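/- Let $d$ be a dimension, let $\mu,\nu,\sigma\ge 0$ satisfy $1>5\mu+6\sigma+2\nu$, and put $\rho=\sigma+\nu+\mu$. For $\hbar\in(0,1]$ let $\phi_\hbar,u_\hbar:\mathbb R^d\to\mathbb C$ be $C^\infty$ functions such that - $\partial_x\phi_\hbar(0)=0$, $\operatorname{Im}\phi_\hbar(0)=0$, and $\operatorname{Im}\phi_\hbar\ge 0$ on $\operatorname{supp}u_\hbar$; - the derivatives of $\phi_\hbar$ of order $n\ge 2$ satisfy $|D^n\phi_\hbar(x)|\le C_n\,\hbar^{-\mu-\nu(n-2)}$ for all $x\in\mathbb R^d$; - the Hessian matrix $\phi_\hbar''(0)$ is invertible and $\|\phi_\hbar''(0)^{-1}\|\le M\hbar^{-\sigma}$; - the derivatives of $u_\hbar$ of order $n\ge0$ satisfy $|D^nu_\hbar(x)|\le A_n\,\hbar^{-\rho n}$ for all $x\in\mathbb R^d$, and $\operatorname{supp}u_\hbar\subset\{|x|\le\varepsilon\hbar^\rho\}$ for some $\varepsilon>0$. Here $C_n,A_n,M$ do not depend on $\hbar$. Set $$I_\hbar=\int_{\mathbb R^d}e^{\frac i\hbar\phi_\hbar(x)}u_\hbar(x)\,dx,\qquad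 g_\hbar(x)=\phi_\hbar(x)-\phi_\hbar(0)-\tfrac12\,\phi_\hbar''(0)x\cdot x,$$ $$\mathscr L_{j,\hbar}f=\sum_{\ell-m=j}\ \sum_{2\ell\ge 3m}\frac{i^{-j}2^{-\ell}}{\ell!\,m!}\big\langle\phi_\hbar''(0)^{-1}D_x,D_x\big\rangle^{\ell}\big(g_\hbar^mf\big),\qquad D_x=\tfrac1i\partial_x .$$ Let $E\mapsto\det^{1/2}E$ be the continuous branch of the square root of the determinant on the set of invertible complex symmetric matrices $E$ with $\operatorname{Re}E\ge0$ that is positive on the real positive definite matrices. (If $\frac1i\phi_\hbar''(0)$ is not in this set, then $u_\hbar$ vanishes to infinite order at $0$, so the sum below is $0$ and the value of $\det^{1/2}$ is irrelevant.) Then there is a threshold $\varepsilon_0>0$, depending only on $d,\mu,\nu,\sigma,C_3,M$, such that, if $\varepsilon\le\varepsilon_0$, for every integer $k\ge1$ and every $\hbar\in(0,1]$ $$\Big|I_\hbar-(2\pi\hbar)^{d/2}\,\frac{e^{\frac i\hbar\phi_\hbar(0)}}{\det^{1/2}\!\big(\frac1i\phi_\hbar''(0)\big)}\sum_{j=0}^{k-1}\hbar^j\,\mathscr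 L_{j,\hbar}u_\hbar(0)\Big|\le K\,\hbar^{(1-5\mu-6\sigma-2\nu)k+\rho d}.$$ The constant $K$ depends only on $d,\mu,\nu,\sigma,k$, on $M$, and on finitely many of the $C_n$ and $A_n$: there is $N=N(d,\mu,\nu,\sigma,k)$ such that only the bounds with $n\le N$ are needed for the estimate with this $k$. -/

import Mathlib

open MeasureTheory

noncomputable section

/-! ### The branch of `det^{1/2}` -/

/-- Invertible complex symmetric matrices whose real part is positive semidefinite, i.e. the
invertible elements of the closure of the set of complex symmetric matrices with positive definite
real part. -/
def dissipativeMatrices (d : ℕ) : Set (Matrix (Fin d) (Fin d) ℂ) :=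
  {E | E.IsSymm ∧ (E.map Complex.re).PosSemidef ∧ E.det ≠ 0}

/-- `s` is the branch of `E ↦ det^{1/2} E` on `dissipativeMatrices d`: it is continuous, squares to
the determinant, and is positive on the real positive definite matrices. -/
structure IsDetSqrtBranch {d : ℕ} (s : Matrix (Fin d) (Fin d) ℂ → ℂ) : Prop where
  continuousOn : ContinuousOn s (dissipativeMatrices d)
  sq_eq : ∀ E ∈ dissipativeMatrices d, s E ^ 2 = E.det
  pos : ∀ R : Matrix (Fin d) (Fin d) ℝ, R.PosDef →
    ∃ r : ℝ, 0 < r ∧ s (R.map Complex.ofReal) = r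

theorem det_segment_ne_zero {d : ℕ} {E : Matrix (Fin d) (Fin d) ℂ}
    (hE : E ∈ dissipativeMatrices d) {t : ℝ} (h0 : 0 ≤ t) (h1 : t ≤ 1) :
    (((1 - t : ℝ) : ℂ) • (1 : Matrix (Fin d) (Fin d) ℂ) + (t : ℂ) • E).det ≠ 0 := by
  obtain ⟨hs, hp, hd⟩ := hE
  rcases h1.eq_or_lt with rfl | h1
  · simpa using hd
  intro h
  obtain ⟨v, hv, hv0⟩ := Matrix.exists_mulVec_eq_zero_iff.mpr h
  apply hv
  have hR := hp.dotProduct_mulVec_nonneg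
  have hx := hR (fun i => (v i).re)
  have hy := hR (fun i => (v i).im)
  have key : (star v ⬝ᵥ ((((1 - t : ℝ) : ℂ) • (1 : Matrix (Fin d) (Fin d) ℂ)
      + (t : ℂ) • E).mulVec v)).re = 0 := by rw [hv0]; simp
  have hE' : (star v ⬝ᵥ E.mulVec v).re =
      star (fun i => (v i).re) ⬝ᵥ (E.map Complex.re).mulVec (fun i => (v i).re)
      + star (fun i => (v i).im) ⬝ᵥ (E.map Complex.re).mulVec (fun i => (v i).im) := by
    have e1 : ∑ i, ∑ j, (v i).re * ((E i j).im * (v j).im)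
        = ∑ i, ∑ j, (v i).im * ((E i j).im * (v j).re) := by
      rw [Finset.sum_comm]
      refine Finset.sum_congr rfl fun i _ => Finset.sum_congr rfl fun j _ => ?_
      rw [hs.apply i j]; ring
    simp only [dotProduct, Matrix.mulVec, Pi.star_apply, Complex.re_sum, Finset.mul_sum,
      Matrix.map_apply, Complex.mul_re, Complex.mul_im, RCLike.star_def, Complex.conj_re,
      Complex.conj_im, star_trivial]
    rw [← Finset.sum_add_distrib, ← sub_eq_zero]
    rw [← sub_eq_zero] at e1
    rw [← neg_eq_zero, ← e1]
    simp only [← Finset.sum_add_distrib, ← Finset.sum_sub_distrib, ← Finset.sum_neg_distrib]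
    refine Finset.sum_congr rfl fun i _ => Finset.sum_congr rfl fun j _ => ?_
    ring
  have hone : (star v ⬝ᵥ v).re = ∑ i, Complex.normSq (v i) := by
    simp [dotProduct, Complex.normSq_apply]
  have hsum : (1 - t) * ∑ i, Complex.normSq (v i) + t * (star v ⬝ᵥ E.mulVec v).re = 0 := by
    rw [← key, ← hone]
    simp [Matrix.add_mulVec, Matrix.smul_mulVec, dotProduct_add, dotProduct_smul]
  have hn : 0 ≤ ∑ i, Complex.normSq (v i) := Finset.sum_nonneg fun i _ => Complex.normSq_nonneg _
  have hz : ∑ i, Complex.normSq (v i) = 0 := by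
    have : 0 ≤ t * (star v ⬝ᵥ E.mulVec v).re := by
      rw [hE']; exact mul_nonneg h0 (add_nonneg hx hy)
    nlinarith
  rw [Finset.sum_eq_zero_iff_of_nonneg fun i _ => Complex.normSq_nonneg _] at hz
  ext i
  exact Complex.normSq_eq_zero.mp (hz i (Finset.mem_univ i))

theorem exists_isDetSqrtBranch (d : ℕ) :
    ∃ s : Matrix (Fin d) (Fin d) ℂ → ℂ, IsDetSqrtBranch s := by
  classical
  let H : C(unitInterval × dissipativeMatrices d, {z : ℂ // z ≠ 0}) :=
    ⟨fun p => ⟨(((1 - (p.1 : ℝ) : ℝ) : ℂ) • (1 : Matrix (Fin d) (Fin d) ℂ)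
      + ((p.1 : ℝ) : ℂ) • (p.2 : Matrix (Fin d) (Fin d) ℂ)).det,
      det_segment_ne_zero p.2.2 p.1.2.1 p.1.2.2⟩, by
      refine Continuous.subtype_mk (Continuous.matrix_det ?_) _
      fun_prop⟩
  have H0 : ∀ a, H (0, a) = ⟨Complex.exp ((ContinuousMap.const _ 0 :
      C(dissipativeMatrices d, ℂ)) a), Complex.exp_ne_zero _⟩ := by
    intro a; apply Subtype.ext; simp [H]
  let L := Complex.isCoveringMap_exp.liftHomotopy H (ContinuousMap.const _ 0) H0
  have hL : ∀ t a, Complex.exp (L (t, a)) = (H (t, a) : ℂ) := fun t a =>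
    congrArg Subtype.val
      (congrFun (Complex.isCoveringMap_exp.liftHomotopy_lifts H (ContinuousMap.const _ 0) H0) (t, a))
  have hL0 : ∀ a, L (0, a) = 0 := fun a =>
    Complex.isCoveringMap_exp.liftHomotopy_zero H (ContinuousMap.const _ 0) H0 a
  refine ⟨fun E => if h : E ∈ dissipativeMatrices d then Complex.exp (L (1, ⟨E, h⟩) / 2) else 0,
    ?_, ?_, ?_⟩
  · rw [continuousOn_iff_continuous_domRestrict]
    have : (dissipativeMatrices d).domRestrict (fun E => if h : E ∈ dissipativeMatrices d then
        Complex.exp (L (1, ⟨E, h⟩) / 2) else 0) = fun E => Complex.exp (L (1, E) / 2) := by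
      ext E; simp [Set.domRestrict]
    rw [this]
    fun_prop
  · intro E hE
    simp only [hE, dif_pos]
    rw [← Complex.exp_nat_mul]
    have := hL 1 ⟨E, hE⟩
    rw [show ((2 : ℕ) : ℂ) * (L (1, ⟨E, hE⟩) / 2) = L (1, ⟨E, hE⟩) by push_cast; ring, this]
    simp [H]
  · intro R hR
    have hE : R.map Complex.ofReal ∈ dissipativeMatrices d := by
      refine ⟨?_, ?_, ?_⟩
      · have := hR.isHermitian
        ext i j
        simpa using this.apply i j
      · have : (R.map Complex.ofReal).map Complex.re = R := by ext; simp
        rw [this]; exact hR.posSemidef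
      · have : (R.map Complex.ofReal).det = (R.det : ℂ) := (Complex.ofRealHom.map_det R).symm
        rw [this]; exact_mod_cast hR.det_pos.ne'
    have hreal : ∀ t : unitInterval, (H (t, ⟨_, hE⟩) : ℂ)
        = ((((1 - (t : ℝ)) • (1 : Matrix (Fin d) (Fin d) ℝ) + (t : ℝ) • R).det : ℝ) : ℂ) := by
      intro t
      rw [← Complex.ofRealHom_eq_coe, Complex.ofRealHom.map_det]
      refine congrArg Matrix.det ?_
      ext i j
      simp [Matrix.one_apply, apply_ite]
    have hpos : ∀ t : unitInterval,
        0 < ((1 - (t : ℝ)) • (1 : Matrix (Fin d) (Fin d) ℝ) + (t : ℝ) • R).det := by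
      intro t
      apply Matrix.PosDef.det_pos
      rcases t.2.2.eq_or_lt with h | h
      · rw [h]; simpa using hR
      · exact (Matrix.PosDef.one.smul (sub_pos.mpr h)).add_posSemidef
          (hR.posSemidef.smul t.2.1)
    have hlift := Complex.isCoveringMap_exp.eq_of_comp_eq
      (g₁ := fun t : unitInterval => L (t, ⟨_, hE⟩))
      (g₂ := fun t : unitInterval => ((Real.log
        ((1 - (t : ℝ)) • (1 : Matrix (Fin d) (Fin d) ℝ) + (t : ℝ) • R).det : ℝ) : ℂ))
      (by fun_prop)
      (Complex.continuous_ofReal.comp (Continuous.log (Continuous.matrix_det (by fun_prop))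
        fun t => (hpos t).ne'))
      (by
        ext t
        simp only [Function.comp_apply]
        rw [hL, hreal, ← Complex.ofReal_exp, Real.exp_log (hpos t)])
      0 (by simp [hL0])
    have h1 := congrFun hlift 1
    refine ⟨Real.exp (Real.log R.det / 2), Real.exp_pos _, ?_⟩
    simp only [hE, dif_pos]
    rw [h1]
    push_cast
    simp

theorem IsDetSqrtBranch.eqOn {d : ℕ} {s s' : Matrix (Fin d) (Fin d) ℂ → ℂ}
    (hs : IsDetSqrtBranch s) (hs' : IsDetSqrtBranch s') :
    Set.EqOn s s' (dissipativeMatrices d) := by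
  intro E hE
  let M : unitInterval → Matrix (Fin d) (Fin d) ℂ := fun t =>
    ((1 - (t : ℝ) : ℝ) : ℂ) • (1 : Matrix (Fin d) (Fin d) ℂ) + ((t : ℝ) : ℂ) • E
  have hM : ∀ t, M t ∈ dissipativeMatrices d := by
    intro t
    refine ⟨?_, ?_, det_segment_ne_zero hE t.2.1 t.2.2⟩
    · simp [M, Matrix.IsSymm, hE.1.eq]
    · have : (M t).map Complex.re = (1 - (t : ℝ)) • (1 : Matrix (Fin d) (Fin d) ℝ)
          + (t : ℝ) • E.map Complex.re := by
        ext i j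
        simp [M, Matrix.one_apply, apply_ite]
      rw [this]
      exact (Matrix.PosSemidef.one.smul (sub_nonneg.mpr t.2.2)).add (hE.2.1.smul t.2.1)
  have hMc : Continuous M := by fun_prop
  have key : ∀ {r : Matrix (Fin d) (Fin d) ℂ → ℂ}, IsDetSqrtBranch r →
      Continuous (fun t => r (M t)) ∧ ∀ t, r (M t) ≠ 0 := fun {r} hr =>
    ⟨hr.continuousOn.comp_continuous hMc hM, fun t h => (hM t).2.2 (by
      rw [← hr.sq_eq _ (hM t), h]; simp)⟩
  have h1 : ∀ {r : Matrix (Fin d) (Fin d) ℂ → ℂ}, IsDetSqrtBranch r → r (M 0) = 1 := by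
    intro r hr
    obtain ⟨x, hx, hx'⟩ := hr.pos 1 Matrix.PosDef.one
    have h0 : M 0 = (1 : Matrix (Fin d) (Fin d) ℝ).map Complex.ofReal := by
      ext i j
      simp [M, Matrix.one_apply, apply_ite]
    have h2 := hr.sq_eq _ (hM 0)
    rw [h0, hx'] at h2
    rw [h0, hx']
    have h3 : x ^ 2 = 1 := by
      have : (x : ℂ) ^ 2 = 1 := by rw [h2, ← h0]; simp [M]
      exact_mod_cast this
    have : x = 1 := by nlinarith
    simp [this]
  have hsq : Set.EqOn ((fun t => s (M t)) ^ 2) ((fun t => s' (M t)) ^ 2) Set.univ := fun t _ => by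
    simp [hs.sq_eq _ (hM t), hs'.sq_eq _ (hM t)]
  have h2 := isPreconnected_univ.eq_of_sq_eq (key hs).1.continuousOn (key hs').1.continuousOn hsq
    (fun {t} _ => (key hs').2 t) (Set.mem_univ 0) ((h1 hs).trans (h1 hs').symm) (Set.mem_univ 1)
  simpa [M] using h2

/-- The branch of `det^{1/2}`. It exists, and it is determined on `dissipativeMatrices d`
(`exists_isDetSqrtBranch`, `IsDetSqrtBranch.eqOn`); its values elsewhere are irrelevant. -/
def detSqrt {d : ℕ} : Matrix (Fin d) (Fin d) ℂ → ℂ :=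
  (exists_isDetSqrtBranch d).choose

theorem isDetSqrtBranch_detSqrt (d : ℕ) : IsDetSqrtBranch (detSqrt (d := d)) :=
  (exists_isDetSqrtBranch d).choose_spec

/-! ### Differential operators -/

/-- The partial derivative `∂f/∂x_i`. -/
def partialDeriv {d : ℕ} (i : Fin d) (f : EuclideanSpace ℝ (Fin d) → ℂ) :
    EuclideanSpace ℝ (Fin d) → ℂ :=
  fun x => fderiv ℝ f x (EuclideanSpace.single i 1)

/-- `D_i = (1/i) ∂/∂x_i`. -/
def opD {d : ℕ} (i : Fin d) (f : EuclideanSpace ℝ (Fin d) → ℂ) : EuclideanSpace ℝ (Fin d) → ℂ :=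
  fun x => (1 / Complex.I) * partialDeriv i f x

/-- The second order operator `⟨B D, D⟩ = ∑_{i,j} B_{ij} D_j D_i`. -/
def quadOp {d : ℕ} (B : Matrix (Fin d) (Fin d) ℂ) (f : EuclideanSpace ℝ (Fin d) → ℂ) :
    EuclideanSpace ℝ (Fin d) → ℂ :=
  fun x => ∑ i, ∑ j, B i j * opD j (opD i f) x

/-- The Hessian matrix of `φ` at the origin. -/
def hessianZero {d : ℕ} (φ : EuclideanSpace ℝ (Fin d) → ℂ) : Matrix (Fin d) (Fin d) ℂ :=
  Matrix.of fun i j => partialDeriv i (partialDeriv j φ) 0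

/-- The remainder `g(x) = φ(x) - φ(0) - ½ φ''(0) x · x` of the phase. -/
def phaseRemainder {d : ℕ} (φ : EuclideanSpace ℝ (Fin d) → ℂ) : EuclideanSpace ℝ (Fin d) → ℂ :=
  fun x => φ x - φ 0 - (1 / 2) * ∑ i, ∑ j, hessianZero φ i j * (x j : ℂ) * (x i : ℂ)

/-- The pairs `(ℓ, m)` of natural numbers with `ℓ - m = j` and `2ℓ ≥ 3m`, see `mem_spIndex`. -/
def spIndex (j : ℕ) : Finset (ℕ × ℕ) :=
  (Finset.range (3 * j + 1) ×ˢ Finset.range (2 * j + 1)).filter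
    fun p => p.1 = p.2 + j ∧ 3 * p.2 ≤ 2 * p.1

theorem mem_spIndex {j : ℕ} {p : ℕ × ℕ} :
    p ∈ spIndex j ↔ p.1 = p.2 + j ∧ 3 * p.2 ≤ 2 * p.1 := by
  simp only [spIndex, Finset.mem_filter, Finset.mem_product, Finset.mem_range]
  omega

/-- The operator `L_j` of the stationary phase expansion with phase `φ`,
`L_j f = ∑_{ℓ-m=j} ∑_{2ℓ≥3m} i^{-j} 2^{-ℓ} / (ℓ! m!) ⟨φ''(0)⁻¹ D, D⟩^ℓ (g^m f)`. -/
def spOp {d : ℕ} (φ : EuclideanSpace ℝ (Fin d) → ℂ) (j : ℕ)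
    (f : EuclideanSpace ℝ (Fin d) → ℂ) : EuclideanSpace ℝ (Fin d) → ℂ :=
  fun x => ∑ p ∈ spIndex j,
    Complex.I ^ (-(j : ℤ)) * (2 : ℂ) ^ (-(p.1 : ℤ)) / ((p.1.factorial : ℂ) * (p.2.factorial : ℂ)) *
      (quadOp (hessianZero φ)⁻¹)^[p.1] (fun y => phaseRemainder φ y ^ p.2 * f y) x

/-! ### The oscillatory integral -/

/-- The oscillatory integral `∫ e^{iφ(x)/h} u(x) dx`. -/
def oscIntegral {d : ℕ} (h : ℝ) (φ u : EuclideanSpace ℝ (Fin d) → ℂ) : ℂ :=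
  ∫ x, Complex.exp (Complex.I / (h : ℂ) * φ x) * u x

/-- The expansion with `k` terms,
`(2πh)^{d/2} e^{iφ(0)/h} / det^{1/2}(φ''(0)/i) · ∑_{j<k} h^j L_j u(0)`. -/
def spExpansion {d : ℕ} (h : ℝ) (φ u : EuclideanSpace ℝ (Fin d) → ℂ) (k : ℕ) : ℂ :=
  (((2 * Real.pi * h) ^ ((d : ℝ) / 2) : ℝ) : ℂ) *
    (Complex.exp (Complex.I / (h : ℂ) * φ 0) /
      detSqrt ((1 / Complex.I) • hessianZero φ)) *
    ∑ j ∈ Finset.range k, (h : ℂ) ^ j * spOp φ j u 0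

/-- The hypotheses on the phase `φ` and the amplitude `u` at a given value `h` of the semiclassical
parameter. `C n` and `A n` are the constants in the bounds on the derivatives of order `n` of the
phase and of the amplitude, `M` is the constant in the bound on the inverse Hessian, and only the
bounds on derivatives of order at most `N` are required. -/
structure SPHypotheses {d : ℕ} (N : ℕ) (μ ν σ ρ ε h : ℝ) (C A : ℕ → ℝ) (M : ℝ)
    (φ u : EuclideanSpace ℝ (Fin d) → ℂ) : Prop where
  phase_smooth : ContDiff ℝ (⊤ : ℕ∞) φ
  amplitude_smooth : ContDiff ℝ (⊤ : ℕ∞) u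
  critical : ∀ i, partialDeriv i φ 0 = 0
  im_nonneg : ∀ x ∈ tsupport u, 0 ≤ (φ x).im
  im_zero : (φ 0).im = 0
  phase_bound : ∀ n, 2 ≤ n → n ≤ N → ∀ x,
    ‖iteratedFDeriv ℝ n φ x‖ ≤ C n * h ^ (-μ - ν * ((n : ℝ) - 2))
  hessian_invertible : IsUnit (hessianZero φ)
  hessian_inv_bound :
    ‖Matrix.toEuclideanCLM (𝕜 := ℂ) (hessianZero φ)⁻¹‖ ≤ M * h ^ (-σ)
  amplitude_bound : ∀ n ≤ N, ∀ x, ‖iteratedFDeriv ℝ n u x‖ ≤ A n * h ^ (-(ρ * n))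
  amplitude_support : tsupport u ⊆ {x | ‖x‖ ≤ ε * h ^ ρ}

end

open FourierTransform

noncomputable section

variable {d : ℕ}

/-! ### Calculus of partial derivatives -/

/-! Substituting `x = r y` with `r = h^ρ` and multiplying the phase by `a = h^(-(2ρ+σ))` makes the
bounds uniform in `h`. The inverse Hessian is bounded, derivatives of order `m ≥ 3` are multiplied
by `h^((σ+μ)(m-3)) ≤ 1`, and the support lies in the ball of radius `ε`. The large parameter becomes
`lam = (a h)⁻¹ = h^(-(1-2ρ-σ))`. The rescaled Hessian may still grow, so only its inverse is ever
estimated. An error `O(lam^(-k))` at this scale suffices: the Jacobian `r^d` supplies `h^(ρ d)`, and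
`1-2ρ-σ = 1-2μ-2ν-3σ` is at least the exponent claimed.

The engine is a non-stationary phase estimate, `OscFactor.exists_norm_integral_le`. The complex
linear field `φ''(0)⁻¹ x · ∂` applied to the quadratic part of the phase gives exactly `|x|²`, and
for small `ε` the remainder `g` changes this by at most half. Integrating by parts along the field
costs a factor `|x|^(-2)` and gains `lam⁻¹`, so an amplitude with a zero of order `2L` at the origin
gives `O(lam^(-L))`.

If `Im φ''(0) ≥ 0`, expand `exp (i lam g)` to order `2k`. In the integral remainder the phases `½
φ''(0) x · x + s g`, `0 ≤ s ≤ 1`, still have nonnegative imaginary part, and `g^(2k) u` has a zero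
of order `6k`; the gain `lam^(-3k)` beats the factor `lam^(2k)` (`exists_norm_taylorRemainder_le`).
Each remaining term is a Gaussian integral. By Parseval it becomes the integral of `exp (-½
E⁻¹ξ·ξ)`, up to normalization, against an inverse Fourier transform, and the Taylor series of this
exponential produces the powers of `⟨φ''(0)⁻¹ D, D⟩` at the origin (`exists_norm_gaussianTerm_le`).
Terms with `2ℓ < 3m` vanish because `g^m u` has a zero of order `3m`, and `sum_rearrange` collects
the others by `j = ℓ - m`.

If `Im φ''(0)` is not positive semidefinite, then `Im φ < 0` on a short ray from the origin, so the
amplitude is flat at the origin. The expansion is zero and the engine alone bounds the integral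
(`exists_norm_integral_sub_le_of_not_posSemidef`). -/

theorem ContDiff.partialDeriv' {F : EuclideanSpace ℝ (Fin d) → ℂ} (hF : ContDiff ℝ (⊤ : ℕ∞) F)
    (i : Fin d) : ContDiff ℝ (⊤ : ℕ∞) (partialDeriv i F) :=
  (hF.fderiv_right (m := (⊤ : ℕ∞)) (by simp)).clm_apply contDiff_const

theorem ContDiff.differentiable_of_top {F : EuclideanSpace ℝ (Fin d) → ℂ}
    (hF : ContDiff ℝ (⊤ : ℕ∞) F) : Differentiable ℝ F :=
  hF.differentiable (by simp)

theorem partialDeriv_const (i : Fin d) (c : ℂ) :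
    partialDeriv i (fun _ : EuclideanSpace ℝ (Fin d) => c) = fun _ => 0 := by
  ext x; simp [partialDeriv]

theorem partialDeriv_add {F G : EuclideanSpace ℝ (Fin d) → ℂ} (hF : Differentiable ℝ F)
    (hG : Differentiable ℝ G) (i : Fin d) :
    partialDeriv i (fun x => F x + G x) = fun x => partialDeriv i F x + partialDeriv i G x := by
  ext x; simp [partialDeriv, fderiv_fun_add (hF x) (hG x)]

theorem partialDeriv_sub {F G : EuclideanSpace ℝ (Fin d) → ℂ} (hF : Differentiable ℝ F)
    (hG : Differentiable ℝ G) (i : Fin d) :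
    partialDeriv i (fun x => F x - G x) = fun x => partialDeriv i F x - partialDeriv i G x := by
  ext x; simp [partialDeriv, fderiv_fun_sub (hF x) (hG x)]

theorem partialDeriv_const_mul {F : EuclideanSpace ℝ (Fin d) → ℂ} (hF : Differentiable ℝ F)
    (c : ℂ) (i : Fin d) :
    partialDeriv i (fun x => c * F x) = fun x => c * partialDeriv i F x := by
  ext x; simp [partialDeriv, fderiv_const_mul (hF x) c]

theorem partialDeriv_mul {F G : EuclideanSpace ℝ (Fin d) → ℂ} (hF : Differentiable ℝ F)
    (hG : Differentiable ℝ G) (i : Fin d) :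
    partialDeriv i (fun x => F x * G x) =
      fun x => partialDeriv i F x * G x + F x * partialDeriv i G x := by
  ext x
  simp [partialDeriv, fderiv_fun_mul (hF x) (hG x)]
  ring

theorem partialDeriv_sum {ι : Type*} (s : Finset ι) {F : ι → EuclideanSpace ℝ (Fin d) → ℂ}
    (hF : ∀ a ∈ s, Differentiable ℝ (F a)) (i : Fin d) :
    partialDeriv i (fun x => ∑ a ∈ s, F a x) = fun x => ∑ a ∈ s, partialDeriv i (F a) x := by
  ext x
  simp [partialDeriv, fderiv_fun_sum fun a ha => hF a ha x]

theorem partialDeriv_comm {F : EuclideanSpace ℝ (Fin d) → ℂ} (hF : ContDiff ℝ (⊤ : ℕ∞) F)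
    (i j : Fin d) : partialDeriv i (partialDeriv j F) = partialDeriv j (partialDeriv i F) := by
  ext x
  have hd : Differentiable ℝ (fderiv ℝ F) :=
    (hF.fderiv_right (m := (⊤ : ℕ∞)) (by simp)).differentiable (by simp)
  have key : ∀ i j : Fin d, partialDeriv i (partialDeriv j F) x =
      fderiv ℝ (fderiv ℝ F) x (EuclideanSpace.single i 1) (EuclideanSpace.single j 1) := by
    intro i j
    change fderiv ℝ (fun y => fderiv ℝ F y (EuclideanSpace.single j 1)) x _ = _
    rw [fderiv_clm_apply (hd x) (differentiableAt_const _)]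
    simp
  rw [key, key]
  exact (hF.contDiffAt.isSymmSndFDerivAt (by
    simp only [minSmoothness_of_isRCLikeNormedField]
    exact WithTop.coe_le_coe.mpr le_top)).eq _ _

theorem hasFDerivAt_coord (j : Fin d) (x : EuclideanSpace ℝ (Fin d)) :
    HasFDerivAt (fun x : EuclideanSpace ℝ (Fin d) => ((x j : ℝ) : ℂ))
      (Complex.ofRealCLM.comp (EuclideanSpace.proj (𝕜 := ℝ) j)) x :=
  (Complex.ofRealCLM.comp (EuclideanSpace.proj (𝕜 := ℝ) j)).hasFDerivAt

theorem contDiff_coord (j : Fin d) :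
    ContDiff ℝ (⊤ : ℕ∞) (fun x : EuclideanSpace ℝ (Fin d) => ((x j : ℝ) : ℂ)) :=
  (Complex.ofRealCLM.comp (EuclideanSpace.proj (𝕜 := ℝ) j)).contDiff

theorem partialDeriv_coord (i j : Fin d) :
    partialDeriv i (fun x : EuclideanSpace ℝ (Fin d) => ((x j : ℝ) : ℂ)) =
      fun _ => if i = j then 1 else 0 := by
  ext x
  rw [partialDeriv, (hasFDerivAt_coord j x).fderiv]
  by_cases h : i = j
  · subst h; simp
  · simp [h, Ne.symm h]

theorem tsupport_partialDeriv_subset (F : EuclideanSpace ℝ (Fin d) → ℂ) (i : Fin d) :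
    tsupport (partialDeriv i F) ⊆ tsupport F :=
  (closure_mono (fun x hx => by
    rw [Function.mem_support] at hx ⊢
    intro h
    exact hx (by simp [partialDeriv, h]))).trans (tsupport_fderiv_subset ℝ)

theorem fderiv_eq_sum_partialDeriv (F : EuclideanSpace ℝ (Fin d) → ℂ)
    (x : EuclideanSpace ℝ (Fin d)) :
    fderiv ℝ F x = ∑ i, (EuclideanSpace.proj (𝕜 := ℝ) i).smulRight (partialDeriv i F x) := by
  ext y
  conv_lhs => rw [← (EuclideanSpace.basisFun (Fin d) ℝ).sum_repr y]
  simp [partialDeriv]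

theorem norm_fderiv_le_sum_partialDeriv (F : EuclideanSpace ℝ (Fin d) → ℂ)
    (x : EuclideanSpace ℝ (Fin d)) : ‖fderiv ℝ F x‖ ≤ ∑ i, ‖partialDeriv i F x‖ := by
  rw [fderiv_eq_sum_partialDeriv]
  refine (norm_sum_le _ _).trans (Finset.sum_le_sum fun i _ => ?_)
  refine ContinuousLinearMap.opNorm_le_bound _ (norm_nonneg _) fun y => ?_
  simp only [ContinuousLinearMap.smulRight_apply, PiLp.proj_apply, norm_smul]
  rw [mul_comm]
  gcongr
  exact PiLp.norm_apply_le y i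

theorem norm_iteratedFDeriv_partialDeriv_le {F : EuclideanSpace ℝ (Fin d) → ℂ}
    (hF : ContDiff ℝ (⊤ : ℕ∞) F) (i : Fin d) (n : ℕ) (x : EuclideanSpace ℝ (Fin d)) :
    ‖iteratedFDeriv ℝ n (partialDeriv i F) x‖ ≤ ‖iteratedFDeriv ℝ (n + 1) F x‖ := by
  have h1 : partialDeriv i F =
      (ContinuousLinearMap.apply ℝ ℂ (EuclideanSpace.single i (1 : ℝ))) ∘ fderiv ℝ F := by
    ext y; rfl
  have hd : ContDiff ℝ (⊤ : ℕ∞) (fderiv ℝ F) := hF.fderiv_right (by simp)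
  rw [h1, ← norm_iteratedFDeriv_fderiv]
  refine (ContinuousLinearMap.norm_iteratedFDeriv_comp_left _ hd.contDiffAt
    (by exact_mod_cast le_top)).trans ?_
  refine mul_le_of_le_one_left (norm_nonneg _) ?_
  refine ContinuousLinearMap.opNorm_le_bound _ zero_le_one fun L => ?_
  simpa using L.le_opNorm (EuclideanSpace.single i (1 : ℝ))

/-- The differential is the sum of the partial derivatives composed with maps of norm at most one.
With the previous bound this allows passage between norms of Fréchet derivatives, in which
hypotheses and Fourier decay are expressed, and iterated partial derivatives, on which the algebra
is done. -/
theorem norm_iteratedFDeriv_succ_le_sum {F : EuclideanSpace ℝ (Fin d) → ℂ}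
    (hF : ContDiff ℝ (⊤ : ℕ∞) F) (n : ℕ) (x : EuclideanSpace ℝ (Fin d)) :
    ‖iteratedFDeriv ℝ (n + 1) F x‖ ≤ ∑ i, ‖iteratedFDeriv ℝ n (partialDeriv i F) x‖ := by
  rw [← norm_iteratedFDeriv_fderiv]
  let T : Fin d → (ℂ →L[ℝ] EuclideanSpace ℝ (Fin d) →L[ℝ] ℂ) := fun i =>
    ContinuousLinearMap.smulRightL ℝ _ _ (EuclideanSpace.proj (𝕜 := ℝ) i)
  have hT : ∀ i, ‖T i‖ ≤ 1 := fun i => by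
    refine ContinuousLinearMap.opNorm_le_bound _ zero_le_one fun z => ?_
    refine ContinuousLinearMap.opNorm_le_bound _ (by positivity) fun y => ?_
    simp only [T, ContinuousLinearMap.smulRightL_apply_apply, one_mul,
      ContinuousLinearMap.smulRight_apply, PiLp.proj_apply, norm_smul]
    rw [mul_comm]
    gcongr
    exact PiLp.norm_apply_le y i
  have h1 : fderiv ℝ F = fun x => ∑ i, (T i ∘ partialDeriv i F) x := by
    ext1 y
    rw [fderiv_eq_sum_partialDeriv]
    rfl
  have hs : ∀ i, ContDiff ℝ n (partialDeriv i F) := fun i =>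
    (hF.partialDeriv' i).of_le (by exact_mod_cast le_top)
  rw [h1, iteratedFDeriv_fun_sum_apply fun i _ => ((T i).contDiff.comp (hs i)).contDiffAt]
  refine (norm_sum_le _ _).trans (Finset.sum_le_sum fun i _ => ?_)
  refine (ContinuousLinearMap.norm_iteratedFDeriv_comp_left _ (hs i).contDiffAt le_rfl).trans ?_
  exact mul_le_of_le_one_left (norm_nonneg _) (hT i)

/-! ### Functions vanishing to a given order at the origin -/

/-- `|F x| ≤ B |x| ^ p` on the unit ball, and correspondingly for the derivatives of `F` of order at
most `n`, each differentiation lowering the exponent by one. -/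
def VanishBound (B : ℝ) : ℕ → ℕ → (EuclideanSpace ℝ (Fin d) → ℂ) → Prop
  | 0, p, F => ∀ x, ‖x‖ ≤ 1 → ‖F x‖ ≤ B * ‖x‖ ^ p
  | n + 1, p, F => (∀ x, ‖x‖ ≤ 1 → ‖F x‖ ≤ B * ‖x‖ ^ p) ∧
      ∀ i, VanishBound B n (p - 1) (partialDeriv i F)

namespace VanishBound

variable {B B' : ℝ} {n p q : ℕ} {F G : EuclideanSpace ℝ (Fin d) → ℂ}

theorem le (h : VanishBound B n p F) {x : EuclideanSpace ℝ (Fin d)} (hx : ‖x‖ ≤ 1) :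
    ‖F x‖ ≤ B * ‖x‖ ^ p := by
  cases n with
  | zero => exact h x hx
  | succ n => exact h.1 x hx

theorem of_le {m : ℕ} (h : VanishBound B n p F) (hm : m ≤ n) : VanishBound B m p F := by
  induction n generalizing m p F with
  | zero => obtain rfl : m = 0 := by omega
            exact h
  | succ n ih =>
    cases m with
    | zero => exact h.1
    | succ m => exact ⟨h.1, fun i => ih (h.2 i) (by omega)⟩

theorem mono (h : VanishBound B n p F) (hB : B ≤ B') (hB' : 0 ≤ B') (hq : q ≤ p) :
    VanishBound B' n q F := by
  have key : ∀ {p q : ℕ} {F : EuclideanSpace ℝ (Fin d) → ℂ}, q ≤ p →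
      (∀ x, ‖x‖ ≤ 1 → ‖F x‖ ≤ B * ‖x‖ ^ p) → ∀ x, ‖x‖ ≤ 1 → ‖F x‖ ≤ B' * ‖x‖ ^ q := by
    intro p q F hq h x hx
    refine (h x hx).trans (mul_le_mul hB ?_ (by positivity) hB')
    exact pow_le_pow_of_le_one (norm_nonneg x) hx hq
  induction n generalizing p q F with
  | zero => exact key hq h
  | succ n ih => exact ⟨key hq h.1, fun i => ih (h.2 i) (by omega)⟩

theorem zero (hB : 0 ≤ B) (n p : ℕ) :
    VanishBound B n p (fun _ : EuclideanSpace ℝ (Fin d) => (0 : ℂ)) := by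
  have h0 : ∀ p : ℕ, ∀ x : EuclideanSpace ℝ (Fin d), ‖x‖ ≤ 1 → ‖(0 : ℂ)‖ ≤ B * ‖x‖ ^ p := by
    intro p x _
    rw [norm_zero]; positivity
  induction n generalizing p with
  | zero => exact h0 p
  | succ n ih => exact ⟨h0 p, fun i => by rw [partialDeriv_const]; exact ih _⟩

theorem const (n : ℕ) (c : ℂ) :
    VanishBound ‖c‖ n 0 (fun _ : EuclideanSpace ℝ (Fin d) => c) := by
  cases n with
  | zero => intro x _; simp
  | succ n => exact ⟨fun x _ => by simp, fun i => by
      rw [partialDeriv_const]; exact zero (norm_nonneg _) _ _⟩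

theorem add (hF : VanishBound B n p F) (hG : VanishBound B' n p G)
    (sF : ContDiff ℝ (⊤ : ℕ∞) F) (sG : ContDiff ℝ (⊤ : ℕ∞) G) :
    VanishBound (B + B') n p (fun x => F x + G x) := by
  induction n generalizing p F G with
  | zero =>
    intro x hx
    rw [add_mul]
    exact (norm_add_le _ _).trans (add_le_add (hF x hx) (hG x hx))
  | succ n ih =>
    refine ⟨fun x hx => ?_, fun i => ?_⟩
    · rw [add_mul]
      exact (norm_add_le _ _).trans (add_le_add (hF.1 x hx) (hG.1 x hx))
    · rw [partialDeriv_add sF.differentiable_of_top sG.differentiable_of_top]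
      exact ih (hF.2 i) (hG.2 i) (sF.partialDeriv' i) (sG.partialDeriv' i)

theorem const_mul (hF : VanishBound B n p F) (sF : ContDiff ℝ (⊤ : ℕ∞) F) (c : ℂ) :
    VanishBound (‖c‖ * B) n p (fun x => c * F x) := by
  induction n generalizing p F with
  | zero =>
    intro x hx
    rw [norm_mul, mul_assoc]
    exact mul_le_mul_of_nonneg_left (hF x hx) (norm_nonneg _)
  | succ n ih =>
    refine ⟨fun x hx => ?_, fun i => ?_⟩
    · rw [norm_mul, mul_assoc]
      exact mul_le_mul_of_nonneg_left (hF.1 x hx) (norm_nonneg _)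
    · rw [partialDeriv_const_mul sF.differentiable_of_top]
      exact ih (hF.2 i) (sF.partialDeriv' i)

theorem sum {ι : Type*} (s : Finset ι) {F : ι → EuclideanSpace ℝ (Fin d) → ℂ} {B : ι → ℝ}
    (hF : ∀ a ∈ s, VanishBound (B a) n p (F a)) (sF : ∀ a ∈ s, ContDiff ℝ (⊤ : ℕ∞) (F a)) :
    VanishBound (∑ a ∈ s, B a) n p (fun x => ∑ a ∈ s, F a x) := by
  classical
  induction s using Finset.induction_on with
  | empty => simpa using zero le_rfl n p
  | insert a s ha ih =>
    simp only [Finset.sum_insert ha]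
    refine (hF a (by simp)).add (ih (fun b hb => hF b (by simp [hb]))
      (fun b hb => sF b (by simp [hb]))) (sF a (by simp)) ?_
    exact ContDiff.sum fun b hb => sF b (by simp [hb])

/-- Leibniz rule: each differentiation produces two products with the same bound, so the constant
doubles at each order. -/
theorem mul (hF : VanishBound B n p F) (hG : VanishBound B' n q G) (hB : 0 ≤ B) (hB' : 0 ≤ B')
    (sF : ContDiff ℝ (⊤ : ℕ∞) F) (sG : ContDiff ℝ (⊤ : ℕ∞) G) :
    VanishBound (2 ^ n * (B * B')) n (p + q) (fun x => F x * G x) := by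
  have key : ∀ {p q n n' : ℕ} {F G : EuclideanSpace ℝ (Fin d) → ℂ}, VanishBound B n p F →
      VanishBound B' n q G → ∀ x, ‖x‖ ≤ 1 →
      ‖F x * G x‖ ≤ (2 ^ n' * (B * B')) * ‖x‖ ^ (p + q) := by
    intro p q n n' F G hF hG x hx
    calc ‖F x * G x‖ = ‖F x‖ * ‖G x‖ := norm_mul _ _
      _ ≤ (B * ‖x‖ ^ p) * (B' * ‖x‖ ^ q) :=
        mul_le_mul (hF.le hx) (hG.le hx) (norm_nonneg _) (by positivity)
      _ = 1 * ((B * B') * ‖x‖ ^ (p + q)) := by ring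
      _ ≤ 2 ^ n' * ((B * B') * ‖x‖ ^ (p + q)) := by
        gcongr
        exact one_le_pow₀ (by norm_num)
      _ = _ := by ring
  induction n generalizing p q F G with
  | zero => exact key hF hG
  | succ n ih =>
    refine ⟨key hF hG, fun i => ?_⟩
    rw [partialDeriv_mul sF.differentiable_of_top sG.differentiable_of_top]
    have h1 := ih (hF.2 i) (hG.of_le n.le_succ) (sF.partialDeriv' i) sG
    have h2 := ih (hF.of_le n.le_succ) (hG.2 i) sF (sG.partialDeriv' i)
    have hb : (0 : ℝ) ≤ 2 ^ n * (B * B') := by positivity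
    -- Truncated subtraction is harmless here: `(p - 1) + q` and `p + (q - 1)` are at least `p + q -
    -- 1` even when an exponent is already zero.
    refine ((h1.mono le_rfl hb (by omega : p + q - 1 ≤ _)).add
      (h2.mono le_rfl hb (by omega : p + q - 1 ≤ _))
      ((sF.partialDeriv' i).mul sG) (sF.mul (sG.partialDeriv' i))).mono
      (le_of_eq (by ring)) (by positivity) le_rfl

theorem pow (hF : VanishBound B n p F) (hB : 0 ≤ B) (sF : ContDiff ℝ (⊤ : ℕ∞) F) (m : ℕ) :
    VanishBound ((2 ^ n * B) ^ m) n (p * m) (fun x => F x ^ m) := by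
  induction m with
  | zero => simpa using const (d := d) n 1
  | succ m ih =>
    simp only [pow_succ (F _)]
    refine (ih.mul hF (by positivity) hB (sF.pow m) sF).mono (le_of_eq (by ring))
      (by positivity) (by rw [Nat.mul_succ])

theorem coord (n : ℕ) (j : Fin d) :
    VanishBound 1 n 1 (fun x : EuclideanSpace ℝ (Fin d) => ((x j : ℝ) : ℂ)) := by
  have h : ∀ x : EuclideanSpace ℝ (Fin d), ‖x‖ ≤ 1 → ‖((x j : ℝ) : ℂ)‖ ≤ 1 * ‖x‖ ^ 1 := by
    intro x _
    rw [Complex.norm_real]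
    simpa using PiLp.norm_apply_le x j
  cases n with
  | zero => exact h
  | succ n =>
    refine ⟨h, fun i => ?_⟩
    rw [partialDeriv_coord]
    refine (const n _).mono ?_ zero_le_one le_rfl
    split_ifs <;> simp

theorem of_iteratedFDeriv (sF : ContDiff ℝ (⊤ : ℕ∞) F)
    (h : ∀ m ≤ n, ∀ x, ‖x‖ ≤ 1 → ‖iteratedFDeriv ℝ m F x‖ ≤ B) : VanishBound B n 0 F := by
  have key : ∀ {n : ℕ} {F : EuclideanSpace ℝ (Fin d) → ℂ},
      (∀ m ≤ n, ∀ x, ‖x‖ ≤ 1 → ‖iteratedFDeriv ℝ m F x‖ ≤ B) →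
      ∀ x, ‖x‖ ≤ 1 → ‖F x‖ ≤ B * ‖x‖ ^ 0 := by
    intro n F h x hx
    simpa using h 0 (by omega) x hx
  induction n generalizing F with
  | zero => exact key h
  | succ n ih =>
    exact ⟨key h, fun i => ih (sF.partialDeriv' i) fun m hm x hx =>
      (norm_iteratedFDeriv_partialDeriv_le sF i m x).trans (h (m + 1) (by omega) x hx)⟩

theorem norm_iteratedFDeriv_le (hF : VanishBound B n p F) (sF : ContDiff ℝ (⊤ : ℕ∞) F)
    (hB : 0 ≤ B) {m : ℕ} (hm : m ≤ n) {x : EuclideanSpace ℝ (Fin d)} (hx : ‖x‖ ≤ 1) :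
    ‖iteratedFDeriv ℝ m F x‖ ≤ d ^ m * B := by
  induction m generalizing n p F with
  | zero =>
    have := (hF.mono le_rfl hB (Nat.zero_le p)).le hx
    simpa using this
  | succ m ih =>
    obtain ⟨n, rfl⟩ : ∃ n', n = n' + 1 := ⟨n - 1, by omega⟩
    refine (norm_iteratedFDeriv_succ_le_sum sF m x).trans ?_
    refine (Finset.sum_le_sum fun i _ => ih (hF.2 i) (sF.partialDeriv' i) (by omega)).trans ?_
    simp [pow_succ]
    exact le_of_eq (by ring)

/-- Mean value inequality on the ball of radius `‖x‖`: a zero at the origin raises the order by one.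
Iterating it turns vanishing of successive derivatives into a zero of high order. -/
theorem of_partialDeriv (sF : ContDiff ℝ (⊤ : ℕ∞) F) (h0 : F 0 = 0) (hB : 0 ≤ B)
    (h : ∀ i, VanishBound B n p (partialDeriv i F)) :
    VanishBound (B + d * B) (n + 1) (p + 1) F := by
  have hd : (0 : ℝ) ≤ d * B := by positivity
  refine ⟨fun x hx => ?_, fun i => (h i).mono (by linarith) (by positivity) (by simp)⟩
  have key : ‖F x - F 0‖ ≤ (d * B * ‖x‖ ^ p) * ‖x - 0‖ := by
    refine Convex.norm_image_sub_le_of_norm_fderiv_le (𝕜 := ℝ) (s := Metric.closedBall 0 ‖x‖)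
      (fun y _ => sF.differentiable_of_top y) (fun y hy => ?_) (convex_closedBall _ _)
      (by simp) (by simp)
    have hy' : ‖y‖ ≤ ‖x‖ := by simpa using hy
    refine (norm_fderiv_le_sum_partialDeriv F y).trans ?_
    refine (Finset.sum_le_sum fun i _ => (h i).le (hy'.trans hx)).trans ?_
    simp only [Finset.sum_const, Finset.card_univ, Fintype.card_fin, nsmul_eq_mul, mul_assoc]
    gcongr
  rw [h0, sub_zero, sub_zero] at key
  refine key.trans ?_
  rw [mul_assoc, ← pow_succ]
  gcongr
  linarith

end VanishBound

/-! ### Integration by parts along a linear vector field -/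

/-- The derivative of `F` along the linear vector field `x ↦ S x`. -/
def linField (S : Matrix (Fin d) (Fin d) ℂ) (F : EuclideanSpace ℝ (Fin d) → ℂ) :
    EuclideanSpace ℝ (Fin d) → ℂ :=
  fun x => ∑ i, (∑ j, S i j * ((x j : ℝ) : ℂ)) * partialDeriv i F x

theorem contDiff_linear_coord (a : Fin d → ℂ) : ContDiff ℝ (⊤ : ℕ∞)
    (fun x : EuclideanSpace ℝ (Fin d) => ∑ j, a j * ((x j : ℝ) : ℂ)) :=
  ContDiff.sum fun j _ => contDiff_const.mul (contDiff_coord j)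

theorem partialDeriv_linear_coord (a : Fin d → ℂ) (i : Fin d) :
    partialDeriv i (fun x : EuclideanSpace ℝ (Fin d) => ∑ j, a j * ((x j : ℝ) : ℂ)) =
      fun _ => a i := by
  rw [partialDeriv_sum _ fun j _ => (contDiff_const.mul (contDiff_coord j)).differentiable_of_top]
  ext x
  simp only [partialDeriv_const_mul (contDiff_coord _).differentiable_of_top, partialDeriv_coord]
  simp

theorem ContDiff.linField {F : EuclideanSpace ℝ (Fin d) → ℂ} (hF : ContDiff ℝ (⊤ : ℕ∞) F)
    (S : Matrix (Fin d) (Fin d) ℂ) : ContDiff ℝ (⊤ : ℕ∞) (linField S F) :=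
  ContDiff.sum fun i _ => (contDiff_linear_coord (S i)).mul (hF.partialDeriv' i)

theorem linField_eq_zero_of_notMem {F : EuclideanSpace ℝ (Fin d) → ℂ}
    (S : Matrix (Fin d) (Fin d) ℂ) {x : EuclideanSpace ℝ (Fin d)} (hx : x ∉ tsupport F) :
    linField S F x = 0 :=
  Finset.sum_eq_zero fun i _ => by
    rw [image_eq_zero_of_notMem_tsupport fun h => hx (tsupport_partialDeriv_subset F i h), mul_zero]

theorem tsupport_linField_subset (S : Matrix (Fin d) (Fin d) ℂ)
    (F : EuclideanSpace ℝ (Fin d) → ℂ) : tsupport (linField S F) ⊆ tsupport F :=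
  closure_minimal (fun x hx => by
    by_contra h
    exact hx (linField_eq_zero_of_notMem S h)) (isClosed_tsupport F)

theorem VanishBound.linear_coord {M : ℝ} {a : Fin d → ℂ} (ha : ∀ j, ‖a j‖ ≤ M) (n : ℕ) :
    VanishBound (d * M) n 1
      (fun x : EuclideanSpace ℝ (Fin d) => ∑ j, a j * ((x j : ℝ) : ℂ)) := by
  have h0 : 0 ≤ d * M := by
    cases d with
    | zero => simp
    | succ d => exact mul_nonneg (by positivity) ((norm_nonneg _).trans (ha 0))
  refine (VanishBound.sum _ (fun j _ => (VanishBound.coord n j).const_mul (contDiff_coord j) (a j))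
    fun j _ => contDiff_const.mul (contDiff_coord j)).mono ?_ h0 le_rfl
  refine (Finset.sum_le_sum fun j _ => (by simpa using ha j)).trans (b := ∑ _j : Fin d, M) ?_
  simp

/-- The linear coefficients restore the order lost by differentiation. Since the order of vanishing
is preserved, the integration by parts can be iterated. -/
theorem VanishBound.linField {M B : ℝ} {n p : ℕ} {F : EuclideanSpace ℝ (Fin d) → ℂ}
    {S : Matrix (Fin d) (Fin d) ℂ} (hM : 0 ≤ M) (hB : 0 ≤ B) (hS : ∀ i j, ‖S i j‖ ≤ M)
    (hF : VanishBound B (n + 1) p F) (sF : ContDiff ℝ (⊤ : ℕ∞) F) :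
    VanishBound (d * (2 ^ n * (d * M * B))) n p (linField S F) := by
  have h0 : 0 ≤ 2 ^ n * (d * M * B) := by positivity
  refine (VanishBound.sum _ (fun i _ => ((VanishBound.linear_coord (hS i) n).mul (hF.2 i)
    (by positivity) hB (contDiff_linear_coord _) (sF.partialDeriv' i)).mono le_rfl h0
    (by omega : p ≤ 1 + (p - 1)))
    fun i _ => (contDiff_linear_coord _).mul (sF.partialDeriv' i)).mono ?_ (by positivity) le_rfl
  simp

theorem integral_partialDeriv_eq_zero {f : EuclideanSpace ℝ (Fin d) → ℂ}
    (hf : ContDiff ℝ (⊤ : ℕ∞) f) (hc : HasCompactSupport f) (i : Fin d) :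
    ∫ x, partialDeriv i f x = 0 := by
  have hi : Integrable f := hf.continuous.integrable_of_hasCompactSupport hc
  have hi' : Integrable (partialDeriv i f) :=
    (hf.partialDeriv' i).continuous.integrable_of_hasCompactSupport
      (hc.of_isClosed_subset (isClosed_tsupport _) (tsupport_partialDeriv_subset f i))
  have := integral_mul_fderiv_eq_neg_fderiv_mul_of_integrable (𝕜 := ℂ) (μ := volume)
    (f := fun _ : EuclideanSpace ℝ (Fin d) => (1 : ℂ)) (g := f)
    (v := EuclideanSpace.single i (1 : ℝ)) (by simp)
    (by simp only [one_mul]; exact hi') (by simpa only [one_mul] using hi)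
    (fun _ _ => differentiableAt_const _) (fun x _ => hf.differentiable_of_top x)
  simpa [partialDeriv] using this

/-- The integrand is the divergence of the compactly supported field `f(x) S x`. -/
theorem integral_divergence_linField {f : EuclideanSpace ℝ (Fin d) → ℂ}
    (hf : ContDiff ℝ (⊤ : ℕ∞) f) (hc : HasCompactSupport f) (S : Matrix (Fin d) (Fin d) ℂ) :
    ∫ x, (S.trace * f x + linField S f x) = 0 := by
  have h1 : ∀ x, S.trace * f x + linField S f x =
      ∑ i, partialDeriv i (fun y => (∑ j, S i j * ((y j : ℝ) : ℂ)) * f y) x := by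
    intro x
    simp only [partialDeriv_mul (contDiff_linear_coord _).differentiable_of_top
      hf.differentiable_of_top, partialDeriv_linear_coord, Finset.sum_add_distrib]
    simp [linField, Matrix.trace, Finset.sum_mul]
  have hs : ∀ i, ContDiff ℝ (⊤ : ℕ∞)
      (fun y : EuclideanSpace ℝ (Fin d) => (∑ j, S i j * ((y j : ℝ) : ℂ)) * f y) :=
    fun i => (contDiff_linear_coord _).mul hf
  have hcs : ∀ i, HasCompactSupport
      (fun y : EuclideanSpace ℝ (Fin d) => (∑ j, S i j * ((y j : ℝ) : ℂ)) * f y) :=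
    fun i => hc.mul_left
  simp_rw [h1]
  rw [integral_finsetSum]
  · exact Finset.sum_eq_zero fun i _ => integral_partialDeriv_eq_zero (hs i) (hcs i) i
  · intro i _
    exact ((hs i).partialDeriv' i).continuous.integrable_of_hasCompactSupport
      ((hcs i).of_isClosed_subset (isClosed_tsupport _) (tsupport_partialDeriv_subset _ i))

/-- Off the support of `F` the quotient is locally zero, so zeros of `β` there do no harm. -/
theorem contDiff_div_pow {F β : EuclideanSpace ℝ (Fin d) → ℂ} {T : Set (EuclideanSpace ℝ (Fin d))}
    (sF : ContDiff ℝ (⊤ : ℕ∞) F) (sβ : ContDiff ℝ (⊤ : ℕ∞) β) (hT : tsupport F ⊆ T)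
    (hβ : ∀ x ∈ T, β x ≠ 0) (j : ℕ) : ContDiff ℝ (⊤ : ℕ∞) (fun x => F x / β x ^ j) := by
  rw [contDiff_iff_contDiffAt]
  intro x
  by_cases hx : x ∈ tsupport F
  · simp only [div_eq_mul_inv]
    exact sF.contDiffAt.mul ((sβ.pow j).contDiffAt.inv (pow_ne_zero _ (hβ x (hT hx))))
  · have : (fun x => F x / β x ^ j) =ᶠ[nhds x] fun _ => 0 := by
      filter_upwards [notMem_tsupport_iff_eventuallyEq.mp hx] with y hy
      simp [hy]
    exact contDiffAt_const.congr_of_eventuallyEq this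

theorem linField_mul_div_pow {e F β : EuclideanSpace ℝ (Fin d) → ℂ}
    {T : Set (EuclideanSpace ℝ (Fin d))} (se : ContDiff ℝ (⊤ : ℕ∞) e)
    (sF : ContDiff ℝ (⊤ : ℕ∞) F) (sβ : ContDiff ℝ (⊤ : ℕ∞) β) (hT : tsupport F ⊆ T)
    (hβ : ∀ x ∈ T, β x ≠ 0) (S : Matrix (Fin d) (Fin d) ℂ) (j : ℕ)
    (x : EuclideanSpace ℝ (Fin d)) :
    linField S (fun y => e y * (F y / β y ^ (j + 1))) x =
      linField S e x * (F x / β x ^ (j + 1)) + e x * (linField S F x / β x ^ (j + 1))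
        - (j + 1) * (e x * (F x * linField S β x / β x ^ (j + 2))) := by
  have alg : ∀ (c a f g : Fin d → ℂ) (q e r F k s : ℂ),
      ∑ i, c i * (a i * q + e * (f i / r - k * (F * g i / s))) =
        (∑ i, c i * a i) * q + e * ((∑ i, c i * f i) / r)
          - k * (e * (F * (∑ i, c i * g i) / s)) := by
    intro c a f g q e r F k s
    simp only [Finset.sum_mul, Finset.mul_sum, Finset.sum_div]
    rw [← Finset.sum_add_distrib, ← Finset.sum_sub_distrib]
    exact Finset.sum_congr rfl fun i _ => by ring
  have sq := contDiff_div_pow sF sβ hT hβ (j + 1)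
  have key : ∀ i, partialDeriv i (fun y => F y / β y ^ (j + 1)) x =
      partialDeriv i F x / β x ^ (j + 1)
        - (j + 1) * (F x * partialDeriv i β x / β x ^ (j + 2)) := by
    intro i
    by_cases hx : x ∈ tsupport F
    · have h0 := hβ x (hT hx)
      -- The product rule for `F = (F / β^(j+1)) · β^(j+1)`, valid near `x`, is solved for the
      -- derivative of the quotient.
      have h1 : partialDeriv i F x =
          partialDeriv i (fun y => F y / β y ^ (j + 1)) x * β x ^ (j + 1) +
            (F x / β x ^ (j + 1)) * partialDeriv i (fun y => β y ^ (j + 1)) x := by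
        have h2 : F =ᶠ[nhds x] fun y => (F y / β y ^ (j + 1)) * β y ^ (j + 1) := by
          filter_upwards [sβ.continuous.continuousAt.eventually_ne h0] with y hy
          rw [div_mul_cancel₀ _ (pow_ne_zero _ hy)]
        have h3 : partialDeriv i F x =
            partialDeriv i (fun y => (F y / β y ^ (j + 1)) * β y ^ (j + 1)) x := by
          simp only [partialDeriv, h2.fderiv_eq]
        rw [h3, partialDeriv_mul sq.differentiable_of_top (sβ.pow _).differentiable_of_top]
      have h4 : partialDeriv i (fun y => β y ^ (j + 1)) x =
          (j + 1) * β x ^ j * partialDeriv i β x := by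
        simp [partialDeriv, fderiv_fun_pow (j + 1) (sβ.differentiable_of_top x)]
      rw [h1, h4]
      field_simp
      ring
    · have hF : F x = 0 := image_eq_zero_of_notMem_tsupport hx
      have hF' : partialDeriv i F x = 0 :=
        image_eq_zero_of_notMem_tsupport fun h => hx (tsupport_partialDeriv_subset F i h)
      have : (fun y => F y / β y ^ (j + 1)) =ᶠ[nhds x] fun _ => 0 := by
        filter_upwards [notMem_tsupport_iff_eventuallyEq.mp hx] with y hy
        simp [hy]
      have h0 : partialDeriv i (fun y => F y / β y ^ (j + 1)) x = 0 := by
        simp [partialDeriv, this.fderiv_eq]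
      rw [h0, hF, hF']
      simp
  simp only [linField, partialDeriv_mul se.differentiable_of_top sq.differentiable_of_top, key]
  exact alg _ _ _ _ _ _ _ _ _ _

/-! ### Non-stationary phase -/

/-- `e` is an oscillating factor `exp (i lam ψ)`, bounded by one on the compact set `T`, and
`b = linField S ψ` is comparable to `|x|²` on `T`. -/
structure OscFactor (S : Matrix (Fin d) (Fin d) ℂ) (lam : ℝ) (T : Set (EuclideanSpace ℝ (Fin d)))
    (e b : EuclideanSpace ℝ (Fin d) → ℂ) : Prop where
  closed : IsClosed T
  subset : T ⊆ Metric.closedBall 0 1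
  smooth : ContDiff ℝ (⊤ : ℕ∞) e
  smooth_b : ContDiff ℝ (⊤ : ℕ∞) b
  norm_le : ∀ x ∈ T, ‖e x‖ ≤ 1
  linField_eq : ∀ x, linField S e x = Complex.I * lam * b x * e x
  re_ge : ∀ x ∈ T, ‖x‖ ^ 2 / 2 ≤ (b x).re

namespace OscFactor

variable {S : Matrix (Fin d) (Fin d) ℂ} {lam : ℝ} {T : Set (EuclideanSpace ℝ (Fin d))}
  {e b F : EuclideanSpace ℝ (Fin d) → ℂ}

theorem isCompact (h : OscFactor S lam T e b) : IsCompact T :=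
  (isCompact_closedBall _ _).of_isClosed_subset h.closed h.subset

theorem norm_add_ge (h : OscFactor S lam T e b) (δ : ℝ)
    {x : EuclideanSpace ℝ (Fin d)} (hx : x ∈ T) : ‖x‖ ^ 2 / 2 + δ ≤ ‖b x + δ‖ := by
  refine le_trans ?_ (Complex.re_le_norm _)
  simpa using h.re_ge x hx

theorem add_ne_zero (h : OscFactor S lam T e b) {δ : ℝ} (hδ : 0 < δ)
    {x : EuclideanSpace ℝ (Fin d)} (hx : x ∈ T) : b x + δ ≠ 0 := by
  have := h.norm_add_ge δ hx
  rw [← norm_pos_iff]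
  have h2 := sq_nonneg ‖x‖
  linarith

theorem contDiff_mul_div (h : OscFactor S lam T e b) {δ : ℝ} (hδ : 0 < δ)
    (sF : ContDiff ℝ (⊤ : ℕ∞) F) (hF : tsupport F ⊆ T) (j : ℕ) :
    ContDiff ℝ (⊤ : ℕ∞) (fun x => e x * (F x / (b x + δ) ^ j)) :=
  h.smooth.mul (contDiff_div_pow sF (h.smooth_b.add contDiff_const) hF
    (fun _ hx => h.add_ne_zero hδ hx) j)

theorem hasCompactSupport_mul_div (h : OscFactor S lam T e b) (δ : ℝ)
    (hF : tsupport F ⊆ T) (j : ℕ) :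
    HasCompactSupport (fun x => e x * (F x / (b x + δ) ^ j)) :=
  HasCompactSupport.intro h.isCompact fun x hx => by
    simp [image_eq_zero_of_notMem_tsupport fun h' => hx (hF h')]

theorem integrable_mul_div (h : OscFactor S lam T e b) {δ : ℝ} (hδ : 0 < δ)
    (sF : ContDiff ℝ (⊤ : ℕ∞) F) (hF : tsupport F ⊆ T) (j : ℕ) :
    Integrable (fun x => e x * (F x / (b x + δ) ^ j)) :=
  (h.contDiff_mul_div hδ sF hF j).continuous.integrable_of_hasCompactSupport
    (h.hasCompactSupport_mul_div δ hF j)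

/-- On `T` the denominator dominates `‖x‖² / 2`, so a zero of order `2 j` cancels its `j`-th power.
The bound is independent of `δ`. -/
theorem norm_integral_le_of_two_mul_le (h : OscFactor S lam T e b) {δ B : ℝ} (hδ : 0 < δ)
    {n j p : ℕ} (hp : 2 * j ≤ p) (hB : 0 ≤ B) (hF : tsupport F ⊆ T) (vF : VanishBound B n p F) :
    ‖∫ x, e x * (F x / (b x + δ) ^ j)‖ ≤
      B * 2 ^ j * volume.real (Metric.closedBall (0 : EuclideanSpace ℝ (Fin d)) 1) := by
  have h1 : ∀ x, x ∉ T → e x * (F x / (b x + δ) ^ j) = 0 := fun x hx => by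
    simp [image_eq_zero_of_notMem_tsupport fun h' => hx (hF h')]
  rw [← setIntegral_eq_integral_of_forall_compl_eq_zero
    (s := Metric.closedBall (0 : EuclideanSpace ℝ (Fin d)) 1)
    fun x hx => h1 x fun h' => hx (h.subset h')]
  refine norm_setIntegral_le_of_norm_le_const (isCompact_closedBall _ _).measure_lt_top ?_
  intro x hx
  by_cases hxT : x ∈ T
  · have hx1 : ‖x‖ ≤ 1 := by simpa using hx
    have hβ := h.norm_add_ge δ hxT
    have hβ0 : 0 < ‖b x + δ‖ := norm_pos_iff.mpr (h.add_ne_zero hδ hxT)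
    rw [norm_mul, norm_div, norm_pow]
    refine (mul_le_of_le_one_left (by positivity) (h.norm_le x hxT)).trans ?_
    rw [div_le_iff₀ (by positivity)]
    calc ‖F x‖ ≤ B * ‖x‖ ^ p := vF.le hx1
      _ ≤ B * ‖x‖ ^ (2 * j) :=
        mul_le_mul_of_nonneg_left (pow_le_pow_of_le_one (norm_nonneg _) hx1 hp) hB
      _ = B * 2 ^ j * (‖x‖ ^ 2 / 2) ^ j := by rw [div_pow, pow_mul]; field_simp
      _ ≤ B * 2 ^ j * ‖b x + δ‖ ^ j := by
        gcongr
        linarith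
  · rw [h1 x hxT, norm_zero]; positivity

/-- The divergence identity for `e F / (b + δ)^(j+1)`. Differentiating `e` produces `i lam b`, and
writing `b = (b + δ) - δ` lowers the power of the denominator by one, at the price of the last term.
The shift `δ` is there because `b` vanishes at the origin. -/
theorem integral_step (h : OscFactor S lam T e b) {δ : ℝ} (hδ : 0 < δ)
    (sF : ContDiff ℝ (⊤ : ℕ∞) F) (hF : tsupport F ⊆ T) (j : ℕ) :
    Complex.I * lam * ∫ x, e x * (F x / (b x + δ) ^ j) =
      (j + 1) * (∫ x, e x * (F x * linField S b x / (b x + δ) ^ (j + 2)))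
      - S.trace * (∫ x, e x * (F x / (b x + δ) ^ (j + 1)))
      - (∫ x, e x * (linField S F x / (b x + δ) ^ (j + 1)))
      + Complex.I * lam * (δ * ∫ x, e x * (F x / (b x + δ) ^ (j + 1))) := by
  have sβ : ContDiff ℝ (⊤ : ℕ∞) (fun x => b x + (δ : ℂ)) := h.smooth_b.add contDiff_const
  have hβ : ∀ x ∈ T, b x + (δ : ℂ) ≠ 0 := fun x hx => h.add_ne_zero hδ hx
  have hWb : linField S (fun x => b x + (δ : ℂ)) = linField S b := by
    ext x
    simp [linField, partialDeriv]
  have h0 := integral_divergence_linField (h.contDiff_mul_div hδ sF hF (j + 1))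
    (h.hasCompactSupport_mul_div δ hF (j + 1)) S
  have hFb : tsupport (fun x => F x * linField S b x) ⊆ T :=
    (tsupport_mul_subset_left).trans hF
  have i0 := h.integrable_mul_div hδ sF hF j
  have i1 := h.integrable_mul_div hδ sF hF (j + 1)
  have i2 := h.integrable_mul_div hδ (sF.linField S) ((tsupport_linField_subset S F).trans hF)
    (j + 1)
  have i3 := h.integrable_mul_div hδ (sF.mul (h.smooth_b.linField S)) hFb (j + 2)
  have key : ∀ x, S.trace * (e x * (F x / (b x + δ) ^ (j + 1))) +
      linField S (fun y => e y * (F y / (b y + δ) ^ (j + 1))) x =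
      S.trace * (e x * (F x / (b x + δ) ^ (j + 1))) +
      (Complex.I * lam * (e x * (F x / (b x + δ) ^ j))
        - Complex.I * lam * δ * (e x * (F x / (b x + δ) ^ (j + 1)))
        + e x * (linField S F x / (b x + δ) ^ (j + 1))
        - (j + 1) * (e x * (F x * linField S b x / (b x + δ) ^ (j + 2)))) := by
    intro x
    rw [linField_mul_div_pow h.smooth sF sβ hF hβ, hWb, h.linField_eq]
    by_cases hx : x ∈ T
    · have := hβ x hx
      have e1 : F x / (b x + δ) ^ j = (b x + δ) * (F x / (b x + δ) ^ (j + 1)) := by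
        rw [pow_succ]
        field_simp
      rw [e1]
      ring
    · simp [image_eq_zero_of_notMem_tsupport fun h' => hx (hF h')]
  simp_rw [key] at h0
  have j0 := i0.const_mul (Complex.I * lam)
  have j1 := i1.const_mul (Complex.I * lam * δ)
  have j3 := i3.const_mul ((j : ℂ) + 1)
  rw [integral_add (i1.const_mul _), integral_sub _ j3, integral_add _ i2, integral_sub j0 j1] at h0
  rotate_left
  · exact j0.sub j1
  · exact (j0.sub j1).add i2
  · exact ((j0.sub j1).add i2).sub j3
  simp only [integral_const_mul] at h0
  linear_combination h0

/-- Induction on the number of integrations by parts, with invariant `2 j + 2 L ≤ p`. One step gains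
`lam⁻¹` and lowers `L` by one. Either `j` grows by one with `p` unchanged, or `j` grows by two with
`p` growing by two because the derivative of `b` has a zero of order two. The invariant survives in
both cases. -/
theorem norm_integral_div_le (d : ℕ) {M b₀ : ℝ} (hM : 0 ≤ M) (hb₀ : 0 ≤ b₀) (L : ℕ) :
    ∀ j p : ℕ, 2 * j + 2 * L ≤ p → ∀ B : ℝ, 0 ≤ B → ∃ K : ℝ, 0 ≤ K ∧
      ∀ (S : Matrix (Fin d) (Fin d) ℂ) (lam : ℝ) (T : Set (EuclideanSpace ℝ (Fin d)))
        (e b F : EuclideanSpace ℝ (Fin d) → ℂ) (δ : ℝ), OscFactor S lam T e b → 1 ≤ lam →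
        0 < δ → (∀ i j, ‖S i j‖ ≤ M) → VanishBound b₀ (L + 1) 2 b → ContDiff ℝ (⊤ : ℕ∞) F →
        tsupport F ⊆ T → VanishBound B L p F →
        ‖∫ x, e x * (F x / (b x + δ) ^ j)‖ ≤ K * ((lam⁻¹) ^ L + δ) := by
  set V := volume.real (Metric.closedBall (0 : EuclideanSpace ℝ (Fin d)) 1) with hV
  have hV0 : 0 ≤ V := measureReal_nonneg
  induction L with
  | zero =>
    intro j p hp B hB
    refine ⟨B * 2 ^ j * V, by positivity, fun S lam T e b F δ h _ hδ _ _ _ hF vF => ?_⟩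
    refine (h.norm_integral_le_of_two_mul_le hδ (by omega) hB hF vF).trans ?_
    refine le_mul_of_one_le_right (by positivity) ?_
    simp [hδ.le]
  | succ L ih =>
    intro j p hp B hB
    set B1 := d * (2 ^ L * (d * M * B))
    set B2 := 2 ^ L * (B * (d * (2 ^ (L + 1) * (d * M * b₀))))
    have hB1 : 0 ≤ B1 := by positivity
    have hB2 : 0 ≤ B2 := by positivity
    obtain ⟨K1, hK1, H1⟩ := ih (j + 1) p (by omega) B hB
    obtain ⟨K2, hK2, H2⟩ := ih (j + 1) p (by omega) B1 hB1
    obtain ⟨K3, hK3, H3⟩ := ih (j + 2) (p + 2) (by omega) B2 hB2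
    refine ⟨(j + 1) * K3 + d * M * K1 + K2 + B * 2 ^ (j + 1) * V, by positivity, ?_⟩
    intro S lam T e b F δ h hlam hδ hS vb sF hF vF
    have hl0 : 0 < lam := by linarith
    have vb' : VanishBound b₀ (L + 1) 2 b := vb.of_le (by omega)
    have vF' : VanishBound B L p F := vF.of_le (by omega)
    have a1 := H1 S lam T e b F δ h hlam hδ hS vb' sF hF vF'
    have a2 := H2 S lam T e b _ δ h hlam hδ hS vb' (sF.linField S)
      ((tsupport_linField_subset S F).trans hF) (vF.linField hM hB hS sF)
    have vWb := (vb.linField hM hb₀ hS h.smooth_b).of_le L.le_succ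
    have a3 := H3 S lam T e b _ δ h hlam hδ hS vb' (sF.mul (h.smooth_b.linField S))
      ((tsupport_mul_subset_left).trans hF)
      (vF'.mul vWb hB (by positivity) sF (h.smooth_b.linField S))
    -- The `δ` term is not integrated by parts again: its factor `lam` disappears on division by
    -- `lam`, which leaves a multiple of `δ`.
    have a4 := h.norm_integral_le_of_two_mul_le hδ (by omega : 2 * (j + 1) ≤ p) hB hF vF
    have step := h.integral_step hδ sF hF j
    set J0 := ∫ x, e x * (F x / (b x + δ) ^ j)
    set J1 := ∫ x, e x * (F x / (b x + δ) ^ (j + 1))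
    set J2 := ∫ x, e x * (linField S F x / (b x + δ) ^ (j + 1))
    set J3 := ∫ x, e x * (F x * linField S b x / (b x + δ) ^ (j + 2))
    have htr : ‖S.trace‖ ≤ d * M := by
      refine (norm_sum_le _ _).trans ((Finset.sum_le_sum fun i _ => hS i i).trans ?_)
      simp
    have hI : ‖Complex.I * (lam : ℂ)‖ = lam := by
      simp [abs_of_pos hl0]
    have e1 : lam * ‖J0‖ ≤ (j + 1) * ‖J3‖ + d * M * ‖J1‖ + ‖J2‖ + lam * (δ * ‖J1‖) := by
      have : lam * ‖J0‖ = ‖Complex.I * lam * J0‖ := by rw [norm_mul, hI]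
      rw [this, step]
      refine (norm_add_le _ _).trans (add_le_add ((norm_sub_le _ _).trans (add_le_add
        ((norm_sub_le _ _).trans (add_le_add ?_ ?_)) le_rfl)) ?_)
      · rw [norm_mul]
        gcongr
        have : ((j : ℂ) + 1) = ((j + 1 : ℕ) : ℂ) := by push_cast; ring
        rw [this, Complex.norm_natCast]; push_cast; rfl
      · rw [norm_mul]; gcongr
      · rw [norm_mul, hI, norm_mul, Complex.norm_real, Real.norm_of_nonneg hδ.le]
    have hq0 : 0 < lam⁻¹ := inv_pos.mpr hl0
    have hq1 : lam⁻¹ ≤ 1 := inv_le_one_of_one_le₀ hlam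
    set X := (lam⁻¹) ^ L + δ
    have hX : lam⁻¹ * X ≤ (lam⁻¹) ^ (L + 1) + δ := by
      simp only [X, mul_add, pow_succ']
      gcongr
      exact mul_le_of_le_one_left hδ.le hq1
    have e2 : lam * ‖J0‖ ≤ (((j + 1) * K3 + d * M * K1 + K2) * X)
        + lam * (δ * (B * 2 ^ (j + 1) * V)) := by
      refine e1.trans ?_
      have : (j + 1) * ‖J3‖ + d * M * ‖J1‖ + ‖J2‖ ≤
          (j + 1) * (K3 * X) + d * M * (K1 * X) + K2 * X := by gcongr
      have : lam * (δ * ‖J1‖) ≤ lam * (δ * (B * 2 ^ (j + 1) * V)) := by gcongr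
      linarith
    have e3 : ‖J0‖ ≤ ((j + 1) * K3 + d * M * K1 + K2) * (lam⁻¹ * X)
        + δ * (B * 2 ^ (j + 1) * V) := by
      have := mul_le_mul_of_nonneg_left e2 hq0.le
      rw [inv_mul_cancel_left₀ hl0.ne', mul_add, inv_mul_cancel_left₀ hl0.ne'] at this
      linarith
    refine e3.trans ?_
    have e4 : ((j + 1) * K3 + d * M * K1 + K2) * (lam⁻¹ * X) ≤
        ((j + 1) * K3 + d * M * K1 + K2) * ((lam⁻¹) ^ (L + 1) + δ) := by gcongr
    have e5 : δ * (B * 2 ^ (j + 1) * V) ≤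
        (B * 2 ^ (j + 1) * V) * ((lam⁻¹) ^ (L + 1) + δ) := by
      rw [mul_comm]
      gcongr
      linarith [pow_pos hq0 (L + 1)]
    linarith

/-- Non-stationary phase away from the origin: an amplitude vanishing to order `2 L` at the origin
produces a gain of `lam ^ (-L)`. -/
theorem exists_norm_integral_le (d : ℕ) {M b₀ : ℝ} (hM : 0 ≤ M) (hb₀ : 0 ≤ b₀) (L : ℕ) {B : ℝ}
    (hB : 0 ≤ B) : ∃ K : ℝ, 0 ≤ K ∧
      ∀ (S : Matrix (Fin d) (Fin d) ℂ) (lam : ℝ) (T : Set (EuclideanSpace ℝ (Fin d)))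
        (e b F : EuclideanSpace ℝ (Fin d) → ℂ), OscFactor S lam T e b → 1 ≤ lam →
        (∀ i j, ‖S i j‖ ≤ M) → VanishBound b₀ (L + 1) 2 b → ContDiff ℝ (⊤ : ℕ∞) F →
        tsupport F ⊆ T → VanishBound B L (2 * L) F →
        ‖∫ x, e x * F x‖ ≤ K * (lam⁻¹) ^ L := by
  obtain ⟨K, hK, H⟩ := norm_integral_div_le d hM hb₀ L 0 (2 * L) (by omega) B hB
  refine ⟨K, hK, fun S lam T e b F h hlam hS vb sF hF vF => ?_⟩
  have h1 : ∀ δ : ℝ, 0 < δ → ‖∫ x, e x * F x‖ ≤ K * ((lam⁻¹) ^ L + δ) := fun δ hδ => by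
    simpa using H S lam T e b F δ h hlam hδ hS vb sF hF vF
  -- The constant `K` was chosen before `δ`, so the shift can be sent to zero.
  refine le_of_forall_pos_le_add fun ε hε => ?_
  refine (h1 (ε / (K + 1)) (by positivity)).trans ?_
  rw [mul_add]
  gcongr
  rw [mul_div_assoc', div_le_iff₀ (by positivity)]
  nlinarith

end OscFactor

section

/-! ### Gaussian integrals with complex symmetric matrices -/

-- Write `X = Aᵀ A` and diagonalize the symmetric matrix `A⁻ᵀ Y A⁻¹` by an orthogonal `U`; then `V =
-- Uᵀ A`.
open scoped MatrixOrder in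
theorem exists_simultaneous_diagonalization {X Y : Matrix (Fin d) (Fin d) ℝ} (hX : X.PosDef)
    (hY : Y.IsSymm) : ∃ (V : Matrix (Fin d) (Fin d) ℝ) (D : Fin d → ℝ), V.det ≠ 0 ∧
      X = V.transpose * V ∧ Y = V.transpose * Matrix.diagonal D * V := by
  obtain ⟨A, hXA⟩ := CStarAlgebra.nonneg_iff_eq_star_mul_self.mp
    (Matrix.nonneg_iff_posSemidef.mpr hX.posSemidef)
  rw [Matrix.star_eq_conjTranspose, Matrix.conjTranspose_eq_transpose_of_trivial] at hXA
  have hA : IsUnit A.det := by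
    rw [isUnit_iff_ne_zero]
    intro h
    have := hX.det_pos
    rw [hXA, Matrix.det_mul, h, mul_zero] at this
    exact lt_irrefl _ this
  have hZ : (A⁻¹.transpose * Y * A⁻¹).IsHermitian := by
    rw [Matrix.IsHermitian, Matrix.conjTranspose_eq_transpose_of_trivial]
    simp [Matrix.mul_assoc, hY.eq]
  set U : Matrix (Fin d) (Fin d) ℝ := (hZ.eigenvectorUnitary : Matrix (Fin d) (Fin d) ℝ)
  have hU1 : U * U.transpose = 1 := by
    have := Unitary.coe_mul_star_self hZ.eigenvectorUnitary
    rwa [Unitary.coe_star, Matrix.star_eq_conjTranspose, Matrix.conjTranspose_eq_transpose_of_trivial] at this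
  obtain ⟨D, hsp⟩ : ∃ D : Fin d → ℝ,
      A⁻¹.transpose * Y * A⁻¹ = U * Matrix.diagonal D * U.transpose := by
    refine ⟨hZ.eigenvalues, ?_⟩
    have := hZ.spectral_theorem
    rw [Unitary.conjStarAlgAut_apply, 
      Matrix.star_eq_conjTranspose, Matrix.conjTranspose_eq_transpose_of_trivial] at this
    exact this
  refine ⟨U.transpose * A, D, ?_, ?_, ?_⟩
  · have h1 : U.det * U.transpose.det = 1 := by rw [← Matrix.det_mul, hU1, Matrix.det_one]
    rw [Matrix.det_mul]
    exact mul_ne_zero (right_ne_zero_of_mul (h1 ▸ one_ne_zero)) hA.ne_zero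
  · rw [hXA, Matrix.transpose_mul, Matrix.transpose_transpose, Matrix.mul_assoc,
      ← Matrix.mul_assoc U, hU1, one_mul]
  · calc Y = (A⁻¹ * A).transpose * Y * (A⁻¹ * A) := by
          simp [Matrix.nonsing_inv_mul _ hA]
      _ = A.transpose * (A⁻¹.transpose * Y * A⁻¹) * A := by
          simp only [Matrix.transpose_mul, Matrix.mul_assoc]
      _ = _ := by
          rw [hsp]
          simp only [Matrix.transpose_mul, Matrix.transpose_transpose, Matrix.mul_assoc]

/-- Each base has positive real part, so the principal square root never meets its cut. -/
theorem continuous_gaussian_sqrt (b : Fin d → ℝ) : Continuous fun t : ℝ =>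
    ∏ k, (2 * Real.pi / (1 + Complex.I * (t * b k)) : ℂ) ^ (1 / 2 : ℂ) := by
  refine continuous_finsetProd _ fun k _ => ?_
  rw [continuous_iff_continuousAt]
  intro t
  have h1 : (1 + Complex.I * (t * b k) : ℂ) ≠ 0 := fun h => by
    have := congrArg Complex.re h
    simp at this
  refine ContinuousAt.cpow (ContinuousAt.div (by fun_prop) (by fun_prop) h1) continuousAt_const ?_
  left
  rw [Complex.div_re]
  have h2 : 0 < Complex.normSq (1 + Complex.I * (t * b k) : ℂ) := Complex.normSq_pos.mpr h1
  simp
  positivity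

/-- The real vector `x`, viewed as a complex vector. -/
def complexVec (x : Fin d → ℝ) : Fin d → ℂ := fun i => (x i : ℂ)

theorem complexVec_mulVec (V : Matrix (Fin d) (Fin d) ℝ) (x : Fin d → ℝ) :
    complexVec (V.mulVec x) = (V.map Complex.ofReal).mulVec (complexVec x) := by
  ext i
  simp [complexVec, Matrix.mulVec, dotProduct]

theorem det_map_ofReal (V : Matrix (Fin d) (Fin d) ℝ) :
    (V.map Complex.ofReal).det = (V.det : ℂ) :=
  (Complex.ofRealHom.map_det V).symm

theorem dotProduct_congruence_diagonal (V : Matrix (Fin d) (Fin d) ℝ) (w : Fin d → ℂ)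
    (x : Fin d → ℝ) :
    complexVec x ⬝ᵥ ((V.map Complex.ofReal).transpose * Matrix.diagonal w *
      V.map Complex.ofReal).mulVec (complexVec x) = ∑ k, w k * ((V.mulVec x k : ℝ) : ℂ) ^ 2 := by
  rw [← Matrix.mulVec_mulVec, ← Matrix.mulVec_mulVec, ← complexVec_mulVec,
    Matrix.dotProduct_mulVec, Matrix.vecMul_transpose, ← complexVec_mulVec]
  simp only [dotProduct, Matrix.mulVec_diagonal, complexVec]
  exact Finset.sum_congr rfl fun k _ => by ring

theorem inv_congruence_diagonal {V : Matrix (Fin d) (Fin d) ℝ} (hV : V.det ≠ 0) {w : Fin d → ℂ}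
    (hw : ∀ k, w k ≠ 0) :
    ((V.map Complex.ofReal).transpose * Matrix.diagonal w * V.map Complex.ofReal)⁻¹ =
      (V.map Complex.ofReal)⁻¹ * Matrix.diagonal (fun k => (w k)⁻¹) *
        ((V.map Complex.ofReal)⁻¹).transpose := by
  have hU : IsUnit (V.map Complex.ofReal).det := by
    rw [det_map_ofReal]; exact (by exact_mod_cast hV : ((V.det : ℝ) : ℂ) ≠ 0).isUnit
  have hD : Matrix.diagonal w * Matrix.diagonal (fun k => (w k)⁻¹) = 1 := by
    rw [Matrix.diagonal_mul_diagonal, ← Matrix.diagonal_one]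
    congr 1
    ext k
    exact mul_inv_cancel₀ (hw k)
  refine Matrix.inv_eq_right_inv ?_
  set W := V.map Complex.ofReal
  calc W.transpose * Matrix.diagonal w * W * (W⁻¹ * Matrix.diagonal (fun k => (w k)⁻¹) *
        W⁻¹.transpose)
      = W.transpose * (Matrix.diagonal w * ((W * W⁻¹) *
        Matrix.diagonal (fun k => (w k)⁻¹))) * W⁻¹.transpose := by simp only [Matrix.mul_assoc]
    _ = 1 := by
      rw [Matrix.mul_nonsing_inv _ hU, one_mul, hD, mul_one, ← Matrix.transpose_mul,
        Matrix.nonsing_inv_mul _ hU, Matrix.transpose_one]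

theorem integral_comp_mulVec {V : Matrix (Fin d) (Fin d) ℝ} (hV : V.det ≠ 0)
    {f : (Fin d → ℝ) → ℂ} (hf : Continuous f) :
    ∫ x, f (V.mulVec x) = ((|V.det|⁻¹ : ℝ) : ℂ) * ∫ x, f x := by
  have h := Real.map_matrix_volume_pi_eq_smul_volume_pi hV
  have hc : Continuous (Matrix.toLin' V) := LinearMap.continuous_of_finiteDimensional _
  have h2 := integral_map (μ := volume) hc.measurable.aemeasurable
    (f := f) hf.aestronglyMeasurable
  rw [h, integral_smul_measure] at h2
  simp only [Matrix.toLin'_apply] at h2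
  rw [← h2, abs_inv, ENNReal.toReal_ofReal (by positivity), Complex.real_smul]

theorem integrable_comp_mulVec {V : Matrix (Fin d) (Fin d) ℝ} (hV : V.det ≠ 0)
    {f : (Fin d → ℝ) → ℂ} (hf : Continuous f) (hi : Integrable f) :
    Integrable fun x => f (V.mulVec x) := by
  have h := Real.map_matrix_volume_pi_eq_smul_volume_pi hV
  have hc : Continuous (Matrix.toLin' V) := LinearMap.continuous_of_finiteDimensional _
  have h2 : Integrable f (Measure.map (Matrix.toLin' V) volume) := by
    rw [h]; exact hi.smul_measure ENNReal.ofReal_ne_top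
  exact (integrable_map_measure hf.aestronglyMeasurable hc.measurable.aemeasurable).mp h2

theorem one_add_I_mul_ne_zero (t : ℝ) : (1 + Complex.I * t : ℂ) ≠ 0 := fun h => by
  have := congrArg Complex.re h
  simp at this

section

variable (V : Matrix (Fin d) (Fin d) ℝ) (D : Fin d → ℝ)

/-- The matrix `Vᵀ (1 + i D) V`. -/
def congruenceMatrix : Matrix (Fin d) (Fin d) ℂ :=
  (V.map Complex.ofReal).transpose * Matrix.diagonal (fun k => 1 + Complex.I * (D k : ℂ)) *
    V.map Complex.ofReal

theorem congruenceMatrix_eq : congruenceMatrix V D =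
    (V.transpose * V).map Complex.ofReal +
      Complex.I • (V.transpose * Matrix.diagonal D * V).map Complex.ofReal := by
  have h : Matrix.diagonal (fun k => 1 + Complex.I * (D k : ℂ)) =
      1 + Complex.I • (Matrix.diagonal D).map Complex.ofReal := by
    ext i j
    by_cases hij : i = j
    · subst hij; simp
    · simp [hij]
  have hm : ∀ A B : Matrix (Fin d) (Fin d) ℝ,
      (A * B).map Complex.ofReal = A.map Complex.ofReal * B.map Complex.ofReal :=
    fun A B => Matrix.map_mul (f := Complex.ofRealHom)
  rw [congruenceMatrix, h, hm, hm, hm, Matrix.transpose_map]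
  simp [mul_add, add_mul]

variable {V}

theorem congruenceMatrix_mem (hV : V.det ≠ 0) : congruenceMatrix V D ∈ dissipativeMatrices d := by
  refine ⟨?_, ?_, ?_⟩
  · simp [Matrix.IsSymm, congruenceMatrix, Matrix.mul_assoc]
  · have : (congruenceMatrix V D).map Complex.re = V.transpose * V := by
      rw [congruenceMatrix_eq]
      ext i j
      simp
    rw [this]
    exact Matrix.posSemidef_conjTranspose_mul_self V
  · have : ((V.det : ℝ) : ℂ) ≠ 0 := by exact_mod_cast hV
    simp [congruenceMatrix, Finset.prod_eq_zero_iff, Matrix.det_transpose, det_map_ofReal, this,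
      one_add_I_mul_ne_zero]

/-- This identifies the product of one-dimensional principal square roots with the chosen branch.
Along the path `t ↦ Vᵀ (1 + i t D) V` both expressions are continuous with equal squares, and the
product never vanishes. They agree at `t = 0`, where the matrix is real positive definite, hence at
`t = 1` by connectedness. -/
theorem detSqrt_congruenceMatrix (hV : V.det ≠ 0) :
    detSqrt (congruenceMatrix V D) * (((|V.det|⁻¹ : ℝ) : ℂ) *
      ∏ k, (2 * Real.pi / (1 + Complex.I * D k) : ℂ) ^ (1 / 2 : ℂ)) =
      (((2 * Real.pi) ^ ((d : ℝ) / 2) : ℝ) : ℂ) := by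
  have hVc : ((|V.det| : ℝ) : ℂ) ≠ 0 := by exact_mod_cast (abs_pos.mpr hV).ne'
  have hp : (((2 * Real.pi) ^ ((d : ℝ) / 2) : ℝ) : ℂ) ≠ 0 := by
    have : 0 < (2 * Real.pi) ^ ((d : ℝ) / 2) := by positivity
    exact_mod_cast this.ne'
  have hp2 : (((2 * Real.pi) ^ ((d : ℝ) / 2) : ℝ) : ℂ) ^ 2 = (2 * Real.pi) ^ d := by
    rw [← Complex.ofReal_pow, ← Real.rpow_natCast, ← Real.rpow_mul (by positivity)]
    rw [show (d : ℝ) / 2 * (2 : ℕ) = (d : ℕ) by push_cast; ring, Real.rpow_natCast]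
    push_cast; ring
  have hs := isDetSqrtBranch_detSqrt d
  let P : ℝ → ℂ := fun t => ∏ k, (2 * Real.pi / (1 + Complex.I * (t * D k)) : ℂ) ^ (1 / 2 : ℂ)
  have hone : ∀ (t : ℝ) k, (1 + Complex.I * ((t : ℂ) * D k) : ℂ) ≠ 0 := fun t k => by
    simpa using one_add_I_mul_ne_zero (t * D k)
  have hpi : (2 * Real.pi : ℂ) ≠ 0 := by simp [Real.pi_ne_zero]
  have hP0 : ∀ t, P t ≠ 0 := fun t => Finset.prod_ne_zero_iff.mpr fun k _ => by
    rw [Ne, Complex.cpow_eq_zero_iff]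
    exact fun h => div_ne_zero hpi (hone t k) h.1
  have hPsq : ∀ t, P t ^ 2 = (2 * Real.pi) ^ d / ∏ k, (1 + Complex.I * ((t : ℂ) * D k)) := by
    intro t
    simp only [P, ← Finset.prod_pow]
    have : ∀ k, ((2 * Real.pi / (1 + Complex.I * ((t : ℂ) * D k)) : ℂ) ^ (1 / 2 : ℂ)) ^ 2 =
        2 * Real.pi / (1 + Complex.I * ((t : ℂ) * D k)) := fun k => by
      rw [← Complex.cpow_nat_mul]; simp
    simp only [this, Finset.prod_div_distrib, Finset.prod_const, Finset.card_univ, Fintype.card_fin]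
  have hmem : ∀ t : ℝ, congruenceMatrix V (fun k => t * D k) ∈ dissipativeMatrices d :=
    fun t => congruenceMatrix_mem (fun k => t * D k) hV
  have hdet : ∀ t : ℝ, (congruenceMatrix V (fun k => t * D k)).det =
      ((|V.det| : ℝ) : ℂ) ^ 2 * ∏ k, (1 + Complex.I * ((t : ℂ) * D k)) := by
    intro t
    rw [← Complex.ofReal_pow, sq_abs]
    simp [congruenceMatrix, det_map_ofReal, Matrix.det_transpose]
    ring
  have hcont : Continuous fun t : ℝ => congruenceMatrix V (fun k => t * D k) := by
    unfold congruenceMatrix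
    fun_prop
  have hf : ContinuousOn (fun t : ℝ => detSqrt (congruenceMatrix V (fun k => t * D k))) Set.univ :=
    (hs.continuousOn.comp_continuous hcont hmem).continuousOn
  have hg : ContinuousOn (fun t : ℝ => (((2 * Real.pi) ^ ((d : ℝ) / 2) : ℝ) : ℂ) *
      ((|V.det| : ℝ) : ℂ) / P t) Set.univ :=
    (continuous_const.div (continuous_gaussian_sqrt D) hP0).continuousOn
  have h0 : detSqrt (congruenceMatrix V (fun k => (0 : ℝ) * D k)) =
      (((2 * Real.pi) ^ ((d : ℝ) / 2) : ℝ) : ℂ) * ((|V.det| : ℝ) : ℂ) / P 0 := by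
    have hR : congruenceMatrix V (fun k => (0 : ℝ) * D k) =
        (V.transpose * V).map Complex.ofReal := by
      rw [congruenceMatrix_eq]
      simp [Matrix.diagonal_zero]
    have hpd : (V.transpose * V).PosDef :=
      Matrix.PosDef.conjTranspose_mul_self V
        (Matrix.mulVec_injective_of_isUnit ((Matrix.isUnit_iff_isUnit_det V).mpr hV.isUnit))
    obtain ⟨r, hr, hr'⟩ := hs.pos _ hpd
    have hr2 : r ^ 2 = |V.det| ^ 2 := by
      have h1 := hs.sq_eq _ (hmem 0)
      rw [hdet 0, hR, hr'] at h1
      simp only [Complex.ofReal_zero, zero_mul, mul_zero, add_zero, Finset.prod_const_one,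
        mul_one] at h1
      exact_mod_cast h1
    have hr3 : r = |V.det| := by
      rw [← abs_of_pos hr]
      simpa using (sq_eq_sq_iff_abs_eq_abs _ _).mp hr2
    have hP : P 0 = (((2 * Real.pi) ^ ((d : ℝ) / 2) : ℝ) : ℂ) := by
      simp only [P, Complex.ofReal_zero, zero_mul, mul_zero, add_zero, div_one, Finset.prod_const,
        Finset.card_univ, Fintype.card_fin]
      rw [← Complex.cpow_nat_mul, Complex.ofReal_cpow (by positivity)]
      push_cast
      congr 1
      ring
    rw [hR, hr', hr3, hP]
    field_simp
  have key := isPreconnected_univ.eq_of_sq_eq hf hg (fun t _ => by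
      simp only [Pi.pow_apply]
      rw [hs.sq_eq _ (hmem t), hdet, div_pow, mul_pow, hp2, hPsq]
      have : ∏ k, (1 + Complex.I * ((t : ℂ) * D k)) ≠ 0 :=
        Finset.prod_ne_zero_iff.mpr fun k _ => hone t k
      have h2 : (2 * Real.pi : ℂ) ^ d ≠ 0 := pow_ne_zero _ hpi
      field_simp)
    (fun {t} _ => div_ne_zero (mul_ne_zero hp hVc) (hP0 t)) (Set.mem_univ 0) h0 (Set.mem_univ 1)
  simp only [one_mul] at key
  rw [key]
  have hP1 : P 1 = ∏ k, (2 * Real.pi / (1 + Complex.I * D k) : ℂ) ^ (1 / 2 : ℂ) := by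
    simp [P]
  rw [← hP1]
  have := hP0 1
  push_cast
  field_simp

/-- The substitution `y = V x` separates the variables; the linear form `c` becomes `V⁻ᵀ c`. -/
theorem integrable_gaussian_congruence (hV : V.det ≠ 0) (c : Fin d → ℂ) :
    Integrable (fun x : Fin d → ℝ => Complex.exp (-(1 / 2) *
      (complexVec x ⬝ᵥ (congruenceMatrix V D).mulVec (complexVec x)) + c ⬝ᵥ complexVec x)) ∧
    ∫ x : Fin d → ℝ, Complex.exp (-(1 / 2) *
      (complexVec x ⬝ᵥ (congruenceMatrix V D).mulVec (complexVec x)) + c ⬝ᵥ complexVec x) =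
      (((2 * Real.pi) ^ ((d : ℝ) / 2) : ℝ) : ℂ) / detSqrt (congruenceMatrix V D) *
        Complex.exp (1 / 2 * (c ⬝ᵥ (congruenceMatrix V D)⁻¹.mulVec c)) := by
  set W := V.map Complex.ofReal with hW
  have hU : IsUnit W.det := by
    rw [det_map_ofReal]; exact (by exact_mod_cast hV : ((V.det : ℝ) : ℂ) ≠ 0).isUnit
  let b : Fin d → ℂ := fun k => (1 + Complex.I * (D k : ℂ)) / 2
  let e : Fin d → ℂ := W⁻¹.transpose.mulVec c
  have hb : ∀ k, 0 < (b k).re := fun k => by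
    simp only [b, Complex.div_ofNat_re, Complex.add_re, Complex.one_re, Complex.mul_re,
      Complex.I_re, Complex.I_im, Complex.ofReal_re, Complex.ofReal_im]
    norm_num
  let f : (Fin d → ℝ) → ℂ := fun y =>
    Complex.exp (-∑ k, b k * (y k : ℂ) ^ 2 + ∑ k, e k * y k)
  have hfc : Continuous f := by fun_prop
  have hfi : Integrable f := GaussianFourier.integrable_cexp_neg_sum_mul_add hb e
  have hcomp : (fun x : Fin d → ℝ => Complex.exp (-(1 / 2) *
      (complexVec x ⬝ᵥ (congruenceMatrix V D).mulVec (complexVec x)) + c ⬝ᵥ complexVec x)) =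
      fun x => f (V.mulVec x) := by
    ext x
    simp only [f]
    congr 2
    · rw [congruenceMatrix, dotProduct_congruence_diagonal, Finset.mul_sum,
        ← Finset.sum_neg_distrib]
      refine Finset.sum_congr rfl fun k _ => ?_
      simp only [b]; ring
    · have : e ⬝ᵥ complexVec (V.mulVec x) = c ⬝ᵥ complexVec x := by
        simp only [e]
        rw [complexVec_mulVec, Matrix.mulVec_transpose, Matrix.dotProduct_mulVec,
          Matrix.vecMul_vecMul, ← hW, Matrix.nonsing_inv_mul _ hU, Matrix.vecMul_one]
      rw [← this]
      rfl
  rw [hcomp]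
  refine ⟨integrable_comp_mulVec hV hfc hfi, ?_⟩
  rw [integral_comp_mulVec hV hfc, GaussianFourier.integral_cexp_neg_sum_mul_add hb e,
    Finset.prod_mul_distrib, ← Complex.exp_sum]
  have h1 : ∀ k, (Real.pi / b k : ℂ) = 2 * Real.pi / (1 + Complex.I * D k) := fun k => by
    simp only [b]
    have := one_add_I_mul_ne_zero (D k)
    field_simp
  have h2 : ∑ k, e k ^ 2 / (4 * b k) =
      1 / 2 * (c ⬝ᵥ (congruenceMatrix V D)⁻¹.mulVec c) := by
    rw [congruenceMatrix, inv_congruence_diagonal hV fun k => one_add_I_mul_ne_zero (D k),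
      ← Matrix.mulVec_mulVec, ← Matrix.mulVec_mulVec, Matrix.dotProduct_mulVec,
      ← Matrix.mulVec_transpose]
    simp only [← hW, dotProduct, Matrix.mulVec_diagonal, Finset.mul_sum]
    refine Finset.sum_congr rfl fun k _ => ?_
    have := one_add_I_mul_ne_zero (D k)
    simp only [b]
    change e k ^ 2 / _ = 1 / 2 * (e k * (_ * e k))
    field_simp
    ring
  simp only [h1, h2]
  have h3 := detSqrt_congruenceMatrix D hV
  have h4 : detSqrt (congruenceMatrix V D) ≠ 0 := fun h => by
    have h5 := (isDetSqrtBranch_detSqrt d).sq_eq _ (congruenceMatrix_mem D hV)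
    rw [h] at h5
    exact (congruenceMatrix_mem D hV).2.2 (by rw [← h5]; simp)
  rw [← h3]
  field_simp

end

variable {E : Matrix (Fin d) (Fin d) ℂ}

theorem exists_eq_congruenceMatrix (hE : E.IsSymm) (hpos : (E.map Complex.re).PosDef) :
    ∃ (V : Matrix (Fin d) (Fin d) ℝ) (D : Fin d → ℝ), V.det ≠ 0 ∧ E = congruenceMatrix V D := by
  obtain ⟨V, D, hV, hX, hY⟩ := exists_simultaneous_diagonalization (Y := E.map Complex.im) hpos
    (by ext i j; simp [hE.apply i j])
  refine ⟨V, D, hV, ?_⟩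
  rw [congruenceMatrix_eq, ← hX, ← hY]
  ext i j
  simp [mul_comm Complex.I, Complex.re_add_im]

/-- The Gaussian with matrix `E`. -/
def gaussian (E : Matrix (Fin d) (Fin d) ℂ) (x : EuclideanSpace ℝ (Fin d)) : ℂ :=
  Complex.exp (-(1 / 2) * (complexVec x ⬝ᵥ E.mulVec (complexVec x)))

theorem integrable_gaussian_mul_exp (hE : E.IsSymm) (hpos : (E.map Complex.re).PosDef)
    (c : Fin d → ℂ) :
    Integrable (fun x : EuclideanSpace ℝ (Fin d) =>
      gaussian E x * Complex.exp (c ⬝ᵥ complexVec x)) := by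
  obtain ⟨V, D, hV, rfl⟩ := exists_eq_congruenceMatrix hE hpos
  have h := (integrable_gaussian_congruence D hV c).1
  rw [← (PiLp.volume_preserving_ofLp (Fin d)).integrable_comp_emb
    (MeasurableEquiv.toLp 2 _).symm.measurableEmbedding] at h
  simpa only [gaussian, ← Complex.exp_add] using! h

theorem integral_gaussian_mul_exp (hE : E.IsSymm) (hpos : (E.map Complex.re).PosDef)
    (c : Fin d → ℂ) :
    ∫ x : EuclideanSpace ℝ (Fin d), gaussian E x * Complex.exp (c ⬝ᵥ complexVec x) =
      (((2 * Real.pi) ^ ((d : ℝ) / 2) : ℝ) : ℂ) / detSqrt E *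
        Complex.exp (1 / 2 * (c ⬝ᵥ E⁻¹.mulVec c)) := by
  obtain ⟨V, D, hV, rfl⟩ := exists_eq_congruenceMatrix hE hpos
  rw [← (integrable_gaussian_congruence D hV c).2,
    ← (PiLp.volume_preserving_ofLp (Fin d)).integral_comp
    (MeasurableEquiv.toLp 2 _).symm.measurableEmbedding]
  simp only [gaussian, ← Complex.exp_add]

end

/-! ### Quadratic forms -/

/-- The quadratic form `x ↦ B x · x`. -/
def quadForm (B : Matrix (Fin d) (Fin d) ℂ) (x : EuclideanSpace ℝ (Fin d)) : ℂ :=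
  complexVec x ⬝ᵥ B.mulVec (complexVec x)

theorem quadForm_eq_sum (B : Matrix (Fin d) (Fin d) ℂ) (x : EuclideanSpace ℝ (Fin d)) :
    quadForm B x = ∑ i, ∑ j, B i j * ((x j : ℝ) : ℂ) * ((x i : ℝ) : ℂ) := by
  simp only [quadForm, dotProduct, Matrix.mulVec, Finset.mul_sum, complexVec]
  exact Finset.sum_congr rfl fun i _ => Finset.sum_congr rfl fun j _ => by ring

theorem quadForm_smul (c : ℂ) (B : Matrix (Fin d) (Fin d) ℂ) (x : EuclideanSpace ℝ (Fin d)) :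
    quadForm (c • B) x = c * quadForm B x := by
  simp [quadForm, Matrix.smul_mulVec]

theorem contDiff_quadForm (B : Matrix (Fin d) (Fin d) ℂ) : ContDiff ℝ (⊤ : ℕ∞) (quadForm B) := by
  rw [funext (quadForm_eq_sum B)]
  exact ContDiff.sum fun i _ => ContDiff.sum fun j _ =>
    (contDiff_const.mul (contDiff_coord j)).mul (contDiff_coord i)

theorem norm_quadForm_le {B : Matrix (Fin d) (Fin d) ℂ} {m : ℝ} (hB : ∀ i j, ‖B i j‖ ≤ m)
    (x : EuclideanSpace ℝ (Fin d)) : ‖quadForm B x‖ ≤ d ^ 2 * m * ‖x‖ ^ 2 := by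
  rw [quadForm_eq_sum]
  have h : ∀ i j, ‖B i j * ((x j : ℝ) : ℂ) * ((x i : ℝ) : ℂ)‖ ≤ m * ‖x‖ ^ 2 := by
    intro i j
    have hm : 0 ≤ m := (norm_nonneg _).trans (hB i j)
    rw [norm_mul, norm_mul, Complex.norm_real, Complex.norm_real, sq, ← mul_assoc]
    gcongr
    · exact hB i j
    · exact PiLp.norm_apply_le x j
    · exact PiLp.norm_apply_le x i
  refine (norm_sum_le_of_le _ fun i _ => norm_sum_le_of_le _ fun j _ => h i j).trans ?_
  simp
  exact le_of_eq (by ring)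

theorem re_quadForm (B : Matrix (Fin d) (Fin d) ℂ) (x : EuclideanSpace ℝ (Fin d)) :
    (quadForm B x).re = x.ofLp ⬝ᵥ (B.map Complex.re).mulVec x.ofLp := by
  simp [quadForm, dotProduct, Matrix.mulVec, complexVec, Finset.mul_sum]

theorem re_quadForm_nonneg {E : Matrix (Fin d) (Fin d) ℂ} (hE : E ∈ dissipativeMatrices d)
    (x : EuclideanSpace ℝ (Fin d)) : 0 ≤ (quadForm E x).re := by
  rw [re_quadForm]
  simpa using hE.2.1.dotProduct_mulVec_nonneg x.ofLp

/-- For a complex symmetric matrix the cross terms between `Re v` and `Im v` cancel in the real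
part. What remains is the form of `Re E` at `Re v` plus the same form at `Im v`. -/
theorem re_star_dotProduct_mulVec_nonneg {E : Matrix (Fin d) (Fin d) ℂ}
    (hE : E ∈ dissipativeMatrices d) (v : Fin d → ℂ) : 0 ≤ (star v ⬝ᵥ E.mulVec v).re := by
  obtain ⟨hs, hp, -⟩ := hE
  have hx := hp.dotProduct_mulVec_nonneg (fun i => (v i).re)
  have hy := hp.dotProduct_mulVec_nonneg (fun i => (v i).im)
  have key : (star v ⬝ᵥ E.mulVec v).re =
      star (fun i => (v i).re) ⬝ᵥ (E.map Complex.re).mulVec (fun i => (v i).re)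
      + star (fun i => (v i).im) ⬝ᵥ (E.map Complex.re).mulVec (fun i => (v i).im) := by
    have e1 : ∑ i, ∑ j, (v i).re * ((E i j).im * (v j).im)
        = ∑ i, ∑ j, (v i).im * ((E i j).im * (v j).re) := by
      rw [Finset.sum_comm]
      refine Finset.sum_congr rfl fun i _ => Finset.sum_congr rfl fun j _ => ?_
      rw [hs.apply i j]; ring
    simp only [dotProduct, Matrix.mulVec, Pi.star_apply, Complex.re_sum, Finset.mul_sum,
      Matrix.map_apply, Complex.mul_re, Complex.mul_im, RCLike.star_def, Complex.conj_re,
      Complex.conj_im, star_trivial]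
    rw [← Finset.sum_add_distrib, ← sub_eq_zero]
    rw [← sub_eq_zero] at e1
    rw [← neg_eq_zero, ← e1]
    simp only [← Finset.sum_add_distrib, ← Finset.sum_sub_distrib, ← Finset.sum_neg_distrib]
    refine Finset.sum_congr rfl fun i _ => Finset.sum_congr rfl fun j _ => ?_
    ring
  rw [key]
  exact add_nonneg hx hy

/-- With `v = E⁻¹ x`, the number `E⁻¹ x · x` is the conjugate of `v̄ · E v`. Hence the Gaussian on
the Fourier side is again bounded by one. -/
theorem re_quadForm_inv_nonneg {E : Matrix (Fin d) (Fin d) ℂ} (hE : E ∈ dissipativeMatrices d)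
    (x : EuclideanSpace ℝ (Fin d)) : 0 ≤ (quadForm E⁻¹ x).re := by
  have h := re_star_dotProduct_mulVec_nonneg hE (E⁻¹.mulVec (complexVec x))
  rw [Matrix.mulVec_mulVec, Matrix.mul_nonsing_inv _ (isUnit_iff_ne_zero.mpr hE.2.2),
    Matrix.one_mulVec] at h
  convert h using 1
  have h2 : star (quadForm E⁻¹ x) = star (E⁻¹.mulVec (complexVec x)) ⬝ᵥ complexVec x := by
    rw [quadForm, ← Matrix.star_dotProduct_star]
    congr 1
    ext i
    simp [complexVec]
  rw [← h2]
  simp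

theorem norm_gaussian_le_one {E : Matrix (Fin d) (Fin d) ℂ} {x : EuclideanSpace ℝ (Fin d)}
    (h : 0 ≤ (quadForm E x).re) : ‖gaussian E x‖ ≤ 1 := by
  rw [gaussian, Complex.norm_exp, Real.exp_le_one_iff]
  change (-(1 / 2) * quadForm E x).re ≤ 0
  rw [show (-(1 / 2) : ℂ) = ((-(1 / 2) : ℝ) : ℂ) by push_cast; ring, Complex.re_ofReal_mul]
  linarith

theorem contDiff_gaussian (E : Matrix (Fin d) (Fin d) ℂ) :
    ContDiff ℝ (⊤ : ℕ∞) (gaussian E) :=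
  (contDiff_const.mul (contDiff_quadForm E)).cexp

/-! ### The Fourier transform of a Gaussian -/

/-- The constant `(2π)^{d/2} / det^{1/2} E`, which is the integral of the Gaussian. -/
def gaussianConst (E : Matrix (Fin d) (Fin d) ℂ) : ℂ :=
  (((2 * Real.pi) ^ ((d : ℝ) / 2) : ℝ) : ℂ) / detSqrt E

theorem fourier_gaussian {E : Matrix (Fin d) (Fin d) ℂ} (hE : E.IsSymm)
    (hpos : (E.map Complex.re).PosDef) (ξ : EuclideanSpace ℝ (Fin d)) :
    𝓕 (gaussian E) ξ = gaussianConst E * gaussian ((4 * Real.pi ^ 2 : ℂ) • E⁻¹) ξ := by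
  rw [Real.fourier_eq']
  let c : Fin d → ℂ := (-2 * Real.pi * Complex.I) • complexVec ξ
  have h := integral_gaussian_mul_exp hE hpos c
  have h1 : ∀ v : EuclideanSpace ℝ (Fin d),
      Complex.exp (((-2 * Real.pi * inner ℝ v ξ : ℝ) : ℂ) * Complex.I) • gaussian E v =
        gaussian E v * Complex.exp (c ⬝ᵥ complexVec v) := by
    intro v
    rw [smul_eq_mul, mul_comm]
    have h2 : c ⬝ᵥ complexVec v = -2 * Real.pi * Complex.I * ((inner ℝ v ξ : ℝ) : ℂ) := by
      simp only [c, smul_dotProduct, smul_eq_mul, PiLp.inner_apply]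
      simp [dotProduct, complexVec]
    rw [h2]
    congr 2
    push_cast
    ring
  simp_rw [h1]
  rw [h, gaussianConst, gaussian]
  congr 2
  simp only [c, Matrix.mulVec_smul, smul_dotProduct, dotProduct_smul, Matrix.smul_mulVec,
    smul_eq_mul]
  linear_combination (2 * Real.pi ^ 2 *
    (complexVec ξ.ofLp ⬝ᵥ E⁻¹.mulVec (complexVec ξ.ofLp))) * Complex.I_sq

/-- Parseval: the Fourier transform is moved from `𝓕⁻ f` onto the Gaussian. -/
theorem integral_gaussian_mul_of_posDef {E : Matrix (Fin d) (Fin d) ℂ} (hE : E.IsSymm)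
    (hpos : (E.map Complex.re).PosDef) (f : SchwartzMap (EuclideanSpace ℝ (Fin d)) ℂ) :
    ∫ x, gaussian E x * f x =
      gaussianConst E * ∫ ξ, gaussian ((4 * Real.pi ^ 2 : ℂ) • E⁻¹) ξ * 𝓕⁻ f ξ := by
  have hg : Integrable (gaussian E) := by
    simpa using integrable_gaussian_mul_exp hE hpos 0
  have h := VectorFourier.integral_fourierIntegral_smul_eq_flip
    (L := innerₗ (EuclideanSpace ℝ (Fin d))) (μ := volume) (ν := volume)
    Real.continuous_fourierChar continuous_inner hg (𝓕⁻ f).integrable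
  have h1 : ∀ x, VectorFourier.fourierIntegral Real.fourierChar volume
      (innerₗ (EuclideanSpace ℝ (Fin d))).flip (𝓕⁻ f : SchwartzMap (EuclideanSpace ℝ (Fin d)) ℂ) x = f x := by
    intro x
    have : 𝓕 (𝓕⁻ f) x = f x := by rw [FourierTransform.fourier_fourierInv_eq]
    rw [← this, flip_innerₗ]
    rfl
  have h2 : ∀ ξ, VectorFourier.fourierIntegral Real.fourierChar volume
      (innerₗ (EuclideanSpace ℝ (Fin d))) (gaussian E) ξ =
      gaussianConst E * gaussian ((4 * Real.pi ^ 2 : ℂ) • E⁻¹) ξ :=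
    fun ξ => fourier_gaussian hE hpos ξ
  simp only [h1, h2, smul_eq_mul] at h
  rw [← h, ← integral_const_mul]
  simp only [mul_assoc]

theorem mem_dissipativeMatrices_of_posDef {E : Matrix (Fin d) (Fin d) ℂ} (hE : E.IsSymm)
    (hpos : (E.map Complex.re).PosDef) : E ∈ dissipativeMatrices d := by
  obtain ⟨V, D, hV, rfl⟩ := exists_eq_congruenceMatrix hE hpos
  exact congruenceMatrix_mem D hV

theorem detSqrt_ne_zero {E : Matrix (Fin d) (Fin d) ℂ} (hE : E ∈ dissipativeMatrices d) :
    detSqrt E ≠ 0 := fun h => by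
  have h5 := (isDetSqrtBranch_detSqrt d).sq_eq _ hE
  rw [h] at h5
  exact hE.2.2 (by rw [← h5]; simp)

/-- The Gaussian of a dissipative matrix need not be integrable, so `E` is replaced by `E + δ` and
`δ` decreases to zero. The Gaussians on both sides stay bounded by one, which gives dominated
convergence. The constant converges because the branch is continuous on all of `dissipativeMatrices
d`, including matrices with degenerate real part. -/
theorem integral_gaussian_mul {E : Matrix (Fin d) (Fin d) ℂ} (hE : E ∈ dissipativeMatrices d)
    (f : SchwartzMap (EuclideanSpace ℝ (Fin d)) ℂ) :
    ∫ x, gaussian E x * f x =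
      gaussianConst E * ∫ ξ, gaussian ((4 * Real.pi ^ 2 : ℂ) • E⁻¹) ξ * 𝓕⁻ f ξ := by
  let Eδ : ℝ → Matrix (Fin d) (Fin d) ℂ := fun δ => E + (δ : ℂ) • 1
  have hE0 : Eδ 0 = E := by simp [Eδ]
  have hsymm : ∀ δ, (Eδ δ).IsSymm := fun δ => by
    simp [Eδ, Matrix.IsSymm, hE.1.eq]
  have hpos : ∀ δ, 0 < δ → ((Eδ δ).map Complex.re).PosDef := fun δ hδ => by
    have : (Eδ δ).map Complex.re = E.map Complex.re + δ • (1 : Matrix (Fin d) (Fin d) ℝ) := by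
      ext i j
      by_cases hij : i = j
      · subst hij; simp [Eδ]
      · simp [Eδ, hij]
    rw [this]
    exact Matrix.PosDef.posSemidef_add hE.2.1 (Matrix.PosDef.one.smul hδ)
  have hmem : ∀ δ, 0 < δ → Eδ δ ∈ dissipativeMatrices d := fun δ hδ =>
    mem_dissipativeMatrices_of_posDef (hsymm δ) (hpos δ hδ)
  have hcE : Continuous Eδ := by fun_prop
  have hlim : Filter.Tendsto Eδ (nhdsWithin 0 (Set.Ioi 0)) (nhds E) := by
    rw [← hE0]
    exact hcE.continuousAt.tendsto.mono_left nhdsWithin_le_nhds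
  have hev : ∀ᶠ δ in nhdsWithin (0 : ℝ) (Set.Ioi 0), 0 < δ := self_mem_nhdsWithin
  have hqc : ∀ x : EuclideanSpace ℝ (Fin d),
      Continuous fun B : Matrix (Fin d) (Fin d) ℂ => gaussian B x := by
    intro x
    unfold gaussian
    fun_prop
  have hinv : Filter.Tendsto (fun δ => (4 * Real.pi ^ 2 : ℂ) • (Eδ δ)⁻¹)
      (nhdsWithin 0 (Set.Ioi 0)) (nhds ((4 * Real.pi ^ 2 : ℂ) • E⁻¹)) := by
    refine Filter.Tendsto.const_smul ?_ _
    simp only [Matrix.inv_def, Ring.inverse_eq_inv']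
    refine Filter.Tendsto.smul (Filter.Tendsto.inv₀ ?_ hE.2.2) ?_
    · exact ((continuous_id.matrix_det).tendsto E).comp hlim
    · exact ((continuous_id.matrix_adjugate).tendsto E).comp hlim
  have hb : ∀ B : Matrix (Fin d) (Fin d) ℂ, (∀ x, 0 ≤ (quadForm B x).re) →
      ∀ (g : SchwartzMap (EuclideanSpace ℝ (Fin d)) ℂ) x, ‖gaussian B x * g x‖ ≤ ‖g x‖ :=
    fun B hB g x => by
      rw [norm_mul]
      exact mul_le_of_le_one_left (norm_nonneg _) (norm_gaussian_le_one (hB x))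
  have hmeas : ∀ (B : Matrix (Fin d) (Fin d) ℂ) (g : SchwartzMap (EuclideanSpace ℝ (Fin d)) ℂ),
      AEStronglyMeasurable (fun x => gaussian B x * g x) :=
    fun B g => ((contDiff_gaussian B).continuous.mul g.continuous).aestronglyMeasurable
  have h1 : Filter.Tendsto (fun δ => ∫ x, gaussian (Eδ δ) x * f x)
      (nhdsWithin 0 (Set.Ioi 0)) (nhds (∫ x, gaussian E x * f x)) := by
    refine tendsto_integral_filter_of_dominated_convergence (fun x => ‖f x‖)
      (.of_forall fun δ => hmeas _ f) ?_ f.integrable.norm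
      (.of_forall fun x => (((hqc x).tendsto E).comp hlim).mul_const _)
    filter_upwards [hev] with δ hδ
    exact .of_forall fun x => hb _ (re_quadForm_nonneg (hmem δ hδ)) f x
  have hre : ∀ B : Matrix (Fin d) (Fin d) ℂ, B ∈ dissipativeMatrices d →
      ∀ x, 0 ≤ (quadForm ((4 * Real.pi ^ 2 : ℂ) • B⁻¹) x).re := fun B hB x => by
    rw [quadForm_smul, show (4 * Real.pi ^ 2 : ℂ) = ((4 * Real.pi ^ 2 : ℝ) : ℂ) by push_cast; ring,
      Complex.re_ofReal_mul]
    exact mul_nonneg (by positivity) (re_quadForm_inv_nonneg hB x)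
  have h2 : Filter.Tendsto
      (fun δ => ∫ ξ, gaussian ((4 * Real.pi ^ 2 : ℂ) • (Eδ δ)⁻¹) ξ * 𝓕⁻ f ξ)
      (nhdsWithin 0 (Set.Ioi 0))
      (nhds (∫ ξ, gaussian ((4 * Real.pi ^ 2 : ℂ) • E⁻¹) ξ * 𝓕⁻ f ξ)) := by
    refine tendsto_integral_filter_of_dominated_convergence (fun x => ‖𝓕⁻ f x‖)
      (.of_forall fun δ => hmeas _ (𝓕⁻ f)) ?_ (𝓕⁻ f).integrable.norm
      (.of_forall fun x => (((hqc x).tendsto _).comp hinv).mul_const _)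
    filter_upwards [hev] with δ hδ
    exact .of_forall fun x => hb _ (hre _ (hmem δ hδ)) (𝓕⁻ f) x
  have h3 : Filter.Tendsto (fun δ => gaussianConst (Eδ δ)) (nhdsWithin 0 (Set.Ioi 0))
      (nhds (gaussianConst E)) := by
    refine Filter.Tendsto.div tendsto_const_nhds ?_ (detSqrt_ne_zero hE)
    refine Filter.Tendsto.comp ((isDetSqrtBranch_detSqrt d).continuousOn E hE) ?_
    exact tendsto_nhdsWithin_iff.mpr ⟨hlim, hev.mono hmem⟩
  refine tendsto_nhds_unique h1 ((h3.mul h2).congr' ?_)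
  filter_upwards [hev] with δ hδ
  exact (integral_gaussian_mul_of_posDef (hsymm δ) (hpos δ hδ) f).symm

/-! ### The exponential series -/

/-- Repeated integration by parts in `s`. The exact integral form matters: with `z = i lam g` the
factors `exp (s z)` are absorbed into a family of oscillating phases, so the cancellation is kept.
-/
theorem exp_sub_sum_eq_integral (z : ℂ) (n : ℕ) :
    Complex.exp z - ∑ m ∈ Finset.range (n + 1), z ^ m / m.factorial =
      z ^ (n + 1) * ∫ s in (0 : ℝ)..1, (((1 - s) ^ n / n.factorial : ℝ) : ℂ) *
        Complex.exp (s * z) := by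
  have hexp : ∀ s : ℝ, HasDerivAt (fun s : ℝ => Complex.exp (s * z))
      (z * Complex.exp (s * z)) s := by
    intro s
    have h1 : HasDerivAt (fun s : ℝ => (s : ℂ) * z) z s := by
      simpa using (Complex.ofRealCLM.hasDerivAt (x := s)).mul_const z
    simpa [mul_comm] using h1.cexp
  induction n with
  | zero =>
    have h := intervalIntegral.integral_eq_sub_of_hasDerivAt (a := 0) (b := 1)
      (fun s _ => hexp s) (Continuous.intervalIntegrable (by fun_prop) _ _)
    rw [intervalIntegral.integral_const_mul] at h
    simp at h ⊢
    exact h.symm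
  | succ n ih =>
    have hd : ∀ s : ℝ, HasDerivAt (fun s : ℝ =>
        (((1 - s) ^ (n + 1) / (n + 1).factorial : ℝ) : ℂ) * Complex.exp (s * z))
        (-((((1 - s) ^ n / n.factorial : ℝ) : ℂ) * Complex.exp (s * z)) +
          z * ((((1 - s) ^ (n + 1) / (n + 1).factorial : ℝ) : ℂ) * Complex.exp (s * z))) s := by
      intro s
      have h1 : HasDerivAt (fun s : ℝ => (1 - s) ^ (n + 1) / (n + 1).factorial)
          (-((1 - s) ^ n / n.factorial)) s := by
        have := (((hasDerivAt_id' s).const_sub 1).pow (n + 1)).div_const ((n + 1).factorial : ℝ)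
        refine this.congr_deriv ?_
        rw [Nat.factorial_succ]
        have : (n.factorial : ℝ) ≠ 0 := by exact_mod_cast n.factorial_ne_zero
        push_cast
        simp
        field_simp
      refine (h1.ofReal_comp.mul (hexp s)).congr_deriv ?_
      push_cast
      ring
    have h := intervalIntegral.integral_eq_sub_of_hasDerivAt (a := 0) (b := 1)
      (fun s _ => hd s) (Continuous.intervalIntegrable (by fun_prop) _ _)
    rw [intervalIntegral.integral_add (Continuous.intervalIntegrable (by fun_prop) _ _)
      (Continuous.intervalIntegrable (by fun_prop) _ _), intervalIntegral.integral_neg,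
      intervalIntegral.integral_const_mul] at h
    rw [Finset.sum_range_succ, ← sub_sub, ih]
    simp only [sub_self, zero_pow (Nat.succ_ne_zero n), zero_div, Complex.ofReal_zero, zero_mul,
      sub_zero, one_pow, mul_one, Complex.exp_zero, zero_sub] at h
    have h2 : ((1 / (n + 1).factorial : ℝ) : ℂ) = 1 / (n + 1).factorial := by push_cast; rfl
    rw [h2] at h
    linear_combination (-z ^ (n + 1)) * h

/-- For `Re z ≤ 0` every factor `exp (s z)` in the remainder has modulus at most one. -/
theorem norm_exp_sub_sum_le {z : ℂ} (hz : z.re ≤ 0) (n : ℕ) :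
    ‖Complex.exp z - ∑ m ∈ Finset.range n, z ^ m / m.factorial‖ ≤ ‖z‖ ^ n := by
  cases n with
  | zero => simpa [Complex.norm_exp] using hz
  | succ n =>
    rw [exp_sub_sum_eq_integral, norm_mul, norm_pow]
    refine mul_le_of_le_one_right (by positivity) ?_
    refine (intervalIntegral.norm_integral_le_of_norm_le_const (C := 1) fun s hs => ?_).trans
      (by simp)
    rw [Set.uIoc_of_le zero_le_one] at hs
    rw [norm_mul, Complex.norm_real, Complex.norm_exp, Complex.re_ofReal_mul]
    have h1 : ‖(1 - s) ^ n / (n.factorial : ℝ)‖ ≤ 1 := by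
      rw [norm_div, norm_pow, Real.norm_of_nonneg (by linarith [hs.2]), Real.norm_natCast]
      refine div_le_one_of_le₀ ?_ (by positivity)
      exact (pow_le_one₀ (by linarith [hs.2]) (by linarith [hs.1])).trans
        (by exact_mod_cast n.factorial_pos)
    have h2 : Real.exp (s * z.re) ≤ 1 :=
      Real.exp_le_one_iff.mpr (mul_nonpos_of_nonneg_of_nonpos hs.1.le hz)
    exact mul_le_one₀ h1 (Real.exp_pos _).le h2

/-! ### The Gaussian expansion -/

theorem ContDiff.opD {f : EuclideanSpace ℝ (Fin d) → ℂ} (hf : ContDiff ℝ (⊤ : ℕ∞) f) (i : Fin d) :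
    ContDiff ℝ (⊤ : ℕ∞) (opD i f) :=
  contDiff_const.mul (hf.partialDeriv' i)

theorem ContDiff.quadOp {f : EuclideanSpace ℝ (Fin d) → ℂ} (hf : ContDiff ℝ (⊤ : ℕ∞) f)
    (B : Matrix (Fin d) (Fin d) ℂ) : ContDiff ℝ (⊤ : ℕ∞) (_root_.quadOp B f) :=
  ContDiff.sum fun i _ => ContDiff.sum fun j _ => contDiff_const.mul ((hf.opD i).opD j)

theorem ContDiff.iterate_quadOp {f : EuclideanSpace ℝ (Fin d) → ℂ} (hf : ContDiff ℝ (⊤ : ℕ∞) f)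
    (B : Matrix (Fin d) (Fin d) ℂ) (l : ℕ) : ContDiff ℝ (⊤ : ℕ∞) ((_root_.quadOp B)^[l] f) := by
  induction l with
  | zero => exact hf
  | succ l ih => rw [Function.iterate_succ_apply']; exact ih.quadOp B

theorem tsupport_opD_subset (f : EuclideanSpace ℝ (Fin d) → ℂ) (i : Fin d) :
    tsupport (opD i f) ⊆ tsupport f :=
  tsupport_mul_subset_right.trans (tsupport_partialDeriv_subset f i)

theorem tsupport_quadOp_subset (B : Matrix (Fin d) (Fin d) ℂ)
    (f : EuclideanSpace ℝ (Fin d) → ℂ) : tsupport (quadOp B f) ⊆ tsupport f :=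
  closure_minimal (fun x hx => by
    by_contra h
    refine hx (Finset.sum_eq_zero fun i _ => Finset.sum_eq_zero fun j _ => ?_)
    rw [image_eq_zero_of_notMem_tsupport fun h' => h (tsupport_opD_subset f i
      (tsupport_opD_subset _ j h')), mul_zero]) (isClosed_tsupport f)

theorem tsupport_iterate_quadOp_subset (B : Matrix (Fin d) (Fin d) ℂ)
    (f : EuclideanSpace ℝ (Fin d) → ℂ) (l : ℕ) : tsupport ((quadOp B)^[l] f) ⊆ tsupport f := by
  induction l with
  | zero => exact subset_rfl
  | succ l ih =>
    rw [Function.iterate_succ_apply']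
    exact (tsupport_quadOp_subset B _).trans ih

theorem HasCompactSupport.of_tsupport_subset {f g : EuclideanSpace ℝ (Fin d) → ℂ}
    (hf : HasCompactSupport f) (h : tsupport g ⊆ tsupport f) : HasCompactSupport g :=
  hf.of_isClosed_subset (isClosed_tsupport _) h

theorem fourierInv_partialDeriv {f : EuclideanSpace ℝ (Fin d) → ℂ}
    (hf : ContDiff ℝ (⊤ : ℕ∞) f) (hc : HasCompactSupport f) (i : Fin d)
    (ξ : EuclideanSpace ℝ (Fin d)) :
    𝓕⁻ (partialDeriv i f) ξ = -(2 * Real.pi * Complex.I) * ((ξ i : ℝ) : ℂ) * 𝓕⁻ f ξ := by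
  have h := SchwartzMap.fourierInv_lineDerivOp_eq (hc.toSchwartzMap hf)
    (EuclideanSpace.single i (1 : ℝ))
  have h2 := congrArg (fun g : SchwartzMap (EuclideanSpace ℝ (Fin d)) ℂ => g ξ) h
  have h3 : (LineDeriv.lineDerivOp (EuclideanSpace.single i (1 : ℝ)) (hc.toSchwartzMap hf) :
      EuclideanSpace ℝ (Fin d) → ℂ) = partialDeriv i f := by
    ext x
    rw [SchwartzMap.lineDerivOp_apply_eq_fderiv]
    rfl
  have ht : Function.HasTemperateGrowth fun x : EuclideanSpace ℝ (Fin d) =>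
      inner ℝ x (EuclideanSpace.single i (1 : ℝ)) := by fun_prop
  simp only [SchwartzMap.fourierInv_coe, h3] at h2
  rw [h2, _root_.smul_apply, SchwartzMap.smulLeftCLM_apply_apply ht,
    SchwartzMap.fourierInv_coe]
  simp only [PiLp.inner_apply, smul_eq_mul, Complex.real_smul]
  have h4 : (⇑(hc.toSchwartzMap hf)) = f := rfl
  rw [h4]
  simp [mul_assoc]

theorem fourierInv_const_mul (c : ℂ) (f : EuclideanSpace ℝ (Fin d) → ℂ)
    (ξ : EuclideanSpace ℝ (Fin d)) : 𝓕⁻ (fun x => c * f x) ξ = c * 𝓕⁻ f ξ := by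
  simp only [Real.fourierInv_eq', smul_eq_mul, mul_left_comm _ c, integral_const_mul]

theorem fourierInv_sum' {ι : Type*} (s : Finset ι) {f : ι → EuclideanSpace ℝ (Fin d) → ℂ}
    (hf : ∀ a ∈ s, Integrable (f a)) (ξ : EuclideanSpace ℝ (Fin d)) :
    𝓕⁻ (fun x => ∑ a ∈ s, f a x) ξ = ∑ a ∈ s, 𝓕⁻ (f a) ξ := by
  simp only [Real.fourierInv_eq, Finset.smul_sum]
  rw [integral_finsetSum]
  intro a ha
  have := (Real.fourierIntegral_convergent_iff (V := EuclideanSpace ℝ (Fin d)) (-ξ)).2 (hf a ha)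
  simpa using this

theorem fourierInv_quadOp {f : EuclideanSpace ℝ (Fin d) → ℂ}
    (hf : ContDiff ℝ (⊤ : ℕ∞) f) (hc : HasCompactSupport f) (B : Matrix (Fin d) (Fin d) ℂ)
    (ξ : EuclideanSpace ℝ (Fin d)) :
    𝓕⁻ (quadOp B f) ξ = 4 * Real.pi ^ 2 * quadForm B ξ * 𝓕⁻ f ξ := by
  have hcs : ∀ i j, HasCompactSupport (opD j (opD i f)) := fun i j =>
    hc.of_tsupport_subset ((tsupport_opD_subset _ j).trans (tsupport_opD_subset f i))
  have hint : ∀ i j, Integrable (fun x => B i j * opD j (opD i f) x) := fun i j =>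
    (((hf.opD i).opD j).continuous.integrable_of_hasCompactSupport (hcs i j)).const_mul _
  have hD : ∀ {g : EuclideanSpace ℝ (Fin d) → ℂ}, ContDiff ℝ (⊤ : ℕ∞) g → HasCompactSupport g →
      ∀ i, 𝓕⁻ (opD i g) ξ = -(2 * Real.pi) * ((ξ i : ℝ) : ℂ) * 𝓕⁻ g ξ := by
    intro g hg hgc i
    unfold opD
    rw [fourierInv_const_mul, fourierInv_partialDeriv hg hgc]
    field_simp
  have h1 : ∀ i j, 𝓕⁻ (fun x => B i j * opD j (opD i f) x) ξ =
      4 * Real.pi ^ 2 * (B i j * ((ξ j : ℝ) : ℂ) * ((ξ i : ℝ) : ℂ)) * 𝓕⁻ f ξ := by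
    intro i j
    rw [fourierInv_const_mul, hD (hf.opD i) (hc.of_tsupport_subset (tsupport_opD_subset f i)),
      hD hf hc]
    ring
  unfold quadOp
  rw [fourierInv_sum' _ fun i _ => integrable_finsetSum _ fun j _ => hint i j]
  simp only [fourierInv_sum' _ fun j _ => hint _ j, h1, quadForm_eq_sum, Finset.mul_sum,
    Finset.sum_mul]

theorem fourierInv_iterate_quadOp {f : EuclideanSpace ℝ (Fin d) → ℂ}
    (hf : ContDiff ℝ (⊤ : ℕ∞) f) (hc : HasCompactSupport f) (B : Matrix (Fin d) (Fin d) ℂ)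
    (l : ℕ) (ξ : EuclideanSpace ℝ (Fin d)) :
    𝓕⁻ ((quadOp B)^[l] f) ξ = (4 * Real.pi ^ 2 * quadForm B ξ) ^ l * 𝓕⁻ f ξ := by
  induction l with
  | zero => simp
  | succ l ih =>
    rw [Function.iterate_succ_apply', fourierInv_quadOp (hf.iterate_quadOp B l)
      (hc.of_tsupport_subset (tsupport_iterate_quadOp_subset B f l)), ih]
    ring

theorem integral_fourierInv_eq {f : EuclideanSpace ℝ (Fin d) → ℂ}
    (hf : ContDiff ℝ (⊤ : ℕ∞) f) (hc : HasCompactSupport f) : ∫ ξ, 𝓕⁻ f ξ = f 0 := by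
  let g := hc.toSchwartzMap hf
  have h : 𝓕 (𝓕⁻ g) 0 = g 0 := by rw [FourierTransform.fourier_fourierInv_eq]
  rw [SchwartzMap.fourier_coe, Real.fourier_eq', SchwartzMap.fourierInv_coe] at h
  have h4 : ⇑g = f := rfl
  rw [h4] at h
  simpa using h

theorem iterate_quadOp_zero_eq_integral {f : EuclideanSpace ℝ (Fin d) → ℂ}
    (hf : ContDiff ℝ (⊤ : ℕ∞) f) (hc : HasCompactSupport f) (B : Matrix (Fin d) (Fin d) ℂ)
    (l : ℕ) : (quadOp B)^[l] f 0 = ∫ ξ, (4 * Real.pi ^ 2 * quadForm B ξ) ^ l * 𝓕⁻ f ξ := by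
  rw [← integral_fourierInv_eq (hf.iterate_quadOp B l)
    (hc.of_tsupport_subset (tsupport_iterate_quadOp_subset B f l))]
  simp only [fourierInv_iterate_quadOp hf hc]

/-- After Parseval the Gaussian is `exp z` with `z = -2π² E⁻¹ξ·ξ`. The factor `4π² E⁻¹ξ·ξ` is the
symbol of `⟨E⁻¹ D, D⟩` for the inverse transform, so integrating `z^l 𝓕⁻ f` evaluates `(-½)^l ⟨E⁻¹
D, D⟩^l f` at the origin. The Taylor remainder is at most `|z|^L` since `Re z ≤ 0`. -/
theorem norm_integral_gaussian_sub_le {E : Matrix (Fin d) (Fin d) ℂ}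
    (hE : E ∈ dissipativeMatrices d) {f : EuclideanSpace ℝ (Fin d) → ℂ}
    (hf : ContDiff ℝ (⊤ : ℕ∞) f) (hc : HasCompactSupport f) {m : ℝ} (hm : ∀ i j, ‖E⁻¹ i j‖ ≤ m)
    (L : ℕ) :
    ‖(∫ x, gaussian E x * f x) - gaussianConst E * ∑ l ∈ Finset.range L,
        (-(1 / 2)) ^ l / l.factorial * (quadOp E⁻¹)^[l] f 0‖ ≤
      ‖gaussianConst E‖ *
        ((2 * Real.pi ^ 2 * (d ^ 2 * m)) ^ L * ∫ ξ, ‖ξ‖ ^ (2 * L) * ‖𝓕⁻ f ξ‖) := by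
  have h0 := integral_gaussian_mul hE (hc.toSchwartzMap hf)
  rw [SchwartzMap.fourierInv_coe] at h0
  have h4 : (⇑(hc.toSchwartzMap hf)) = f := rfl
  rw [h4] at h0
  have hFc : Continuous (𝓕⁻ f) := by
    rw [← h4, ← SchwartzMap.fourierInv_coe]; exact SchwartzMap.continuous _
  have hFi : ∀ k : ℕ, Integrable fun ξ => ‖ξ‖ ^ k * ‖𝓕⁻ f ξ‖ := by
    intro k
    have := (𝓕⁻ (hc.toSchwartzMap hf)).integrable_pow_mul volume k
    rwa [SchwartzMap.fourierInv_coe] at this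
  set z : EuclideanSpace ℝ (Fin d) → ℂ := fun ξ => -(1 / 2) * (4 * Real.pi ^ 2 * quadForm E⁻¹ ξ)
  have hzc : Continuous z :=
    (continuous_const.mul (continuous_const.mul (contDiff_quadForm E⁻¹).continuous))
  have hzn : ∀ ξ, ‖z ξ‖ ≤ 2 * Real.pi ^ 2 * (d ^ 2 * m) * ‖ξ‖ ^ 2 := by
    intro ξ
    have hz' : z ξ = ((-(2 * Real.pi ^ 2) : ℝ) : ℂ) * quadForm E⁻¹ ξ := by
      simp only [z]; push_cast; ring
    have h2 : (0 : ℝ) ≤ 2 * Real.pi ^ 2 := by positivity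
    rw [hz', norm_mul, Complex.norm_real, norm_neg, Real.norm_of_nonneg h2,
      mul_assoc (2 * Real.pi ^ 2)]
    exact mul_le_mul_of_nonneg_left (norm_quadForm_le hm ξ) (by positivity)
  have hzr : ∀ ξ, (z ξ).re ≤ 0 := by
    intro ξ
    have hz' : z ξ = ((-(2 * Real.pi ^ 2) : ℝ) : ℂ) * quadForm E⁻¹ ξ := by
      simp only [z]; push_cast; ring
    have h2 : -(2 * Real.pi ^ 2) ≤ 0 := neg_nonpos.mpr (by positivity)
    rw [hz', Complex.re_ofReal_mul]
    exact mul_nonpos_of_nonpos_of_nonneg h2 (re_quadForm_inv_nonneg hE ξ)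
  have hg : ∀ ξ, gaussian ((4 * Real.pi ^ 2 : ℂ) • E⁻¹) ξ = Complex.exp (z ξ) := by
    intro ξ
    change Complex.exp (-(1 / 2) * quadForm ((4 * Real.pi ^ 2 : ℂ) • E⁻¹) ξ) = _
    rw [quadForm_smul]
  have hterm : ∀ l : ℕ, Integrable fun ξ => z ξ ^ l / l.factorial * 𝓕⁻ f ξ := by
    intro l
    refine ((hFi (2 * l)).const_mul ((2 * Real.pi ^ 2 * (d ^ 2 * m)) ^ l)).mono'
      (((hzc.pow l).div_const _).mul hFc).aestronglyMeasurable (.of_forall fun ξ => ?_)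
    rw [norm_mul, norm_div, norm_pow, ← mul_assoc]
    gcongr
    rw [Complex.norm_natCast]
    refine (div_le_self (by positivity) (by exact_mod_cast l.factorial_pos)).trans ?_
    rw [pow_mul, ← mul_pow]
    exact pow_le_pow_left₀ (norm_nonneg _) (hzn ξ) l
  have hexp : Integrable fun ξ => Complex.exp (z ξ) * 𝓕⁻ f ξ := by
    refine (hFi 0).mono' (hzc.cexp.mul hFc).aestronglyMeasurable (.of_forall fun ξ => ?_)
    rw [norm_mul, Complex.norm_exp, pow_zero]
    gcongr
    exact Real.exp_le_one_iff.mpr (hzr ξ)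
  have hsum : ∑ l ∈ Finset.range L, (-(1 / 2)) ^ l / l.factorial * (quadOp E⁻¹)^[l] f 0 =
      ∫ ξ, ∑ l ∈ Finset.range L, z ξ ^ l / l.factorial * 𝓕⁻ f ξ := by
    rw [integral_finsetSum _ fun l _ => hterm l]
    refine Finset.sum_congr rfl fun l _ => ?_
    rw [iterate_quadOp_zero_eq_integral hf hc, ← integral_const_mul]
    congr 1
    ext ξ
    simp only [z, mul_pow]
    ring
  rw [h0, hsum, ← mul_sub, norm_mul]
  refine mul_le_mul_of_nonneg_left ?_ (norm_nonneg _)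
  simp only [hg]
  rw [← integral_sub hexp (integrable_finsetSum _ fun l _ => hterm l), ← integral_const_mul]
  refine norm_integral_le_of_norm_le ((hFi (2 * L)).const_mul _) (.of_forall fun ξ => ?_)
  rw [← Finset.sum_mul, ← sub_mul, norm_mul, ← mul_assoc]
  gcongr
  refine (norm_exp_sub_sum_le (hzr ξ) L).trans ?_
  rw [pow_mul, ← mul_pow]
  exact pow_le_pow_left₀ (norm_nonneg _) (hzn ξ) L

/-- The number of derivatives, beyond `k`, that are needed to integrate `|ξ| ^ k` against a Fourier
transform. -/
def fourierLoss (d : ℕ) : ℕ := (volume : Measure (EuclideanSpace ℝ (Fin d))).integrablePower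

/-- On the unit ball, sup bounds on derivatives control their `L¹` norms and hence the decay of `𝓕⁻
f`. The extra `fourierLoss d` powers of decay make the weighted integral converge. -/
theorem exists_integral_pow_mul_fourierInv_le (d k : ℕ) : ∃ K : ℝ, 0 ≤ K ∧
    ∀ (f : EuclideanSpace ℝ (Fin d) → ℂ) (B : ℝ), ContDiff ℝ (⊤ : ℕ∞) f →
      tsupport f ⊆ Metric.closedBall 0 1 → 0 ≤ B → VanishBound B (k + fourierLoss d) 0 f →
      ∫ ξ, ‖ξ‖ ^ k * ‖𝓕⁻ f ξ‖ ≤ K * B := by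
  set P := fourierLoss d with hP
  set V := volume.real (Metric.closedBall (0 : EuclideanSpace ℝ (Fin d)) 1) with hV
  have hV0 : 0 ≤ V := measureReal_nonneg
  set c : ℕ → ℝ := fun n => 2 ^ n * ∑ m ∈ Finset.range (n + 1), (d ^ m * V) with hc
  have hc0 : ∀ n, 0 ≤ c n := fun n => by positivity
  set I0 := ∫ x : EuclideanSpace ℝ (Fin d), (1 + ‖x‖) ^ (-(P : ℝ)) with hI0
  have hI : 0 ≤ I0 := integral_nonneg fun x => by positivity
  refine ⟨2 ^ P * I0 * (c 0 + c (k + P)), by have := hc0 0; have := hc0 (k + P); positivity, ?_⟩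
  intro f B hf hs hB vf
  have hcs : HasCompactSupport f :=
    (isCompact_closedBall _ _).of_isClosed_subset (isClosed_tsupport _) hs
  have hint : ∀ (j n : ℕ), Integrable fun v => ‖v‖ ^ j * ‖iteratedFDeriv ℝ n f v‖ := fun j n =>
    (hcs.toSchwartzMap hf).integrable_pow_mul_iteratedFDeriv volume j n
  have hL1 : ∀ n ≤ k + P, ∫ v, ‖v‖ ^ 0 * ‖iteratedFDeriv ℝ n f v‖ ≤ d ^ n * V * B := by
    intro n hn
    have h1 : ∀ v, v ∉ Metric.closedBall (0 : EuclideanSpace ℝ (Fin d)) 1 →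
        ‖v‖ ^ 0 * ‖iteratedFDeriv ℝ n f v‖ = 0 := fun v hv => by
      rw [image_eq_zero_of_notMem_tsupport fun h =>
        hv (hs (tsupport_iteratedFDeriv_subset n h)), norm_zero, mul_zero]
    rw [← setIntegral_eq_integral_of_forall_compl_eq_zero h1]
    have := norm_setIntegral_le_of_norm_le_const (μ := volume)
      (s := Metric.closedBall (0 : EuclideanSpace ℝ (Fin d)) 1) (C := d ^ n * B)
      (f := fun v => ‖v‖ ^ 0 * ‖iteratedFDeriv ℝ n f v‖)
      (isCompact_closedBall _ _).measure_lt_top (fun v hv => by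
        rw [pow_zero, one_mul, norm_norm]
        exact vf.norm_iteratedFDeriv_le hf hB hn (by simpa using hv))
    refine (le_abs_self _).trans (this.trans (le_of_eq (by ring)))
  have hdec : ∀ n ≤ k + P, ∀ ξ, ‖ξ‖ ^ n * ‖𝓕⁻ f ξ‖ ≤ c n * B := by
    intro n hn ξ
    rw [Real.fourierInv_eq_fourier_neg]
    have h := Real.pow_mul_norm_iteratedFDeriv_fourier_le (K := 0) (N := (⊤ : ℕ∞)) hf
      (fun j n _ _ => hint j n) (k := 0) (n := n) (by simp) le_top (-ξ)
    rw [norm_neg, norm_iteratedFDeriv_zero] at h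
    refine h.trans ?_
    rw [Finset.sum_product]
    simp only [zero_add, Finset.sum_range_one, pow_zero, one_mul, Nat.cast_zero, mul_zero, hc]
    rw [mul_assoc, Finset.sum_mul]
    refine mul_le_mul_of_nonneg_left (Finset.sum_le_sum fun m hm => ?_) (by positivity)
    simpa using hL1 m (by have := Finset.mem_range.mp hm; omega)
  have h := integral_pow_mul_le_of_le_of_pow_mul_le
    (μ := (volume : Measure (EuclideanSpace ℝ (Fin d)))) (f := 𝓕⁻ f) (k := k)
    (C₁ := c 0 * B) (C₂ := c (k + P) * B)
    (fun ξ => by simpa using hdec 0 (by omega) ξ) (fun ξ => hdec (k + P) le_rfl ξ)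
  refine h.trans (le_of_eq ?_)
  change 2 ^ P * I0 * _ = _
  ring

/-! ### The phase and its remainder -/

theorem hessianZero_isSymm {φ : EuclideanSpace ℝ (Fin d) → ℂ} (hφ : ContDiff ℝ (⊤ : ℕ∞) φ) :
    (hessianZero φ).IsSymm := by
  ext i j
  simp [hessianZero, partialDeriv_comm hφ]

theorem partialDeriv_quadForm {B : Matrix (Fin d) (Fin d) ℂ} (hB : B.IsSymm) (k : Fin d) :
    partialDeriv k (quadForm B) = fun x => 2 * ∑ j, B k j * ((x j : ℝ) : ℂ) := by
  have h0 : quadForm B = fun x => ∑ i, (∑ j, B i j * ((x j : ℝ) : ℂ)) * ((x i : ℝ) : ℂ) := by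
    ext x
    rw [quadForm_eq_sum]
    simp only [Finset.sum_mul]
  have hs : ∀ i, ContDiff ℝ (⊤ : ℕ∞) fun x : EuclideanSpace ℝ (Fin d) =>
      (∑ j, B i j * ((x j : ℝ) : ℂ)) * ((x i : ℝ) : ℂ) :=
    fun i => (contDiff_linear_coord (B i)).mul (contDiff_coord i)
  rw [h0, partialDeriv_sum _ fun i _ => (hs i).differentiable_of_top]
  ext x
  simp only [partialDeriv_mul (contDiff_linear_coord _).differentiable_of_top
    (contDiff_coord _).differentiable_of_top, partialDeriv_coord, partialDeriv_linear_coord]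
  rw [Finset.sum_add_distrib, two_mul]
  congr 1
  · exact Finset.sum_congr rfl fun i _ => by rw [hB.apply]
  · simp

section phase

variable {φ : EuclideanSpace ℝ (Fin d) → ℂ}

theorem phaseRemainder_eq (φ : EuclideanSpace ℝ (Fin d) → ℂ) :
    phaseRemainder φ = fun x => φ x - φ 0 - 1 / 2 * quadForm (hessianZero φ) x := by
  ext x
  rw [phaseRemainder, quadForm_eq_sum]

theorem contDiff_phaseRemainder (hφ : ContDiff ℝ (⊤ : ℕ∞) φ) :
    ContDiff ℝ (⊤ : ℕ∞) (phaseRemainder φ) := by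
  rw [phaseRemainder_eq]
  exact (hφ.sub contDiff_const).sub (contDiff_const.mul (contDiff_quadForm _))

theorem partialDeriv_phaseRemainder (hφ : ContDiff ℝ (⊤ : ℕ∞) φ) (i : Fin d) :
    partialDeriv i (phaseRemainder φ) = fun x => partialDeriv i φ x -
      ∑ j, hessianZero φ i j * ((x j : ℝ) : ℂ) := by
  rw [phaseRemainder_eq, partialDeriv_sub (hφ.sub contDiff_const).differentiable_of_top
    (contDiff_const.mul (contDiff_quadForm _)).differentiable_of_top,
    partialDeriv_sub hφ.differentiable_of_top contDiff_const.differentiable_of_top,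
    partialDeriv_const, partialDeriv_const_mul (contDiff_quadForm _).differentiable_of_top,
    partialDeriv_quadForm (hessianZero_isSymm hφ)]
  ext x
  ring

theorem partialDeriv_partialDeriv_phaseRemainder (hφ : ContDiff ℝ (⊤ : ℕ∞) φ) (i j : Fin d) :
    partialDeriv i (partialDeriv j (phaseRemainder φ)) =
      fun x => partialDeriv i (partialDeriv j φ) x - hessianZero φ j i := by
  rw [partialDeriv_phaseRemainder hφ, partialDeriv_sub (hφ.partialDeriv' j).differentiable_of_top
    (contDiff_linear_coord _).differentiable_of_top, partialDeriv_linear_coord]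

/-- Third derivatives of the remainder are those of the phase, while its value, gradient and Hessian
vanish at the origin. Each of the three integrations from the origin adds one order and a factor `1
+ d`. -/
theorem vanishBound_phaseRemainder (hφ : ContDiff ℝ (⊤ : ℕ∞) φ)
    (hcrit : ∀ i, partialDeriv i φ 0 = 0) {B : ℝ} {n : ℕ}
    (hb : ∀ m, 3 ≤ m → m ≤ n + 3 → ∀ x, ‖x‖ ≤ 1 → ‖iteratedFDeriv ℝ m φ x‖ ≤ B) :
    VanishBound ((1 + d) ^ 3 * B) (n + 3) 3 (phaseRemainder φ) ∧
      ∀ i, VanishBound ((1 + d) ^ 2 * B) (n + 2) 2 (partialDeriv i (phaseRemainder φ)) := by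
  have hB : 0 ≤ B := (norm_nonneg _).trans (hb 3 le_rfl (by omega) 0 (by simp))
  have sG := contDiff_phaseRemainder hφ
  have h3 : ∀ k i j, VanishBound B n 0
      (partialDeriv k (partialDeriv i (partialDeriv j (phaseRemainder φ)))) := by
    intro k i j
    have e : partialDeriv k (partialDeriv i (partialDeriv j (phaseRemainder φ))) =
        partialDeriv k (partialDeriv i (partialDeriv j φ)) := by
      rw [partialDeriv_partialDeriv_phaseRemainder hφ, partialDeriv_sub
        ((hφ.partialDeriv' j).partialDeriv' i).differentiable_of_top
        contDiff_const.differentiable_of_top, partialDeriv_const]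
      ext x
      simp
    rw [e]
    refine VanishBound.of_iteratedFDeriv (((hφ.partialDeriv' j).partialDeriv' i).partialDeriv' k)
      fun m hm x hx => ?_
    refine (norm_iteratedFDeriv_partialDeriv_le ((hφ.partialDeriv' j).partialDeriv' i) k m x).trans
      ((norm_iteratedFDeriv_partialDeriv_le (hφ.partialDeriv' j) i (m + 1) x).trans
      ((norm_iteratedFDeriv_partialDeriv_le hφ j (m + 1 + 1) x).trans
      (hb _ (by omega) (by omega) x hx)))
  have h2 : ∀ i j, VanishBound ((1 + d) * B) (n + 1) 1
      (partialDeriv i (partialDeriv j (phaseRemainder φ))) := by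
    intro i j
    refine (VanishBound.of_partialDeriv ((sG.partialDeriv' j).partialDeriv' i) ?_ hB
      fun k => h3 k i j).mono (le_of_eq (by ring)) (by positivity) le_rfl
    rw [partialDeriv_partialDeriv_phaseRemainder hφ, partialDeriv_comm hφ]
    simp [hessianZero]
  have h1 : ∀ j, VanishBound ((1 + d) ^ 2 * B) (n + 2) 2 (partialDeriv j (phaseRemainder φ)) := by
    intro j
    refine (VanishBound.of_partialDeriv (sG.partialDeriv' j) ?_ (by positivity)
      fun i => h2 i j).mono (le_of_eq (by ring)) (by positivity) le_rfl
    rw [partialDeriv_phaseRemainder hφ]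
    simp [hcrit]
  refine ⟨?_, h1⟩
  refine (VanishBound.of_partialDeriv sG ?_ (by positivity) h1).mono (le_of_eq (by ring))
    (by positivity) le_rfl
  simp [phaseRemainder]

end phase

/-! ### The vector field adapted to the phase -/

/-- `S x · R x = x · x` because `S` is symmetric and inverse to `R`. With `S = φ''(0)⁻¹` the leading
part of the denominator is exactly `|x|²`, whatever the complex Hessian is, and no deformation into
complex space is needed. -/
theorem linField_quadForm {R S : Matrix (Fin d) (Fin d) ℂ} (hR : R.IsSymm) (hS : S.IsSymm)
    (hSR : S * R = 1) (x : EuclideanSpace ℝ (Fin d)) :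
    linField S (quadForm R) x = 2 * ∑ i, ((x i : ℝ) : ℂ) * ((x i : ℝ) : ℂ) := by
  have h1 : linField S (quadForm R) x =
      2 * (S.mulVec (complexVec x) ⬝ᵥ R.mulVec (complexVec x)) := by
    simp only [linField, partialDeriv_quadForm hR, dotProduct, Matrix.mulVec, Finset.mul_sum,
      complexVec]
    refine Finset.sum_congr rfl fun i _ => ?_
    simp only [← Finset.mul_sum]
    ring
  rw [h1, ← Matrix.vecMul_transpose, hS.eq, ← Matrix.dotProduct_mulVec, Matrix.mulVec_mulVec, hSR,
    Matrix.one_mulVec]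
  rfl

theorem linField_add {F G : EuclideanSpace ℝ (Fin d) → ℂ} (hF : Differentiable ℝ F)
    (hG : Differentiable ℝ G) (S : Matrix (Fin d) (Fin d) ℂ) :
    linField S (fun x => F x + G x) = fun x => linField S F x + linField S G x := by
  ext x
  simp only [linField, partialDeriv_add hF hG, mul_add, Finset.sum_add_distrib]

theorem linField_const_mul {F : EuclideanSpace ℝ (Fin d) → ℂ} (hF : Differentiable ℝ F)
    (c : ℂ) (S : Matrix (Fin d) (Fin d) ℂ) :
    linField S (fun x => c * F x) = fun x => c * linField S F x := by
  ext x
  simp only [linField, partialDeriv_const_mul hF, Finset.mul_sum]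
  exact Finset.sum_congr rfl fun i _ => by rw [mul_left_comm]

theorem linField_cexp {F : EuclideanSpace ℝ (Fin d) → ℂ} (hF : Differentiable ℝ F)
    (S : Matrix (Fin d) (Fin d) ℂ) (x : EuclideanSpace ℝ (Fin d)) :
    linField S (fun x => Complex.exp (F x)) x = linField S F x * Complex.exp (F x) := by
  have h : ∀ i, partialDeriv i (fun x => Complex.exp (F x)) x =
      partialDeriv i F x * Complex.exp (F x) := by
    intro i
    simp only [partialDeriv]
    rw [((hF x).hasFDerivAt.cexp).fderiv]
    simp [mul_comm]
  simp only [linField, h, Finset.sum_mul, mul_assoc]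

theorem sum_coord_sq (x : EuclideanSpace ℝ (Fin d)) :
    ∑ i, ((x i : ℝ) : ℂ) * ((x i : ℝ) : ℂ) = ((‖x‖ ^ 2 : ℝ) : ℂ) := by
  rw [EuclideanSpace.norm_sq_eq]
  push_cast
  refine Finset.sum_congr rfl fun i _ => ?_
  rw [← Complex.ofReal_pow, Real.norm_eq_abs, sq_abs]
  push_cast; ring

theorem vanishBound_sum_coord_sq (n : ℕ) : VanishBound (d * 2 ^ n) n 2
    (fun x : EuclideanSpace ℝ (Fin d) => ∑ i, ((x i : ℝ) : ℂ) * ((x i : ℝ) : ℂ)) := by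
  refine (VanishBound.sum _ (fun i _ => (VanishBound.coord n i).mul (VanishBound.coord n i)
    zero_le_one zero_le_one (contDiff_coord i) (contDiff_coord i))
    fun i _ => (contDiff_coord i).mul (contDiff_coord i)).mono ?_ (by positivity) le_rfl
  simp

/-- The factor `exp (i lam (½ φ''(0) x · x + s g(x)))`. -/
def phaseFactor (φ : EuclideanSpace ℝ (Fin d) → ℂ) (lam s : ℝ) (x : EuclideanSpace ℝ (Fin d)) : ℂ :=
  Complex.exp (Complex.I * lam * (1 / 2 * quadForm (hessianZero φ) x + s * phaseRemainder φ x))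

/-- The derivative of the phase `½ φ''(0) x · x + s g(x)` along `φ''(0)⁻¹ x`. -/
def phaseDenominator (φ : EuclideanSpace ℝ (Fin d) → ℂ) (s : ℝ) (x : EuclideanSpace ℝ (Fin d)) :
    ℂ :=
  ∑ i, ((x i : ℝ) : ℂ) * ((x i : ℝ) : ℂ) + s * linField (hessianZero φ)⁻¹ (phaseRemainder φ) x

/-- Hypotheses at unit scale on the phase and on the support `T` of the amplitude. -/
structure UnitPhase (φ : EuclideanSpace ℝ (Fin d) → ℂ) (T : Set (EuclideanSpace ℝ (Fin d)))
    (n : ℕ) (M B c ε : ℝ) : Prop where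
  smooth : ContDiff ℝ (⊤ : ℕ∞) φ
  zero : φ 0 = 0
  critical : ∀ i, partialDeriv i φ 0 = 0
  invertible : IsUnit (hessianZero φ)
  inv_bound : ∀ i j, ‖(hessianZero φ)⁻¹ i j‖ ≤ M
  bound : ∀ m, 3 ≤ m → m ≤ n + 3 → ∀ x, ‖x‖ ≤ 1 → ‖iteratedFDeriv ℝ m φ x‖ ≤ B
  bound_three : ∀ x, ‖x‖ ≤ 1 → ‖iteratedFDeriv ℝ 3 φ x‖ ≤ c
  closed : IsClosed T
  subset : T ⊆ Metric.closedBall 0 ε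
  le_one : ε ≤ 1
  small : d ^ 2 * (1 + d) ^ 2 * M * c * ε ≤ 1 / 2
  im_nonneg : ∀ x ∈ T, 0 ≤ (φ x).im

namespace UnitPhase

variable {φ : EuclideanSpace ℝ (Fin d) → ℂ} {T : Set (EuclideanSpace ℝ (Fin d))}
  {n : ℕ} {M B c ε : ℝ}

theorem isUnit_det (h : UnitPhase φ T n M B c ε) : IsUnit (hessianZero φ).det :=
  (Matrix.isUnit_iff_isUnit_det _).mp h.invertible

theorem norm_le_one (h : UnitPhase φ T n M B c ε) {x : EuclideanSpace ℝ (Fin d)} (hx : x ∈ T) :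
    ‖x‖ ≤ 1 :=
  (by simpa using h.subset hx : ‖x‖ ≤ ε).trans h.le_one

theorem B_nonneg (h : UnitPhase φ T n M B c ε) : 0 ≤ B :=
  (norm_nonneg _).trans (h.bound 3 le_rfl (by omega) 0 (by simp))

theorem vanishBound (h : UnitPhase φ T n M B c ε) :
    VanishBound ((1 + d) ^ 3 * B) n 3 (phaseRemainder φ) :=
  (vanishBound_phaseRemainder h.smooth h.critical h.bound).1.of_le (by omega)

theorem phase_eq (h : UnitPhase φ T n M B c ε) (x : EuclideanSpace ℝ (Fin d)) :
    φ x = 1 / 2 * quadForm (hessianZero φ) x + phaseRemainder φ x := by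
  rw [phaseRemainder_eq]
  simp [h.zero]

/-- The gradient of the remainder is quadratically small with a constant coming from third
derivatives only. The smallness of `ε` therefore depends on `M` and `c`, not on the bound `B`, which
involves more derivatives as `k` grows. -/
theorem norm_linField_le (h : UnitPhase φ T n M B c ε) (hM : 0 ≤ M)
    {x : EuclideanSpace ℝ (Fin d)} (hx : x ∈ T) :
    ‖linField (hessianZero φ)⁻¹ (phaseRemainder φ) x‖ ≤ ‖x‖ ^ 2 / 2 := by
  have hx1 := h.norm_le_one hx
  have hxε : ‖x‖ ≤ ε := by simpa using h.subset hx
  have hc : 0 ≤ c := (norm_nonneg _).trans (h.bound_three 0 (by simp))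
  have h1 := (vanishBound_phaseRemainder (n := 0) h.smooth h.critical (B := c)
    fun m hm hm' x hx => by
      obtain rfl : m = 3 := by omega
      exact h.bound_three x hx).2
  have h2 : ∀ i, ‖(∑ j, (hessianZero φ)⁻¹ i j * ((x j : ℝ) : ℂ)) *
      partialDeriv i (phaseRemainder φ) x‖ ≤ (d * M * ‖x‖ ^ 1) * ((1 + d) ^ 2 * c * ‖x‖ ^ 2) := by
    intro i
    rw [norm_mul]
    exact mul_le_mul ((VanishBound.linear_coord (h.inv_bound i) 0).le hx1) ((h1 i).le hx1)
      (norm_nonneg _) (by positivity)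
  refine (norm_sum_le_of_le _ fun i _ => h2 i).trans ?_
  simp only [Finset.sum_const, Finset.card_univ, Fintype.card_fin, nsmul_eq_mul]
  calc (d : ℝ) * (d * M * ‖x‖ ^ 1 * ((1 + d) ^ 2 * c * ‖x‖ ^ 2))
      = (d ^ 2 * (1 + d) ^ 2 * M * c * ‖x‖) * ‖x‖ ^ 2 := by ring
    _ ≤ (d ^ 2 * (1 + d) ^ 2 * M * c * ε) * ‖x‖ ^ 2 := by gcongr
    _ ≤ 1 / 2 * ‖x‖ ^ 2 := by gcongr; exact h.small
    _ = _ := by ring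

theorem contDiff_phaseDenominator (h : UnitPhase φ T n M B c ε) (s : ℝ) :
    ContDiff ℝ (⊤ : ℕ∞) (phaseDenominator φ s) :=
  (ContDiff.sum fun i _ => (contDiff_coord i).mul (contDiff_coord i)).add
    (contDiff_const.mul ((contDiff_phaseRemainder h.smooth).linField _))

theorem contDiff_phaseFactor (h : UnitPhase φ T n M B c ε) (lam s : ℝ) :
    ContDiff ℝ (⊤ : ℕ∞) (phaseFactor φ lam s) :=
  (contDiff_const.mul ((contDiff_const.mul (contDiff_quadForm _)).add
    (contDiff_const.mul (contDiff_phaseRemainder h.smooth)))).cexp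

/-- The quadratic part contributes `|x|²` to the denominator and the remainder at most half of that
on `T`, for every `s` in `[0, 1]`. -/
theorem oscFactor (h : UnitPhase φ T n M B c ε) (hM : 0 ≤ M) {lam s : ℝ} (hlam : 0 ≤ lam)
    (hs0 : 0 ≤ s) (hs1 : s ≤ 1) (him : ∀ x ∈ T, 0 ≤
      (1 / 2 * quadForm (hessianZero φ) x + s * phaseRemainder φ x).im) :
    OscFactor (hessianZero φ)⁻¹ lam T (phaseFactor φ lam s) (phaseDenominator φ s) where
  closed := h.closed
  subset := h.subset.trans (Metric.closedBall_subset_closedBall h.le_one)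
  smooth := h.contDiff_phaseFactor lam s
  smooth_b := h.contDiff_phaseDenominator s
  norm_le := fun x hx => by
    rw [phaseFactor, Complex.norm_exp, Real.exp_le_one_iff]
    have := mul_nonneg hlam (him x hx)
    rw [mul_assoc, Complex.I_mul_re, Complex.im_ofReal_mul]
    linarith
  linField_eq := fun x => by
    have hsymm := hessianZero_isSymm h.smooth
    have sq := contDiff_quadForm (hessianZero φ)
    have sG := contDiff_phaseRemainder h.smooth
    have hSR := Matrix.nonsing_inv_mul _ h.isUnit_det
    have hS : ((hessianZero φ)⁻¹).IsSymm := by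
      rw [Matrix.IsSymm, Matrix.transpose_nonsing_inv, hsymm.eq]
    unfold phaseFactor
    have s1 : ContDiff ℝ (⊤ : ℕ∞) (fun x => 1 / 2 * quadForm (hessianZero φ) x) :=
      contDiff_const.mul sq
    have s2 : ContDiff ℝ (⊤ : ℕ∞) (fun x => (s : ℂ) * phaseRemainder φ x) :=
      contDiff_const.mul sG
    rw [linField_cexp (contDiff_const.mul (s1.add s2)).differentiable_of_top,
      linField_const_mul (s1.add s2).differentiable_of_top,
      linField_add s1.differentiable_of_top s2.differentiable_of_top,
      linField_const_mul sq.differentiable_of_top, linField_const_mul sG.differentiable_of_top]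
    simp only [linField_quadForm hsymm hS hSR, phaseDenominator]
    ring
  re_ge := fun x hx => by
    rw [phaseDenominator, sum_coord_sq, Complex.add_re, Complex.ofReal_re, Complex.re_ofReal_mul]
    have h1 := (Complex.abs_re_le_norm _).trans (h.norm_linField_le hM hx)
    have h2 := neg_le_of_abs_le h1
    nlinarith [sq_nonneg ‖x‖]

theorem vanishBound_phaseDenominator (h : UnitPhase φ T (n + 1) M B c ε) (hM : 0 ≤ M) {s : ℝ}
    (hs0 : 0 ≤ s) (hs1 : s ≤ 1) :
    VanishBound (d * 2 ^ n + d * (2 ^ n * (d * M * ((1 + d) ^ 3 * B)))) n 2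
      (phaseDenominator φ s) := by
  have hB := h.B_nonneg
  have sG := contDiff_phaseRemainder h.smooth
  have h1 := h.vanishBound.linField hM (by positivity) h.inv_bound sG
  refine (vanishBound_sum_coord_sq n).add ((h1.const_mul (sG.linField _) (s : ℂ)).mono ?_
    (by positivity) (by norm_num))
    (ContDiff.sum fun i _ => (contDiff_coord i).mul (contDiff_coord i))
    (contDiff_const.mul (sG.linField _))
  rw [Complex.norm_real, Real.norm_of_nonneg hs0]
  exact mul_le_of_le_one_left (by positivity) hs1

end UnitPhase

/-! ### The expansion at unit scale -/

theorem quadOp_smul (c : ℂ) (B : Matrix (Fin d) (Fin d) ℂ) (f : EuclideanSpace ℝ (Fin d) → ℂ) :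
    quadOp (c • B) f = fun x => c * quadOp B f x := by
  ext x
  simp only [quadOp, Matrix.smul_apply, smul_eq_mul, Finset.mul_sum, mul_assoc]

theorem opD_const_mul {f : EuclideanSpace ℝ (Fin d) → ℂ} (hf : ContDiff ℝ (⊤ : ℕ∞) f) (c : ℂ)
    (i : Fin d) : opD i (fun x => c * f x) = fun x => c * opD i f x := by
  ext x
  simp only [opD, partialDeriv_const_mul hf.differentiable_of_top]
  ring

theorem quadOp_const_mul {f : EuclideanSpace ℝ (Fin d) → ℂ} (hf : ContDiff ℝ (⊤ : ℕ∞) f) (c : ℂ)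
    (B : Matrix (Fin d) (Fin d) ℂ) :
    quadOp B (fun x => c * f x) = fun x => c * quadOp B f x := by
  ext x
  simp only [quadOp, opD_const_mul hf, opD_const_mul (hf.opD _), Finset.mul_sum]
  exact Finset.sum_congr rfl fun i _ => Finset.sum_congr rfl fun j _ => by ring

theorem iterate_quadOp_smul {f : EuclideanSpace ℝ (Fin d) → ℂ} (hf : ContDiff ℝ (⊤ : ℕ∞) f)
    (c : ℂ) (B : Matrix (Fin d) (Fin d) ℂ) (l : ℕ) :
    (quadOp (c • B))^[l] f = fun x => c ^ l * (quadOp B)^[l] f x := by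
  induction l with
  | zero => simp
  | succ l ih =>
    rw [Function.iterate_succ_apply', ih, quadOp_smul, quadOp_const_mul (hf.iterate_quadOp B l),
      Function.iterate_succ_apply']
    ext x
    ring

theorem VanishBound.quadOp {B m : ℝ} {n p : ℕ} {f : EuclideanSpace ℝ (Fin d) → ℂ}
    {S : Matrix (Fin d) (Fin d) ℂ} (hB : 0 ≤ B) (hS : ∀ i j, ‖S i j‖ ≤ m)
    (hf : VanishBound B (n + 2) p f) (sf : ContDiff ℝ (⊤ : ℕ∞) f) :
    VanishBound (∑ _i : Fin d, ∑ _j : Fin d, m * B) n (p - 2) (quadOp S f) := by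
  have hD : ∀ {n p : ℕ} {g : EuclideanSpace ℝ (Fin d) → ℂ} (i : Fin d),
      VanishBound B (n + 1) p g → ContDiff ℝ (⊤ : ℕ∞) g → VanishBound B n (p - 1) (opD i g) :=
    fun i hg sg => ((hg.2 i).const_mul (sg.partialDeriv' i) _).mono (by simp) hB le_rfl
  refine VanishBound.sum _ (fun i _ => VanishBound.sum _ (fun j _ => ?_)
    fun j _ => contDiff_const.mul ((sf.opD i).opD j))
    fun i _ => ContDiff.sum fun j _ => contDiff_const.mul ((sf.opD i).opD j)
  exact ((hD j (hD i hf sf) (sf.opD i)).const_mul ((sf.opD i).opD j) _).mono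
    (mul_le_mul_of_nonneg_right (hS i j) hB)
    (mul_nonneg ((norm_nonneg _).trans (hS i j)) hB) (by omega)

theorem iterate_quadOp_zero_of_vanishBound {B m : ℝ} {n p l : ℕ}
    {f : EuclideanSpace ℝ (Fin d) → ℂ} {S : Matrix (Fin d) (Fin d) ℂ} (hB : 0 ≤ B) (hm : 0 ≤ m)
    (hS : ∀ i j, ‖S i j‖ ≤ m) (hf : VanishBound B n p f) (sf : ContDiff ℝ (⊤ : ℕ∞) f)
    (hn : 2 * l ≤ n) (hp : 2 * l < p) : (quadOp S)^[l] f 0 = 0 := by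
  induction l generalizing B n p f with
  | zero =>
    have := hf.le (x := 0) (by simp)
    rw [norm_zero, zero_pow (by omega), mul_zero] at this
    exact norm_le_zero_iff.mp this
  | succ l ih =>
    rw [Function.iterate_succ_apply]
    exact ih (n := n - 2) (p := p - 2) (B := ∑ _i : Fin d, ∑ _j : Fin d, m * B) (by positivity)
      (VanishBound.quadOp hB hS (by rwa [show n - 2 + 2 = n by omega]) sf) (sf.quadOp S)
      (by omega) (by omega)

/-- Rearrangement of the double sum over the orders of the Taylor expansions of the two exponentials
into powers of the large parameter. -/
theorem sum_rearrange (k : ℕ) (lam : ℂ) (hlam : lam ≠ 0) (Q : ℕ → ℕ → ℂ)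
    (hQ : ∀ l m, m < 2 * k → l < k + m → 2 * l < 3 * m → Q l m = 0) :
    ∑ m ∈ Finset.range (2 * k), (Complex.I * lam) ^ m / m.factorial *
      ∑ l ∈ Finset.range (k + m), (-(1 / 2)) ^ l / l.factorial *
        ((Complex.I / lam) ^ l * Q l m) =
    ∑ j ∈ Finset.range k, (lam⁻¹) ^ j * ∑ p ∈ spIndex j, Complex.I ^ (-(j : ℤ)) *
      (2 : ℂ) ^ (-(p.1 : ℤ)) / ((p.1.factorial : ℂ) * (p.2.factorial : ℂ)) * Q p.1 p.2 := by
  classical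
  let t : ℕ × ℕ → ℂ := fun p => (Complex.I * lam) ^ p.2 / p.2.factorial *
    ((-(1 / 2)) ^ p.1 / p.1.factorial * ((Complex.I / lam) ^ p.1 * Q p.1 p.2))
  let P : Finset (ℕ × ℕ) := (Finset.range (3 * k) ×ˢ Finset.range (2 * k)).filter
    fun p => p.1 < k + p.2
  let P' : Finset (ℕ × ℕ) := P.filter fun p => 3 * p.2 ≤ 2 * p.1
  have hL : ∑ m ∈ Finset.range (2 * k), (Complex.I * lam) ^ m / m.factorial *
      ∑ l ∈ Finset.range (k + m), (-(1 / 2)) ^ l / l.factorial *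
        ((Complex.I / lam) ^ l * Q l m) = ∑ p ∈ P, t p := by
    simp only [P, Finset.sum_filter, Finset.sum_product_right]
    refine Finset.sum_congr rfl fun m hm => ?_
    rw [← Finset.sum_filter, Finset.mul_sum]
    have : Finset.range (k + m) = (Finset.range (3 * k)).filter fun l => l < k + m := by
      ext l
      have := Finset.mem_range.mp hm
      simp only [Finset.mem_range, Finset.mem_filter]
      omega
    rw [this]
  -- Pairs with `2 l < 3 m` carry a factor that is zero by hypothesis.
  have hP' : ∑ p ∈ P, t p = ∑ p ∈ P', t p := by
    refine (Finset.sum_subset (Finset.filter_subset _ _) fun p hp hp' => ?_).symm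
    simp only [P, Finset.mem_filter, Finset.mem_product, Finset.mem_range] at hp hp'
    simp only [t]
    rw [hQ p.1 p.2 (by omega) (by omega) (by omega)]
    simp
  have hmaps : ∀ p ∈ P', p.1 - p.2 ∈ Finset.range k := by
    intro p hp
    simp only [P', P, Finset.mem_filter, Finset.mem_product, Finset.mem_range] at hp ⊢
    omega
  rw [hL, hP', ← Finset.sum_fiberwise_of_maps_to hmaps]
  refine Finset.sum_congr rfl fun j hj => ?_
  -- No pair of `spIndex j` is lost by the truncation: `l = m + j` and `2 l ≥ 3 m` give `m ≤ 2 j < 2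
  -- k`, and then `l < k + m`.
  have hfib : P'.filter (fun p => p.1 - p.2 = j) = spIndex j := by
    ext p
    have := Finset.mem_range.mp hj
    rw [mem_spIndex]
    simp only [P', P, Finset.mem_filter, Finset.mem_product, Finset.mem_range]
    omega
  rw [hfib, Finset.mul_sum]
  refine Finset.sum_congr rfl fun p hp => ?_
  have hp1 := (mem_spIndex.mp hp).1
  simp only [t]
  -- Since `-½ · i / lam = ½ · (i lam)⁻¹`, the `m` factors `i lam` cancel all but `j = l - m` of the
  -- inverse factors.
  have e : (Complex.I * lam) ^ p.2 * ((-(1 / 2)) ^ p.1 * (Complex.I / lam) ^ p.1) =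
      (lam⁻¹) ^ j * (Complex.I ^ (-(j : ℤ)) * (2 : ℂ) ^ (-(p.1 : ℤ))) := by
    have h2 : (-(1 / 2) : ℂ) ^ p.1 * (Complex.I / lam) ^ p.1 =
        (Complex.I⁻¹ * lam⁻¹) ^ p.1 * (2⁻¹) ^ p.1 := by
      rw [← mul_pow, ← mul_pow, Complex.inv_I]
      congr 1
      field_simp
    rw [h2, hp1, zpow_neg, zpow_neg, zpow_natCast, zpow_natCast, pow_add (Complex.I⁻¹ * lam⁻¹),
      ← mul_assoc, ← mul_assoc, ← mul_pow]
    rw [show Complex.I * lam * (Complex.I⁻¹ * lam⁻¹) = 1 by field_simp [Complex.I_ne_zero]]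
    rw [one_pow, one_mul, mul_pow, inv_pow, inv_pow]
    simp only [inv_pow, pow_add, mul_inv]
    ring
  calc (Complex.I * lam) ^ p.2 / p.2.factorial *
      ((-(1 / 2)) ^ p.1 / p.1.factorial * ((Complex.I / lam) ^ p.1 * Q p.1 p.2))
      = ((Complex.I * lam) ^ p.2 * ((-(1 / 2)) ^ p.1 * (Complex.I / lam) ^ p.1)) /
        (p.1.factorial * p.2.factorial) * Q p.1 p.2 := by ring
    _ = _ := by rw [e]; ring

/-- The squared modulus is `(2π)^d |det E⁻¹|`, so the branch plays no role. The bound `t ≤ 1 + q`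
from `t² ≤ q` avoids a root. -/
theorem norm_gaussianConst_le {E : Matrix (Fin d) (Fin d) ℂ} (hE : E ∈ dissipativeMatrices d)
    {m : ℝ} (hm : ∀ i j, ‖E⁻¹ i j‖ ≤ m) :
    ‖gaussianConst E‖ ≤ 1 + (2 * Real.pi) ^ d * (d.factorial * m ^ d) := by
  have h1 : ‖gaussianConst E‖ ^ 2 = (2 * Real.pi) ^ d * ‖(E⁻¹).det‖ := by
    have h2 : detSqrt E ^ 2 = E.det := (isDetSqrtBranch_detSqrt d).sq_eq _ hE
    rw [gaussianConst, norm_div, div_pow, ← norm_pow (detSqrt E), h2, Matrix.det_nonsing_inv,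
      Ring.inverse_eq_inv', norm_inv, Complex.norm_real, Real.norm_of_nonneg (by positivity),
      ← Real.rpow_natCast, ← Real.rpow_mul (by positivity),
      show (d : ℝ) / 2 * (2 : ℕ) = (d : ℕ) by push_cast; ring, Real.rpow_natCast, div_eq_mul_inv]
  have h3 : ‖(E⁻¹).det‖ ≤ d.factorial * m ^ d := by
    have := Matrix.det_le (A := E⁻¹) (abv := NormedField.toAbsoluteValue ℂ) (x := m) hm
    rwa [nsmul_eq_mul, Fintype.card_fin] at this
  have h4 : 0 ≤ ‖gaussianConst E‖ := norm_nonneg _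
  have h5 : ‖gaussianConst E‖ ^ 2 ≤ (2 * Real.pi) ^ d * (d.factorial * m ^ d) := by
    rw [h1]; gcongr
  nlinarith

/-! ### Hessians whose imaginary part is not positive semidefinite -/

namespace UnitPhase

variable {φ v : EuclideanSpace ℝ (Fin d) → ℂ} {T : Set (EuclideanSpace ℝ (Fin d))}
  {n : ℕ} {M B c ε : ℝ}

/-- Choose `Y` on which the form of `Im φ''(0)` has a negative value `a`. On the ray `t Y` the
imaginary part of the phase is at most `a t² / 2 + b t³`, which is negative for small `t > 0`. These
points lie outside `T`, so `F` vanishes there and, by continuity, at the origin. -/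
theorem eq_zero_of_not_posSemidef (h : UnitPhase φ T n M B c ε)
    (hR : ¬ ((hessianZero φ).map Complex.im).PosSemidef) {F : EuclideanSpace ℝ (Fin d) → ℂ}
    (hF : Continuous F) (hT : tsupport F ⊆ T) : F 0 = 0 := by
  have hher : ((hessianZero φ).map Complex.im).IsHermitian := by
    ext i j
    simp [(hessianZero_isSymm h.smooth).apply i j]
  obtain ⟨y, hy⟩ : ∃ y : Fin d → ℝ, y ⬝ᵥ ((hessianZero φ).map Complex.im).mulVec y < 0 := by
    by_contra! hcon
    exact hR (Matrix.PosSemidef.of_dotProduct_mulVec_nonneg hher fun y => by simpa using hcon y)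
  set a := y ⬝ᵥ ((hessianZero φ).map Complex.im).mulVec y with ha
  let Y : EuclideanSpace ℝ (Fin d) := WithLp.toLp 2 y
  have hq : ∀ t : ℝ, (quadForm (hessianZero φ) (t • Y)).im = t ^ 2 * a := by
    intro t
    simp only [quadForm, dotProduct, Matrix.mulVec, complexVec, Finset.mul_sum, Complex.im_sum, ha,
      Matrix.map_apply]
    refine Finset.sum_congr rfl fun i _ => Finset.sum_congr rfl fun j _ => ?_
    simp [Y]
    ring
  set b := (1 + d) ^ 3 * B * ‖Y‖ ^ 3 with hb
  have hB := h.B_nonneg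
  have hb0 : 0 ≤ b := by positivity
  have hg : ∀ t : ℝ, 0 < t → t * ‖Y‖ ≤ 1 → (phaseRemainder φ (t • Y)).im ≤ b * t ^ 3 := by
    intro t ht htY
    have hn : ‖t • Y‖ = t * ‖Y‖ := by rw [norm_smul, Real.norm_of_nonneg ht.le]
    refine ((le_abs_self _).trans (Complex.abs_im_le_norm _)).trans
      ((h.vanishBound.le (by rw [hn]; exact htY)).trans (le_of_eq ?_))
    rw [hn, hb]
    ring
  have key : ∀ᶠ t in nhdsWithin (0 : ℝ) (Set.Ioi 0), F (t • Y) = 0 := by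
    have h1 : ∀ᶠ t in nhdsWithin (0 : ℝ) (Set.Ioi 0), t * ‖Y‖ < 1 :=
      nhdsWithin_le_nhds ((by fun_prop : Continuous fun t : ℝ => t * ‖Y‖).continuousAt.eventually_lt
        continuousAt_const (by simp))
    have h2 : ∀ᶠ t in nhdsWithin (0 : ℝ) (Set.Ioi 0), b * t < -a / 2 :=
      nhdsWithin_le_nhds ((by fun_prop : Continuous fun t : ℝ => b * t).continuousAt.eventually_lt
        continuousAt_const (by simp; linarith))
    filter_upwards [h1, h2, self_mem_nhdsWithin] with t ht1 ht2 ht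
    have ht0 : 0 < t := ht
    refine image_eq_zero_of_notMem_tsupport fun hmem => ?_
    have h3 := h.im_nonneg _ (hT hmem)
    rw [h.phase_eq, Complex.add_im, show (1 / 2 : ℂ) = ((1 / 2 : ℝ) : ℂ) by push_cast; ring,
      Complex.im_ofReal_mul, hq] at h3
    have h4 := hg t ht0 ht1.le
    have h5 : b * t ^ 3 < -a / 2 * t ^ 2 := by
      have := mul_lt_mul_of_pos_right ht2 (pow_pos ht0 2)
      linarith [this, (by ring : b * t * t ^ 2 = b * t ^ 3)]
    linarith
  have hlim : Filter.Tendsto (fun t : ℝ => F (t • Y)) (nhdsWithin 0 (Set.Ioi 0)) (nhds (F 0)) := by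
    have hc : Continuous fun t : ℝ => F (t • Y) := by fun_prop
    have := hc.continuousAt (x := 0)
    rw [ContinuousAt, zero_smul] at this
    exact this.mono_left nhdsWithin_le_nhds
  exact tendsto_nhds_unique hlim (tendsto_const_nhds.congr' (key.mono fun t ht => ht.symm))

theorem phaseFactor_one (h : UnitPhase φ T n M B c ε) (lam : ℝ) (x : EuclideanSpace ℝ (Fin d)) :
    phaseFactor φ lam 1 x = Complex.exp (Complex.I * lam * φ x) := by
  rw [phaseFactor, h.phase_eq x]
  simp

end UnitPhase

/-- Derivatives of `v` are again supported in `T`, so they vanish at the origin too, and each one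
raises the order by integration from the origin. -/
theorem vanishBound_of_forall_eq_zero {T : Set (EuclideanSpace ℝ (Fin d))}
    (hT : ∀ F : EuclideanSpace ℝ (Fin d) → ℂ, Continuous F → tsupport F ⊆ T → F 0 = 0)
    {B : ℝ} (hB : 0 ≤ B) (n p : ℕ) : ∀ v : EuclideanSpace ℝ (Fin d) → ℂ, ContDiff ℝ (⊤ : ℕ∞) v →
      tsupport v ⊆ T → VanishBound B (n + p) 0 v → VanishBound ((1 + d) ^ p * B) (n + p) p v := by
  induction p with
  | zero => intro v _ _ h; simpa using h
  | succ p ih =>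
    intro v sv hv h
    refine (VanishBound.of_partialDeriv sv (hT v sv.continuous hv) (B := (1 + d) ^ p * B)
      (by positivity) fun i => ?_).mono (le_of_eq (by ring)) (by positivity) le_rfl
    exact ih _ (sv.partialDeriv' i) ((tsupport_partialDeriv_subset v i).trans hv) (h.2 i)

theorem contDiff_pow_mul {G v : EuclideanSpace ℝ (Fin d) → ℂ} (sG : ContDiff ℝ (⊤ : ℕ∞) G)
    (sv : ContDiff ℝ (⊤ : ℕ∞) v) (m : ℕ) : ContDiff ℝ (⊤ : ℕ∞) (fun x => G x ^ m * v x) :=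
  (sG.pow m).mul sv

/-- Every term of the expansion is the value at the origin of a continuous function supported in
`tsupport v`, hence zero. The full phase (`s = 1`) is used in the non-stationary estimate; the
quadratic part alone would give an unbounded exponential. -/
theorem exists_norm_integral_sub_le_of_not_posSemidef (d k : ℕ) {M B : ℝ} (hM : 0 ≤ M)
    (hB : 0 ≤ B) : ∃ K : ℝ, 0 ≤ K ∧
      ∀ (φ v : EuclideanSpace ℝ (Fin d) → ℂ) (c ε lam : ℝ), 1 ≤ lam →
        UnitPhase φ (tsupport v) (k + 2) M B c ε → ContDiff ℝ (⊤ : ℕ∞) v →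
        VanishBound B (k + 2 * k) 0 v → ¬ ((hessianZero φ).map Complex.im).PosSemidef →
        (∀ j, spOp φ j v 0 = 0) ∧
        ‖∫ x, Complex.exp (Complex.I * lam * φ x) * v x‖ ≤ K * (lam⁻¹) ^ k := by
  obtain ⟨K, hK, H⟩ := OscFactor.exists_norm_integral_le d hM
    (b₀ := d * 2 ^ (k + 1) + d * (2 ^ (k + 1) * (d * M * ((1 + d) ^ 3 * B)))) (by positivity) k
    (B := (1 + d) ^ (2 * k) * B) (by positivity)
  refine ⟨K, hK, fun φ v c ε lam hlam h sv vv hR => ?_⟩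
  have hT : ∀ F : EuclideanSpace ℝ (Fin d) → ℂ, Continuous F → tsupport F ⊆ tsupport v →
      F 0 = 0 := fun F hF hFT => h.eq_zero_of_not_posSemidef hR hF hFT
  have sG := contDiff_phaseRemainder h.smooth
  refine ⟨fun j => Finset.sum_eq_zero fun p _ => ?_, ?_⟩
  · rw [hT _ ((contDiff_pow_mul sG sv p.2).iterate_quadOp _ p.1).continuous
      ((tsupport_iterate_quadOp_subset _ _ _).trans tsupport_mul_subset_right), mul_zero]
  · have hosc := h.oscFactor hM (lam := lam) (s := 1) (by linarith) zero_le_one le_rfl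
      fun x hx => by
        have := h.im_nonneg x hx
        rw [h.phase_eq x] at this
        simpa using this
    have := H _ lam _ _ _ v hosc hlam h.inv_bound
      (h.vanishBound_phaseDenominator hM zero_le_one le_rfl) sv subset_rfl
      ((vanishBound_of_forall_eq_zero hT hB k (2 * k) v sv subset_rfl vv).of_le (by omega))
    simpa only [h.phaseFactor_one] using this

/-! ### The expansion for dissipative Hessians -/

theorem smul_one_div_I_mem_dissipativeMatrices {R : Matrix (Fin d) (Fin d) ℂ} (hs : R.IsSymm)
    (hu : IsUnit R.det) (hR : (R.map Complex.im).PosSemidef) {lam : ℝ} (hlam : 0 < lam) :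
    (lam : ℂ) • ((1 / Complex.I) • R) ∈ dissipativeMatrices d := by
  refine ⟨?_, ?_, ?_⟩
  · simp [Matrix.IsSymm, hs.eq]
  · have : ((lam : ℂ) • ((1 / Complex.I) • R)).map Complex.re = lam • R.map Complex.im := by
      ext i j
      simp
    rw [this]
    exact hR.smul hlam.le
  · rw [Matrix.det_smul, Matrix.det_smul]
    refine mul_ne_zero (pow_ne_zero _ (by exact_mod_cast hlam.ne'))
      (mul_ne_zero (pow_ne_zero _ (by simp)) hu.ne_zero)

theorem inv_smul_one_div_I {R : Matrix (Fin d) (Fin d) ℂ} (hu : IsUnit R.det) {lam : ℝ}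
    (hlam : 0 < lam) :
    ((lam : ℂ) • ((1 / Complex.I) • R))⁻¹ = (Complex.I / lam) • R⁻¹ := by
  refine Matrix.inv_eq_right_inv ?_
  have : (lam : ℂ) ≠ 0 := by exact_mod_cast hlam.ne'
  rw [smul_smul, Matrix.smul_mul, Matrix.mul_smul, Matrix.mul_nonsing_inv _ hu, smul_smul,
    show (lam : ℂ) * (1 / Complex.I) * (Complex.I / lam) = 1 by field_simp [Complex.I_ne_zero],
    one_smul]

theorem phaseFactor_eq_gaussian_mul (φ : EuclideanSpace ℝ (Fin d) → ℂ) (lam s : ℝ)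
    (x : EuclideanSpace ℝ (Fin d)) :
    phaseFactor φ lam s x = gaussian ((lam : ℂ) • ((1 / Complex.I) • hessianZero φ)) x *
      Complex.exp (s * (Complex.I * lam * phaseRemainder φ x)) := by
  change _ = Complex.exp (-(1 / 2) * quadForm _ x) * _
  rw [phaseFactor, ← Complex.exp_add, quadForm_smul, quadForm_smul]
  congr 1
  rw [one_div Complex.I, Complex.inv_I]
  ring

theorem integrable_intervalIntegral_kernel {a : ℝ → EuclideanSpace ℝ (Fin d) → ℂ}
    (ha : Continuous (Function.uncurry a)) {H : EuclideanSpace ℝ (Fin d) → ℂ} (hH : Continuous H)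
    (hc : HasCompactSupport H) :
    Integrable (Function.uncurry fun s x => a s x * H x)
      ((volume.restrict (Set.uIoc (0 : ℝ) 1)).prod volume) := by
  have hcont : Continuous (Function.uncurry fun s x => a s x * H x) :=
    ha.mul (hH.comp continuous_snd)
  have h1 : IntegrableOn (Function.uncurry fun s x => a s x * H x)
      (Set.uIoc (0 : ℝ) 1 ×ˢ tsupport H) (volume.prod volume) :=
    (hcont.continuousOn.integrableOn_compact (isCompact_Icc.prod hc)).mono_set
      (Set.prod_mono_left (by rw [Set.uIoc_of_le zero_le_one]; exact Set.Ioc_subset_Icc_self))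
  have h2 : IntegrableOn (Function.uncurry fun s x => a s x * H x)
      (Set.uIoc (0 : ℝ) 1 ×ˢ Set.univ) (volume.prod volume) :=
    h1.of_forall_sdiff_eq_zero (measurableSet_uIoc.prod MeasurableSet.univ) fun p hp => by
      have : p.2 ∉ tsupport H := fun h => hp.2 ⟨hp.1.1, h⟩
      simp [Function.uncurry, image_eq_zero_of_notMem_tsupport this]
  rwa [IntegrableOn, ← Measure.prod_restrict, Measure.restrict_univ] at h2

theorem phaseFactor_one_mul_eq (φ v : EuclideanSpace ℝ (Fin d) → ℂ) (lam : ℝ) (n : ℕ)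
    (x : EuclideanSpace ℝ (Fin d)) :
    phaseFactor φ lam 1 x * v x - ∑ m ∈ Finset.range (n + 1),
      (Complex.I * lam) ^ m / m.factorial *
        (gaussian ((lam : ℂ) • ((1 / Complex.I) • hessianZero φ)) x *
          (phaseRemainder φ x ^ m * v x)) =
    ∫ s in (0 : ℝ)..1, ((((1 - s) ^ n / n.factorial : ℝ) : ℂ) * phaseFactor φ lam s x) *
      ((Complex.I * lam) ^ (n + 1) * (phaseRemainder φ x ^ (n + 1) * v x)) := by
  have h := exp_sub_sum_eq_integral (Complex.I * lam * phaseRemainder φ x) n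
  set E := (lam : ℂ) • ((1 / Complex.I) • hessianZero φ) with hE
  rw [intervalIntegral.integral_mul_const]
  simp only [phaseFactor_eq_gaussian_mul φ lam, ← hE]
  simp only [mul_left_comm _ (gaussian E x)]
  rw [intervalIntegral.integral_const_mul]
  calc _ = gaussian E x * (Complex.exp (Complex.I * lam * phaseRemainder φ x) -
      ∑ m ∈ Finset.range (n + 1), (Complex.I * lam * phaseRemainder φ x) ^ m / m.factorial) *
        v x := by
        rw [mul_sub, sub_mul, Complex.ofReal_one, one_mul, Finset.mul_sum, Finset.sum_mul]
        congr 1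
        refine Finset.sum_congr rfl fun m _ => ?_
        rw [mul_pow (Complex.I * lam)]
        ring
    _ = _ := by rw [h, mul_pow (Complex.I * lam)]; ring

namespace UnitPhase

variable {φ v : EuclideanSpace ℝ (Fin d) → ℂ} {T : Set (EuclideanSpace ℝ (Fin d))}
  {n : ℕ} {M B c ε : ℝ}

/-- The phase at `s` is `(1 - s)` times the quadratic part plus `s` times `φ`, a convex combination
of two phases with nonnegative imaginary part. -/
theorem im_interpolation_nonneg (h : UnitPhase φ T n M B c ε)
    (hR : ((hessianZero φ).map Complex.im).PosSemidef) {s : ℝ} (hs0 : 0 ≤ s) (hs1 : s ≤ 1)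
    {x : EuclideanSpace ℝ (Fin d)} (hx : x ∈ T) :
    0 ≤ (1 / 2 * quadForm (hessianZero φ) x + s * phaseRemainder φ x).im := by
  have h1 := h.im_nonneg x hx
  have h2 := re_quadForm_nonneg (smul_one_div_I_mem_dissipativeMatrices
    (hessianZero_isSymm h.smooth) h.isUnit_det hR one_pos) x
  rw [h.phase_eq x] at h1
  rw [quadForm_smul, quadForm_smul, one_div Complex.I, Complex.inv_I] at h2
  have e : ∀ z w : ℂ, (1 / 2 * z + w).im = 1 / 2 * z.im + w.im := fun z w => by
    rw [Complex.add_im, show (1 / 2 : ℂ) = ((1 / 2 : ℝ) : ℂ) by push_cast; ring,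
      Complex.im_ofReal_mul]
  rw [e, Complex.im_ofReal_mul]
  rw [e] at h1
  have h3 : 0 ≤ (quadForm (hessianZero φ) x).im := by simpa using h2
  nlinarith

theorem vanishBound_pow_mul (h : UnitPhase φ T n M B c ε) (sv : ContDiff ℝ (⊤ : ℕ∞) v)
    (hv : VanishBound B n 0 v) (m : ℕ) :
    VanishBound (2 ^ n * ((2 ^ n * ((1 + d) ^ 3 * B)) ^ m * B)) n (3 * m)
      (fun x => phaseRemainder φ x ^ m * v x) := by
  have hB := h.B_nonneg
  have sG := contDiff_phaseRemainder h.smooth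
  exact (h.vanishBound.pow (by positivity) sG m).mul hv (by positivity) hB (sG.pow m) sv

end UnitPhase

/-- The `2 k` factors `g`, each with a zero of order three, give order `6 k = 2 · (3 k)`.
Non-stationary phase then gains `lam^(-3k)`, uniformly in `s`, against the explicit `lam^(2k)`. -/
theorem exists_norm_taylorRemainder_le (d n k : ℕ) (hk : 2 * k = n + 1) {M B : ℝ} (hM : 0 ≤ M)
    (hB : 0 ≤ B) : ∃ K : ℝ, 0 ≤ K ∧
      ∀ (φ v : EuclideanSpace ℝ (Fin d) → ℂ) (c ε lam : ℝ), 1 ≤ lam →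
        UnitPhase φ (tsupport v) (3 * k + 2) M B c ε → ContDiff ℝ (⊤ : ℕ∞) v →
        VanishBound B (3 * k + 2) 0 v → ((hessianZero φ).map Complex.im).PosSemidef →
        ‖(∫ x, Complex.exp (Complex.I * lam * φ x) * v x) - ∑ m ∈ Finset.range (2 * k),
          (Complex.I * lam) ^ m / m.factorial *
            ∫ x, gaussian ((lam : ℂ) • ((1 / Complex.I) • hessianZero φ)) x *
              (phaseRemainder φ x ^ m * v x)‖ ≤ K * (lam⁻¹) ^ k := by
  obtain ⟨K, hK, H⟩ := OscFactor.exists_norm_integral_le d hM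
    (b₀ := d * 2 ^ (3 * k + 1) + d * (2 ^ (3 * k + 1) * (d * M * ((1 + d) ^ 3 * B))))
    (by positivity) (3 * k)
    (B := 2 ^ (3 * k + 2) * ((2 ^ (3 * k + 2) * ((1 + d) ^ 3 * B)) ^ (2 * k) * B)) (by positivity)
  refine ⟨K, hK, fun φ v c ε lam hlam h sv vv hR => ?_⟩
  have hlam0 : 0 < lam := by linarith
  have sG := contDiff_phaseRemainder h.smooth
  have hcv : HasCompactSupport v :=
    (isCompact_closedBall (0 : EuclideanSpace ℝ (Fin d)) ε).of_isClosed_subset h.closed h.subset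
  set E := (lam : ℂ) • ((1 / Complex.I) • hessianZero φ) with hE
  have hcs : ∀ m, HasCompactSupport fun x => phaseRemainder φ x ^ m * v x := fun m => hcv.mul_left
  have hcont : ∀ m, Continuous fun x => phaseRemainder φ x ^ m * v x := fun m =>
    (contDiff_pow_mul sG sv m).continuous
  have hint : ∀ m, Integrable fun x => gaussian E x * (phaseRemainder φ x ^ m * v x) := fun m =>
    ((contDiff_gaussian E).continuous.mul (hcont m)).integrable_of_hasCompactSupport
      (hcs m).mul_left
  have hint1 : Integrable fun x => phaseFactor φ lam 1 x * v x :=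
    ((h.contDiff_phaseFactor lam 1).continuous.mul sv.continuous).integrable_of_hasCompactSupport
      hcv.mul_left
  have hJ : ∀ s ∈ Set.uIoc (0 : ℝ) 1,
      ‖∫ x, ((((1 - s) ^ n / n.factorial : ℝ) : ℂ) * phaseFactor φ lam s x) *
        ((Complex.I * lam) ^ (n + 1) * (phaseRemainder φ x ^ (n + 1) * v x))‖ ≤
      lam ^ (2 * k) * (K * (lam⁻¹) ^ (3 * k)) := by
    intro s hs
    rw [Set.uIoc_of_le zero_le_one] at hs
    have h1 := H _ lam _ _ _ (fun x => phaseRemainder φ x ^ (2 * k) * v x)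
      (h.oscFactor hM hlam0.le hs.1.le hs.2 fun x hx =>
        h.im_interpolation_nonneg hR hs.1.le hs.2 hx) hlam h.inv_bound
      (h.vanishBound_phaseDenominator hM hs.1.le hs.2) (contDiff_pow_mul sG sv _)
      tsupport_mul_subset_right
      (((h.vanishBound_pow_mul sv vv (2 * k)).of_le (by omega)).mono le_rfl (by positivity)
        (by omega))
    have e : (fun x => ((((1 - s) ^ n / n.factorial : ℝ) : ℂ) * phaseFactor φ lam s x) *
        ((Complex.I * lam) ^ (n + 1) * (phaseRemainder φ x ^ (n + 1) * v x))) = fun x =>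
        ((((1 - s) ^ n / n.factorial : ℝ) : ℂ) * (Complex.I * lam) ^ (2 * k)) *
          (phaseFactor φ lam s x * (phaseRemainder φ x ^ (2 * k) * v x)) := by
      ext x
      rw [hk]
      ring
    rw [e, integral_const_mul, norm_mul, norm_mul, norm_pow, norm_mul, Complex.norm_I, one_mul,
      Complex.norm_real, Complex.norm_real, Real.norm_of_nonneg hlam0.le, Real.norm_of_nonneg
      (div_nonneg (pow_nonneg (by linarith [hs.2]) _) (by positivity))]
    have h2 : (1 - s) ^ n / (n.factorial : ℝ) ≤ 1 :=
      div_le_one_of_le₀ ((pow_le_one₀ (by linarith [hs.2]) (by linarith [hs.1])).trans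
        (by exact_mod_cast Nat.one_le_iff_ne_zero.mpr n.factorial_ne_zero)) (by positivity)
    refine mul_le_mul (mul_le_of_le_one_left (by positivity) h2) h1 (norm_nonneg _) (by positivity)
  have hsum : (∫ x, Complex.exp (Complex.I * lam * φ x) * v x) - ∑ m ∈ Finset.range (2 * k),
      (Complex.I * lam) ^ m / m.factorial *
        ∫ x, gaussian E x * (phaseRemainder φ x ^ m * v x) =
      ∫ s in (0 : ℝ)..1, ∫ x, ((((1 - s) ^ n / n.factorial : ℝ) : ℂ) * phaseFactor φ lam s x) *
        ((Complex.I * lam) ^ (n + 1) * (phaseRemainder φ x ^ (n + 1) * v x)) := by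
    -- Fubini puts the spatial integral inside, so that for fixed `s` there is one oscillatory
    -- integral to which the gain applies.
    rw [intervalIntegral_integral_swap (integrable_intervalIntegral_kernel
      (a := fun s x => (((1 - s) ^ n / n.factorial : ℝ) : ℂ) * phaseFactor φ lam s x)
      (H := fun x => (Complex.I * lam) ^ (n + 1) * (phaseRemainder φ x ^ (n + 1) * v x)) ?_
      (continuous_const.mul (hcont (n + 1))) (hcs (n + 1)).mul_left)]
    · simp only [← phaseFactor_one_mul_eq, ← h.phaseFactor_one, ← hE, hk]
      rw [integral_sub hint1 (integrable_finsetSum _ fun m _ => (hint m).const_mul _),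
        integral_finsetSum _ fun m _ => (hint m).const_mul _]
      simp only [integral_const_mul]
    · have hq := (contDiff_quadForm (hessianZero φ)).continuous
      have hg := sG.continuous
      simp only [Function.uncurry_def, phaseFactor]
      fun_prop
  rw [hsum]
  refine (intervalIntegral.norm_integral_le_of_norm_le_const hJ).trans (le_of_eq ?_)
  rw [sub_zero, abs_one, mul_one, inv_pow, inv_pow, show 3 * k = 2 * k + k by ring, pow_add]
  field_simp

/-- The inverse of the Gaussian matrix has size `lam⁻¹`, so each further term of the expansion gains
`lam⁻¹`. Taking `k + m` terms pays for the prefactor `lam^m`. -/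
theorem exists_norm_gaussianTerm_le (d k m : ℕ) {M B : ℝ} (hM : 0 ≤ M)
    (hB : 0 ≤ B) : ∃ K : ℝ, 0 ≤ K ∧
      ∀ (φ v : EuclideanSpace ℝ (Fin d) → ℂ) (c ε lam : ℝ), 1 ≤ lam →
        UnitPhase φ (tsupport v) (2 * (k + m) + fourierLoss d) M B c ε → ContDiff ℝ (⊤ : ℕ∞) v →
        VanishBound B (2 * (k + m) + fourierLoss d) 0 v →
        ((hessianZero φ).map Complex.im).PosSemidef →
        ‖(Complex.I * lam) ^ m / m.factorial *
            (∫ x, gaussian ((lam : ℂ) • ((1 / Complex.I) • hessianZero φ)) x *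
              (phaseRemainder φ x ^ m * v x)) -
          gaussianConst ((lam : ℂ) • ((1 / Complex.I) • hessianZero φ)) *
            ((Complex.I * lam) ^ m / m.factorial * ∑ l ∈ Finset.range (k + m),
              (-(1 / 2)) ^ l / l.factorial * ((Complex.I / lam) ^ l *
                (quadOp (hessianZero φ)⁻¹)^[l] (fun x => phaseRemainder φ x ^ m * v x) 0))‖ ≤
          K * (lam⁻¹) ^ k := by
  obtain ⟨K, hK, H⟩ := exists_integral_pow_mul_fourierInv_le d (2 * (k + m))
  set n := 2 * (k + m) + fourierLoss d with hn
  set Bm := 2 ^ n * ((2 ^ n * ((1 + d) ^ 3 * B)) ^ m * B) with hBm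
  have hBm0 : 0 ≤ Bm := by positivity
  refine ⟨(1 + (2 * Real.pi) ^ d * (d.factorial * M ^ d)) *
    ((2 * Real.pi ^ 2 * (d ^ 2 * M)) ^ (k + m) * (K * Bm)), by positivity,
    fun φ v c ε lam hlam h sv vv hR => ?_⟩
  have hlam0 : 0 < lam := by linarith
  have sG := contDiff_phaseRemainder h.smooth
  have hcv : HasCompactSupport v :=
    (isCompact_closedBall (0 : EuclideanSpace ℝ (Fin d)) ε).of_isClosed_subset h.closed h.subset
  set E := (lam : ℂ) • ((1 / Complex.I) • hessianZero φ) with hE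
  have hEm : E ∈ dissipativeMatrices d :=
    smul_one_div_I_mem_dissipativeMatrices (hessianZero_isSymm h.smooth) h.isUnit_det hR hlam0
  have hinv : E⁻¹ = (Complex.I / lam) • (hessianZero φ)⁻¹ := inv_smul_one_div_I h.isUnit_det hlam0
  have hm1 : ∀ i j, ‖E⁻¹ i j‖ ≤ M / lam := fun i j => by
    rw [hinv, Matrix.smul_apply, smul_eq_mul, norm_mul, norm_div, Complex.norm_I,
      Complex.norm_real, Real.norm_of_nonneg hlam0.le, div_mul_eq_mul_div, one_mul]
    exact div_le_div_of_nonneg_right (h.inv_bound i j) hlam0.le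
  -- The Gaussian constant is only bounded; its decay in `lam` is discarded, since the volume factor
  -- of the rescaling is all that the final estimate asks for.
  have hm2 : ∀ i j, ‖E⁻¹ i j‖ ≤ M := fun i j => (hm1 i j).trans (div_le_self hM hlam)
  have sf := contDiff_pow_mul sG sv m
  have key := norm_integral_gaussian_sub_le hEm sf (hcv.mul_left) hm1 (k + m)
  have hFI := H (fun x => phaseRemainder φ x ^ m * v x) Bm sf
    (tsupport_mul_subset_right.trans (h.subset.trans (Metric.closedBall_subset_closedBall h.le_one)))
    hBm0 ((h.vanishBound_pow_mul sv vv m).mono le_rfl hBm0 (Nat.zero_le _))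
  simp only [hinv, iterate_quadOp_smul sf] at key
  have hfac : ‖(Complex.I * lam) ^ m / (m.factorial : ℂ)‖ ≤ lam ^ m := by
    rw [norm_div, norm_pow, norm_mul, Complex.norm_I, one_mul, Complex.norm_real,
      Real.norm_of_nonneg hlam0.le, Complex.norm_natCast]
    exact div_le_self (by positivity)
      (by exact_mod_cast Nat.one_le_iff_ne_zero.mpr m.factorial_ne_zero)
  rw [mul_left_comm (gaussianConst E), ← mul_sub, norm_mul]
  calc _ ≤ lam ^ m * ((1 + (2 * Real.pi) ^ d * (d.factorial * M ^ d)) *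
      ((2 * Real.pi ^ 2 * (d ^ 2 * (M / lam))) ^ (k + m) * (K * Bm))) := by
        refine mul_le_mul hfac (key.trans ?_) (norm_nonneg _) (by positivity)
        refine mul_le_mul (norm_gaussianConst_le hEm hm2) ?_
          (mul_nonneg (by positivity) (integral_nonneg fun ξ => by positivity)) (by positivity)
        exact mul_le_mul_of_nonneg_left hFI (by positivity)
    _ = _ := by
        rw [show 2 * Real.pi ^ 2 * (d ^ 2 * (M / lam)) = 2 * Real.pi ^ 2 * (d ^ 2 * M) * lam⁻¹ by
          ring, mul_pow _ lam⁻¹, pow_add lam⁻¹, inv_pow lam m]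
        field_simp

theorem UnitPhase.of_le {φ : EuclideanSpace ℝ (Fin d) → ℂ} {T : Set (EuclideanSpace ℝ (Fin d))}
    {n m : ℕ} {M B c ε : ℝ} (h : UnitPhase φ T n M B c ε) (hm : m ≤ n) :
    UnitPhase φ T m M B c ε :=
  { h with bound := fun l hl hl' => h.bound l hl (by omega) }

theorem exists_norm_integral_sub_le_of_posSemidef (d k : ℕ) (hk : 1 ≤ k) {M B : ℝ} (hM : 0 ≤ M)
    (hB : 0 ≤ B) : ∃ K : ℝ, 0 ≤ K ∧
      ∀ (φ v : EuclideanSpace ℝ (Fin d) → ℂ) (c ε lam : ℝ), 1 ≤ lam →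
        UnitPhase φ (tsupport v) (6 * k + fourierLoss d + 2) M B c ε → ContDiff ℝ (⊤ : ℕ∞) v →
        VanishBound B (6 * k + fourierLoss d + 2) 0 v →
        ((hessianZero φ).map Complex.im).PosSemidef →
        ‖(∫ x, Complex.exp (Complex.I * lam * φ x) * v x) -
          gaussianConst ((lam : ℂ) • ((1 / Complex.I) • hessianZero φ)) *
            ∑ j ∈ Finset.range k, ((lam : ℂ)⁻¹) ^ j * spOp φ j v 0‖ ≤ K * (lam⁻¹) ^ k := by
  obtain ⟨K, hK, H⟩ := exists_norm_taylorRemainder_le d (2 * k - 1) k (by omega) hM hB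
  choose K' hK' H' using fun m => exists_norm_gaussianTerm_le d k m hM hB
  refine ⟨K + ∑ m ∈ Finset.range (2 * k), K' m,
    add_nonneg hK (Finset.sum_nonneg fun m _ => hK' m), fun φ v c ε lam hlam h sv vv hR => ?_⟩
  have hlam0 : (lam : ℂ) ≠ 0 := by
    have : lam ≠ 0 := by linarith
    exact_mod_cast this
  have sG := contDiff_phaseRemainder h.smooth
  have h1 := H φ v c ε lam hlam (h.of_le (by omega)) sv (vv.of_le (by omega)) hR
  have hre := sum_rearrange k lam hlam0
    (fun l m => (quadOp (hessianZero φ)⁻¹)^[l] (fun x => phaseRemainder φ x ^ m * v x) 0)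
    fun l m hm hl hlm => iterate_quadOp_zero_of_vanishBound (by positivity) hM h.inv_bound
      (h.vanishBound_pow_mul sv vv m) (contDiff_pow_mul sG sv m) (by omega) hlm
  -- The largest index is `m = 2 k - 1`, whence `2 (k + m) ≤ 6 k`: this fixes the number of
  -- derivatives required.
  have h2 : ∀ m ∈ Finset.range (2 * k), _ := fun m hm => H' m φ v c ε lam hlam
    (h.of_le (by have := Finset.mem_range.mp hm; omega)) sv
    (vv.of_le (by have := Finset.mem_range.mp hm; omega)) hR
  have h3 := norm_sum_le_of_le _ h2
  rw [Finset.sum_sub_distrib, ← Finset.mul_sum, hre] at h3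
  refine (norm_sub_le_norm_sub_add_norm_sub _ _ _).trans ((add_le_add h1 h3).trans (le_of_eq ?_))
  rw [add_mul, Finset.sum_mul]

/-! ### Homogeneity of the branch of `det^{1/2}` -/

theorem smul_mem_dissipativeMatrices {E : Matrix (Fin d) (Fin d) ℂ}
    (hE : E ∈ dissipativeMatrices d) {c : ℝ} (hc : 0 < c) :
    (c : ℂ) • E ∈ dissipativeMatrices d := by
  obtain ⟨h1, h2, h3⟩ := hE
  refine ⟨?_, ?_, ?_⟩
  · simp [Matrix.IsSymm, h1.eq]
  · have : ((c : ℂ) • E).map Complex.re = c • E.map Complex.re := by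
      ext i j
      simp
    rw [this]
    exact h2.smul hc.le
  · rw [Matrix.det_smul]
    exact mul_ne_zero (pow_ne_zero _ (by exact_mod_cast hc.ne')) h3

/-- The function `E ↦ c^(-d/2) detSqrt (c E)` satisfies the defining properties of the branch, so
uniqueness applies. -/
theorem detSqrt_smul {E : Matrix (Fin d) (Fin d) ℂ} (hE : E ∈ dissipativeMatrices d) {c : ℝ}
    (hc : 0 < c) : detSqrt ((c : ℂ) • E) = ((c ^ ((d : ℝ) / 2) : ℝ) : ℂ) * detSqrt E := by
  have hb := isDetSqrtBranch_detSqrt d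
  have hp : 0 < c ^ ((d : ℝ) / 2) := Real.rpow_pos_of_pos hc _
  have hp' : ((c ^ ((d : ℝ) / 2) : ℝ) : ℂ) ≠ 0 := by exact_mod_cast hp.ne'
  have hsq : ((c ^ ((d : ℝ) / 2) : ℝ) : ℂ) ^ 2 = (c : ℂ) ^ d := by
    rw [← Complex.ofReal_pow, ← Complex.ofReal_pow, ← Real.rpow_natCast, ← Real.rpow_mul hc.le,
      show (d : ℝ) / 2 * (2 : ℕ) = (d : ℕ) by push_cast; ring, Real.rpow_natCast]
  have hs : IsDetSqrtBranch fun E : Matrix (Fin d) (Fin d) ℂ =>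
      ((c ^ ((d : ℝ) / 2) : ℝ) : ℂ)⁻¹ * detSqrt ((c : ℂ) • E) := by
    refine ⟨?_, fun E hE => ?_, fun R hR => ?_⟩
    · exact continuousOn_const.mul (hb.continuousOn.comp (continuous_const_smul _).continuousOn
        fun E hE => smul_mem_dissipativeMatrices hE hc)
    · rw [mul_pow, inv_pow, hsq, hb.sq_eq _ (smul_mem_dissipativeMatrices hE hc), Matrix.det_smul,
        Fintype.card_fin, inv_mul_cancel_left₀ (pow_ne_zero _ (by exact_mod_cast hc.ne'))]
    · obtain ⟨r, hr, hr'⟩ := hb.pos (c • R) (hR.smul hc)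
      refine ⟨(c ^ ((d : ℝ) / 2))⁻¹ * r, by positivity, ?_⟩
      have : (c • R).map Complex.ofReal = (c : ℂ) • R.map Complex.ofReal := by
        ext i j
        simp
      rw [← this, hr']
      push_cast
      ring
  rw [← hs.eqOn hb hE, mul_inv_cancel_left₀ hp']

/-! ### Dilations -/

theorem partialDeriv_dilation (f : EuclideanSpace ℝ (Fin d) → ℂ) (r : ℝ) (i : Fin d) :
    partialDeriv i (fun y => f (r • y)) = fun y => (r : ℂ) * partialDeriv i f (r • y) := by
  ext y
  simp [partialDeriv, fderiv_comp_smul]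

theorem contDiff_dilation {f : EuclideanSpace ℝ (Fin d) → ℂ} (hf : ContDiff ℝ (⊤ : ℕ∞) f) (r : ℝ) :
    ContDiff ℝ (⊤ : ℕ∞) fun y => f (r • y) :=
  hf.comp (contDiff_const_smul r)

theorem norm_iteratedFDeriv_dilation {f : EuclideanSpace ℝ (Fin d) → ℂ}
    (hf : ContDiff ℝ (⊤ : ℕ∞) f) {r : ℝ} (hr : 0 ≤ r) (m : ℕ) (x : EuclideanSpace ℝ (Fin d)) :
    ‖iteratedFDeriv ℝ m (fun y => f (r • y)) x‖ = r ^ m * ‖iteratedFDeriv ℝ m f (r • x)‖ := by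
  rw [iteratedFDeriv_comp_const_smul r (hf.of_le (by exact_mod_cast le_top)), norm_smul, norm_pow,
    Real.norm_of_nonneg hr]

theorem opD_dilation {f : EuclideanSpace ℝ (Fin d) → ℂ} (r : ℝ) (i : Fin d) :
    opD i (fun y => f (r • y)) = fun y => (r : ℂ) * opD i f (r • y) := by
  ext y
  simp only [opD, partialDeriv_dilation]
  ring

theorem quadOp_dilation {f : EuclideanSpace ℝ (Fin d) → ℂ} (hf : ContDiff ℝ (⊤ : ℕ∞) f) (r : ℝ)
    (B : Matrix (Fin d) (Fin d) ℂ) :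
    quadOp B (fun y => f (r • y)) = fun y => (r : ℂ) ^ 2 * quadOp B f (r • y) := by
  ext y
  simp only [quadOp, opD_dilation, Finset.mul_sum]
  refine Finset.sum_congr rfl fun i _ => Finset.sum_congr rfl fun j _ => ?_
  rw [opD_const_mul (contDiff_dilation (hf.opD i) r), opD_dilation]
  ring

theorem iterate_quadOp_dilation {f : EuclideanSpace ℝ (Fin d) → ℂ} (hf : ContDiff ℝ (⊤ : ℕ∞) f)
    (r : ℝ) (B : Matrix (Fin d) (Fin d) ℂ) (l : ℕ) :
    (quadOp B)^[l] (fun y => f (r • y)) =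
      fun y => ((r : ℂ) ^ 2) ^ l * (quadOp B)^[l] f (r • y) := by
  induction l with
  | zero => simp
  | succ l ih =>
    rw [Function.iterate_succ_apply', ih,
      quadOp_const_mul (contDiff_dilation (hf.iterate_quadOp B l) r),
      quadOp_dilation (hf.iterate_quadOp B l), Function.iterate_succ_apply']
    ext y
    ring

theorem iterate_quadOp_const_mul {f : EuclideanSpace ℝ (Fin d) → ℂ} (hf : ContDiff ℝ (⊤ : ℕ∞) f)
    (c : ℂ) (B : Matrix (Fin d) (Fin d) ℂ) (l : ℕ) :
    (quadOp B)^[l] (fun x => c * f x) = fun x => c * (quadOp B)^[l] f x := by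
  induction l with
  | zero => rfl
  | succ l ih =>
    rw [Function.iterate_succ_apply', ih, quadOp_const_mul (hf.iterate_quadOp B l),
      Function.iterate_succ_apply']

/-! ### Rescaling of the phase -/

/-- The phase `a (φ(r y) - φ(0))`. -/
def rescaledPhase (a r : ℝ) (φ : EuclideanSpace ℝ (Fin d) → ℂ) (y : EuclideanSpace ℝ (Fin d)) : ℂ :=
  a * (φ (r • y) - φ 0)

section rescale

variable {φ u : EuclideanSpace ℝ (Fin d) → ℂ}

theorem contDiff_rescaledPhase (hφ : ContDiff ℝ (⊤ : ℕ∞) φ) (a r : ℝ) :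
    ContDiff ℝ (⊤ : ℕ∞) (rescaledPhase a r φ) :=
  contDiff_const.mul ((contDiff_dilation hφ r).sub contDiff_const)

theorem partialDeriv_rescaledPhase (hφ : ContDiff ℝ (⊤ : ℕ∞) φ) (a r : ℝ) (i : Fin d) :
    partialDeriv i (rescaledPhase a r φ) = fun y => (a * r : ℂ) * partialDeriv i φ (r • y) := by
  have hs := contDiff_dilation hφ r
  unfold rescaledPhase
  rw [partialDeriv_const_mul (hs.sub contDiff_const).differentiable_of_top,
    partialDeriv_sub hs.differentiable_of_top contDiff_const.differentiable_of_top,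
    partialDeriv_const, partialDeriv_dilation]
  ext y
  ring

theorem hessianZero_rescaledPhase (hφ : ContDiff ℝ (⊤ : ℕ∞) φ) (a r : ℝ) :
    hessianZero (rescaledPhase a r φ) = ((a * r ^ 2 : ℝ) : ℂ) • hessianZero φ := by
  ext i j
  simp only [hessianZero, Matrix.of_apply, Matrix.smul_apply, partialDeriv_rescaledPhase hφ]
  rw [partialDeriv_const_mul (contDiff_dilation (hφ.partialDeriv' j) r).differentiable_of_top,
    partialDeriv_dilation]
  simp only [smul_zero, smul_eq_mul]
  push_cast
  ring

theorem phaseRemainder_rescaledPhase (hφ : ContDiff ℝ (⊤ : ℕ∞) φ) (a r : ℝ) :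
    phaseRemainder (rescaledPhase a r φ) = fun y => (a : ℂ) * phaseRemainder φ (r • y) := by
  ext y
  rw [phaseRemainder, phaseRemainder, hessianZero_rescaledPhase hφ]
  simp only [rescaledPhase, Matrix.smul_apply, smul_eq_mul, PiLp.smul_apply, smul_zero, sub_self,
    mul_zero, sub_zero, mul_sub, Finset.mul_sum]
  congr 1
  refine Finset.sum_congr rfl fun i _ => Finset.sum_congr rfl fun j _ => ?_
  push_cast
  ring

theorem norm_iteratedFDeriv_rescaledPhase (hφ : ContDiff ℝ (⊤ : ℕ∞) φ) {a r : ℝ} (ha : 0 ≤ a)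
    (hr : 0 ≤ r) {m : ℕ} (hm : m ≠ 0) (x : EuclideanSpace ℝ (Fin d)) :
    ‖iteratedFDeriv ℝ m (rescaledPhase a r φ) x‖ =
      a * r ^ m * ‖iteratedFDeriv ℝ m φ (r • x)‖ := by
  have hs := contDiff_dilation hφ r
  have hle : ((m : ℕ∞) : WithTop ℕ∞) ≤ ((⊤ : ℕ∞) : WithTop ℕ∞) := by exact_mod_cast le_top
  have e : rescaledPhase a r φ = fun y => a • (φ (r • y) - φ 0) := by
    ext y
    rw [rescaledPhase, Complex.real_smul]
  rw [e, iteratedFDeriv_const_smul_apply' ((hs.sub contDiff_const).of_le hle).contDiffAt,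
    fun_iteratedFDeriv_sub_apply (hs.of_le hle).contDiffAt contDiff_const.contDiffAt,
    iteratedFDeriv_const_of_ne hm, Pi.zero_apply, sub_zero, norm_smul,
    norm_iteratedFDeriv_dilation hφ hr, Real.norm_of_nonneg ha, mul_assoc]

theorem inv_real_smul (B : Matrix (Fin d) (Fin d) ℂ) {c : ℝ} (hc : c ≠ 0)
    (hB : IsUnit B.det) : ((c : ℂ) • B)⁻¹ = ((c⁻¹ : ℝ) : ℂ) • B⁻¹ := by
  refine Matrix.inv_eq_right_inv ?_
  rw [Matrix.smul_mul, Matrix.mul_smul, Matrix.mul_nonsing_inv _ hB, smul_smul,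
    ← Complex.ofReal_mul, mul_inv_cancel₀ hc, Complex.ofReal_one, one_smul]

/-- Powers of `g` contribute `a^m`, the dilation `r^(2l)`, and the inverse Hessian `(a r²)^(-l)`.
The product is `a^(m-l) = a^(-j)`. -/
theorem spOp_rescaledPhase (hφ : ContDiff ℝ (⊤ : ℕ∞) φ) (hu : ContDiff ℝ (⊤ : ℕ∞) u)
    (hdet : IsUnit (hessianZero φ).det) {a r : ℝ} (ha : a ≠ 0) (hr : r ≠ 0) (j : ℕ) :
    spOp (rescaledPhase a r φ) j (fun y => u (r • y)) 0 = ((a : ℂ)⁻¹) ^ j * spOp φ j u 0 := by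
  have sG := contDiff_phaseRemainder hφ
  have ha' : (a : ℂ) ≠ 0 := by exact_mod_cast ha
  have hr' : (r : ℂ) ≠ 0 := by exact_mod_cast hr
  simp only [spOp, Finset.mul_sum]
  refine Finset.sum_congr rfl fun p hp => ?_
  have hp1 := (mem_spIndex.mp hp).1
  have sf := contDiff_pow_mul sG hu p.2
  have e : (quadOp (hessianZero (rescaledPhase a r φ))⁻¹)^[p.1]
      (fun y => phaseRemainder (rescaledPhase a r φ) y ^ p.2 * u (r • y)) 0 =
      ((a : ℂ)⁻¹) ^ j *
        (quadOp (hessianZero φ)⁻¹)^[p.1] (fun y => phaseRemainder φ y ^ p.2 * u y) 0 := by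
    have e1 : (fun y => phaseRemainder (rescaledPhase a r φ) y ^ p.2 * u (r • y)) = fun y =>
        (a : ℂ) ^ p.2 * (fun y => (fun x => phaseRemainder φ x ^ p.2 * u x) (r • y)) y := by
      ext y
      rw [phaseRemainder_rescaledPhase hφ]
      ring
    rw [e1, iterate_quadOp_const_mul (contDiff_dilation sf r), hessianZero_rescaledPhase hφ,
      inv_real_smul _ (mul_ne_zero ha (pow_ne_zero 2 hr)) hdet,
      iterate_quadOp_smul (contDiff_dilation sf r), iterate_quadOp_dilation sf]
    simp only [smul_zero]
    rw [hp1, pow_add, pow_add]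
    push_cast
    simp only [inv_pow, mul_pow]
    field_simp
  rw [e]
  ring

theorem oscIntegral_eq_rescaled (φ u : EuclideanSpace ℝ (Fin d) → ℂ) {h a r : ℝ} (hh : h ≠ 0)
    (ha : a ≠ 0) (hr : 0 < r) :
    oscIntegral h φ u = ((r ^ d : ℝ) : ℂ) * (Complex.exp (Complex.I / h * φ 0) *
      ∫ y, Complex.exp (Complex.I * ((a * h)⁻¹ : ℝ) * rescaledPhase a r φ y) * u (r • y)) := by
  have h1 := Measure.integral_comp_smul_of_nonneg
    (volume : Measure (EuclideanSpace ℝ (Fin d)))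
    (fun x => Complex.exp (Complex.I / (h : ℂ) * φ x) * u x) r (hR := hr.le)
  rw [finrank_euclideanSpace_fin] at h1
  have hh' : (h : ℂ) ≠ 0 := by exact_mod_cast hh
  have ha' : (a : ℂ) ≠ 0 := by exact_mod_cast ha
  have h2 : ∀ y, Complex.exp (Complex.I / h * φ 0) *
      (Complex.exp (Complex.I * ((a * h)⁻¹ : ℝ) * rescaledPhase a r φ y) * u (r • y)) =
      Complex.exp (Complex.I / h * φ (r • y)) * u (r • y) := by
    intro y
    rw [← mul_assoc, ← Complex.exp_add]
    congr 2
    rw [rescaledPhase]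
    push_cast
    field_simp
    ring
  rw [← integral_const_mul]
  simp only [h2, h1]
  rw [oscIntegral, Complex.real_smul, ← mul_assoc, ← Complex.ofReal_mul,
    mul_inv_cancel₀ (by positivity), Complex.ofReal_one, one_mul]

/-- Homogeneity of the branch turns `(2πh)^(d/2)` into `r^d` times the Gaussian constant, and the
factors `a^(-j)` combine with `(a h)^j` to give back `h^j`. -/
theorem spExpansion_eq_rescaled (hφ : ContDiff ℝ (⊤ : ℕ∞) φ) (hu : ContDiff ℝ (⊤ : ℕ∞) u)
    (hdet : IsUnit (hessianZero φ).det) (hR : ((hessianZero φ).map Complex.im).PosSemidef)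
    {h a r : ℝ} (hh : 0 < h) (ha : 0 < a) (hr : 0 < r) (k : ℕ) :
    spExpansion h φ u k = ((r ^ d : ℝ) : ℂ) * (Complex.exp (Complex.I / h * φ 0) *
      (gaussianConst ((((a * h)⁻¹ : ℝ) : ℂ) •
          ((1 / Complex.I) • hessianZero (rescaledPhase a r φ))) *
        ∑ j ∈ Finset.range k, ((((a * h)⁻¹ : ℝ) : ℂ)⁻¹) ^ j *
          spOp (rescaledPhase a r φ) j (fun y => u (r • y)) 0)) := by
  have ha' : (a : ℂ) ≠ 0 := by exact_mod_cast ha.ne'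
  have hE := smul_one_div_I_mem_dissipativeMatrices (hessianZero_isSymm hφ) hdet hR one_pos
  rw [Complex.ofReal_one, one_smul] at hE
  have hsum : ∑ j ∈ Finset.range k, ((((a * h)⁻¹ : ℝ) : ℂ)⁻¹) ^ j *
      spOp (rescaledPhase a r φ) j (fun y => u (r • y)) 0 =
      ∑ j ∈ Finset.range k, (h : ℂ) ^ j * spOp φ j u 0 := by
    refine Finset.sum_congr rfl fun j _ => ?_
    rw [spOp_rescaledPhase hφ hu hdet ha.ne' hr.ne', ← mul_assoc, ← mul_pow]
    congr 2
    push_cast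
    field_simp
  have hmat : (((a * h)⁻¹ : ℝ) : ℂ) • ((1 / Complex.I) • hessianZero (rescaledPhase a r φ)) =
      ((r ^ 2 / h : ℝ) : ℂ) • ((1 / Complex.I) • hessianZero φ) := by
    rw [hessianZero_rescaledPhase hφ, smul_comm (1 / Complex.I), smul_smul, ← Complex.ofReal_mul]
    congr 2
    field_simp
  have hconst : (2 * Real.pi * h) ^ ((d : ℝ) / 2) =
      r ^ d * ((2 * Real.pi) ^ ((d : ℝ) / 2) / (r ^ 2 / h) ^ ((d : ℝ) / 2)) := by
    rw [Real.div_rpow (by positivity) hh.le, Real.mul_rpow (by positivity) hh.le,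
      ← Real.rpow_natCast r 2, ← Real.rpow_mul hr.le,
      show ((2 : ℕ) : ℝ) * ((d : ℝ) / 2) = (d : ℕ) by push_cast; ring, Real.rpow_natCast]
    have : 0 < h ^ ((d : ℝ) / 2) := Real.rpow_pos_of_pos hh _
    field_simp
  rw [hsum, hmat, gaussianConst, detSqrt_smul hE (by positivity), spExpansion, hconst]
  push_cast
  ring

end rescale

theorem norm_apply_le_norm_toEuclideanCLM (B : Matrix (Fin d) (Fin d) ℂ) (i j : Fin d) :
    ‖B i j‖ ≤ ‖Matrix.toEuclideanCLM (𝕜 := ℂ) B‖ := by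
  have h1 := (Matrix.toEuclideanCLM (𝕜 := ℂ) B).le_opNorm (EuclideanSpace.single j 1)
  rw [PiLp.norm_single, norm_one, mul_one] at h1
  refine le_trans (le_of_eq ?_) ((PiLp.norm_apply_le _ i).trans h1)
  rw [Matrix.ofLp_toEuclideanCLM]
  simp

/-! ### The stationary phase expansion -/

/-- The scaling factors `a = h^{-(2ρ+σ)}`, `r = h^ρ` turn the hypotheses into bounds which are
uniform in `h`. -/
theorem SPHypotheses.unitPhase {n : ℕ} {μ ν σ ρ ε h M B : ℝ} {C A : ℕ → ℝ}
    {φ u : EuclideanSpace ℝ (Fin d) → ℂ} (hμ : 0 ≤ μ) (hσ : 0 ≤ σ) (hρ : ρ = σ + ν + μ)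
    (hh : 0 < h) (hh1 : h ≤ 1) (hε1 : ε ≤ 1)
    (hsmall : d ^ 2 * (1 + d) ^ 2 * |M| * |C 3| * ε ≤ 1 / 2)
    (hB : ∀ m ≤ n + 3, |C m| ≤ B)
    (H : SPHypotheses (n + 3) μ ν σ ρ ε h C A M φ u) :
    UnitPhase (rescaledPhase (h ^ (-(2 * ρ + σ))) (h ^ ρ) φ)
      (tsupport fun y => u (h ^ ρ • y)) n |M| B |C 3| ε := by
  set a := h ^ (-(2 * ρ + σ)) with ha
  set r := h ^ ρ with hr
  have ha0 : 0 < a := Real.rpow_pos_of_pos hh _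
  have hr0 : 0 < r := Real.rpow_pos_of_pos hh _
  have har : a * r ^ 2 = h ^ (-σ) := by
    rw [ha, hr, ← Real.rpow_natCast, ← Real.rpow_mul hh.le, ← Real.rpow_add hh]
    congr 1
    push_cast
    ring
  have hdet : IsUnit (hessianZero φ).det :=
    (Matrix.isUnit_iff_isUnit_det _).mp H.hessian_invertible
  have har0 : a * r ^ 2 ≠ 0 := by positivity
  have hder : ∀ m, 3 ≤ m → m ≤ n + 3 → ∀ x,
      ‖iteratedFDeriv ℝ m (rescaledPhase a r φ) x‖ ≤ |C m| := by
    intro m hm hm' x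
    rw [norm_iteratedFDeriv_rescaledPhase H.phase_smooth ha0.le hr0.le (by omega)]
    have hm3 : (3 : ℝ) ≤ m := by exact_mod_cast hm
    -- The exponent vanishes at `m = 3` and is nonnegative beyond; this is what dictates the choice
    -- of `a`.
    have hpow : a * r ^ m * h ^ (-μ - ν * ((m : ℝ) - 2)) = h ^ ((σ + μ) * ((m : ℝ) - 3)) := by
      rw [ha, hr, ← Real.rpow_natCast, ← Real.rpow_mul hh.le, ← Real.rpow_add hh,
        ← Real.rpow_add hh, hρ]
      congr 1
      ring
    calc a * r ^ m * ‖iteratedFDeriv ℝ m φ (r • x)‖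
        ≤ a * r ^ m * (|C m| * h ^ (-μ - ν * ((m : ℝ) - 2))) := by
          refine mul_le_mul_of_nonneg_left ((H.phase_bound m (by omega) hm' _).trans ?_)
            (by positivity)
          exact mul_le_mul_of_nonneg_right (le_abs_self _) (Real.rpow_nonneg hh.le _)
      _ = |C m| * h ^ ((σ + μ) * ((m : ℝ) - 3)) := by rw [← hpow]; ring
      _ ≤ |C m| * 1 := by
          refine mul_le_mul_of_nonneg_left (Real.rpow_le_one hh.le hh1 ?_) (abs_nonneg _)
          exact mul_nonneg (by linarith) (by linarith)
      _ = |C m| := mul_one _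
  have hT : ∀ y ∈ tsupport (fun y => u (r • y)), r • y ∈ tsupport u :=
    fun y hy => tsupport_comp_subset_preimage u (continuous_const_smul r) hy
  refine ⟨contDiff_rescaledPhase H.phase_smooth a r, by simp [rescaledPhase], fun i => ?_, ?_,
    fun i j => ?_, fun m hm hm' x _ => (hder m hm hm' x).trans (hB m hm'),
    fun x _ => hder 3 le_rfl (by omega) x, isClosed_tsupport _, fun y hy => ?_, hε1, hsmall,
    fun y hy => ?_⟩
  · rw [partialDeriv_rescaledPhase H.phase_smooth]
    simp [H.critical]
  · rw [hessianZero_rescaledPhase H.phase_smooth, Matrix.isUnit_iff_isUnit_det, Matrix.det_smul]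
    exact (IsUnit.mk0 _ (pow_ne_zero _ (by exact_mod_cast har0))).mul hdet
  · rw [hessianZero_rescaledPhase H.phase_smooth, inv_real_smul _ har0 hdet, Matrix.smul_apply,
      smul_eq_mul, norm_mul, Complex.norm_real, har, Real.norm_of_nonneg
      (inv_nonneg.mpr (Real.rpow_nonneg hh.le _))]
    have hp : 0 < h ^ (-σ) := Real.rpow_pos_of_pos hh _
    have h1 := (norm_apply_le_norm_toEuclideanCLM _ i j).trans H.hessian_inv_bound
    calc (h ^ (-σ))⁻¹ * ‖(hessianZero φ)⁻¹ i j‖ ≤ (h ^ (-σ))⁻¹ * (M * h ^ (-σ)) := by gcongr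
      _ = M := by field_simp
      _ ≤ |M| := le_abs_self M
  · have h1 : ‖r • y‖ ≤ ε * r := H.amplitude_support (hT y hy)
    rw [norm_smul, Real.norm_of_nonneg hr0.le, mul_comm] at h1
    simpa using le_of_mul_le_mul_right h1 hr0
  · have h1 := H.im_nonneg _ (hT y hy)
    rw [rescaledPhase, Complex.im_ofReal_mul, Complex.sub_im, H.im_zero, sub_zero]
    exact mul_nonneg ha0.le h1

theorem SPHypotheses.vanishBound {N n : ℕ} {μ ν σ ρ ε h M B : ℝ} {C A : ℕ → ℝ}
    {φ u : EuclideanSpace ℝ (Fin d) → ℂ} (hh : 0 < h) (hn : n ≤ N) (hB : ∀ m ≤ n, |A m| ≤ B)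
    (H : SPHypotheses N μ ν σ ρ ε h C A M φ u) :
    VanishBound B n 0 fun y => u (h ^ ρ • y) := by
  refine VanishBound.of_iteratedFDeriv (contDiff_dilation H.amplitude_smooth _)
    fun m hm x _ => le_trans ?_ (hB m hm)
  rw [norm_iteratedFDeriv_dilation H.amplitude_smooth (Real.rpow_nonneg hh.le _)]
  have hp : (h ^ ρ) ^ m * h ^ (-(ρ * m)) = 1 := by
    rw [← Real.rpow_natCast, ← Real.rpow_mul hh.le, ← Real.rpow_add hh, add_neg_cancel,
      Real.rpow_zero]
  calc (h ^ ρ) ^ m * ‖iteratedFDeriv ℝ m u (h ^ ρ • x)‖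
      ≤ (h ^ ρ) ^ m * (A m * h ^ (-(ρ * m))) :=
        mul_le_mul_of_nonneg_left (H.amplitude_bound m (hm.trans hn) _)
          (pow_nonneg (Real.rpow_nonneg hh.le _) _)
    _ = A m * ((h ^ ρ) ^ m * h ^ (-(ρ * m))) := by ring
    _ = A m := by rw [hp, mul_one]
    _ ≤ |A m| := le_abs_self _

end

/-- Stationary phase for phases depending on the semiclassical parameter `h ∈ (0, 1]`. The smallness
threshold for `ε` does not depend on `k`, and the constant `K` depends on the bounds on finitely many
derivatives only; both are independent of `h`, `φ`, `u`. -/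
theorem theorem1p1 (d : ℕ) (μ ν σ ρ : ℝ) (hμ : 0 ≤ μ) (hν : 0 ≤ ν) (hσ : 0 ≤ σ)
    (hcond : 1 > 5 * μ + 6 * σ + 2 * ν) (hρ : ρ = σ + ν + μ) :
    ∃ ε₀ : ℝ → ℝ → ℝ, (∀ c M, 0 < ε₀ c M) ∧
      ∀ k : ℕ, 1 ≤ k → ∃ N : ℕ, ∀ (C A : ℕ → ℝ) (M : ℝ), ∃ K : ℝ,
        ∀ h : ℝ, 0 < h → h ≤ 1 → ∀ ε : ℝ, 0 < ε → ε ≤ ε₀ (C 3) M →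
          ∀ φ u : EuclideanSpace ℝ (Fin d) → ℂ,
            SPHypotheses N μ ν σ ρ ε h C A M φ u →
              ‖oscIntegral h φ u - spExpansion h φ u k‖ ≤
                K * h ^ ((1 - 5 * μ - 6 * σ - 2 * ν) * k + ρ * d) := by
  -- With `X` the constant in front of `ε` in the smallness condition, `ε ≤ 1 / (1 + 2 X)` yields
  -- both `ε ≤ 1` and `X ε ≤ ½`.
  refine ⟨fun c M => 1 / (1 + 2 * (d ^ 2 * (1 + d) ^ 2 * |M| * |c|)), fun c M => by positivity,
    fun k hk => ?_⟩
  set n := 6 * k + fourierLoss d + 2 with hn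
  refine ⟨n + 3, fun C A M => ?_⟩
  -- A single constant built from finitely many of the bounds, so that `K` depends on those only.
  set B := ∑ m ∈ Finset.range (n + 4), (|C m| + |A m|) with hB
  have hB0 : 0 ≤ B := by positivity
  have hBm : ∀ m ≤ n + 3, |C m| + |A m| ≤ B := fun m hm =>
    Finset.single_le_sum (f := fun m => |C m| + |A m|) (fun i _ => by positivity)
      (Finset.mem_range.mpr (by omega))
  obtain ⟨K₁, hK₁, H₁⟩ := exists_norm_integral_sub_le_of_posSemidef d k hk (abs_nonneg M) hB0
  obtain ⟨K₂, hK₂, H₂⟩ := exists_norm_integral_sub_le_of_not_posSemidef d k (abs_nonneg M) hB0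
  refine ⟨K₁ + K₂, fun h hh hh1 ε hε hεle φ u H => ?_⟩
  set X := d ^ 2 * (1 + d) ^ 2 * |M| * |C 3| with hX
  have hX0 : 0 ≤ X := by positivity
  have hε' : ε * (1 + 2 * X) ≤ 1 := by rwa [le_div_iff₀ (by positivity)] at hεle
  have hεX : 0 ≤ ε * X := by positivity
  have hunit := H.unitPhase hμ hσ hρ hh hh1 (by linarith) (by linarith)
    fun m hm => (le_add_of_nonneg_right (abs_nonneg _)).trans (hBm m hm)
  have hv := H.vanishBound hh (Nat.le_add_right n 3)
    fun m hm => (le_add_of_nonneg_left (abs_nonneg _)).trans (hBm m (by omega))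
  have sv := contDiff_dilation H.amplitude_smooth (h ^ ρ)
  have hφ := H.phase_smooth
  have hdet : IsUnit (hessianZero φ).det :=
    (Matrix.isUnit_iff_isUnit_det _).mp H.hessian_invertible
  set a := h ^ (-(2 * ρ + σ)) with ha
  set r := h ^ ρ with hr
  have ha0 : 0 < a := Real.rpow_pos_of_pos hh _
  have hr0 : 0 < r := Real.rpow_pos_of_pos hh _
  have hah : a * h = h ^ (1 - 2 * ρ - σ) := by
    rw [ha]
    nth_rw 2 [← Real.rpow_one h]
    rw [← Real.rpow_add hh]
    congr 1
    ring
  -- The condition on the exponents enters here: `1 - 2ρ - σ = 1 - 2μ - 2ν - 3σ` is nonnegative, so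
  -- the parameter is at least one.
  have hlam : 1 ≤ (a * h)⁻¹ := by
    rw [one_le_inv₀ (by positivity), hah]
    exact Real.rpow_le_one hh.le hh1 (by rw [hρ]; linarith)
  have hexp : ‖Complex.exp (Complex.I / h * φ 0)‖ = 1 := by
    have : Complex.I / h * φ 0 = (((φ 0).re / h : ℝ) : ℂ) * Complex.I := by
      conv_lhs => rw [← Complex.re_add_im (φ 0), H.im_zero]
      push_cast
      ring
    rw [this, Complex.norm_exp_ofReal_mul_I]
  have hfinal : ∀ z : ℂ, ∀ K, K ≤ K₁ + K₂ → ‖z‖ ≤ K * ((a * h)⁻¹⁻¹) ^ k →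
      ‖((r ^ d : ℝ) : ℂ) * (Complex.exp (Complex.I / h * φ 0) * z)‖ ≤
        (K₁ + K₂) * h ^ ((1 - 5 * μ - 6 * σ - 2 * ν) * k + ρ * d) := by
    intro z K hK hz
    have e : r ^ d * (a * h) ^ k = h ^ ((1 - 2 * ρ - σ) * k + ρ * d) := by
      rw [hah, hr, ← Real.rpow_natCast, ← Real.rpow_natCast, ← Real.rpow_mul hh.le,
        ← Real.rpow_mul hh.le, ← Real.rpow_add hh, add_comm]
    rw [inv_inv] at hz
    rw [norm_mul, norm_mul, hexp, one_mul, Complex.norm_real,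
      Real.norm_of_nonneg (pow_nonneg hr0.le d)]
    calc r ^ d * ‖z‖ ≤ r ^ d * ((K₁ + K₂) * (a * h) ^ k) := by
          refine mul_le_mul_of_nonneg_left (hz.trans ?_) (by positivity)
          exact mul_le_mul_of_nonneg_right hK (by positivity)
      _ = (K₁ + K₂) * h ^ ((1 - 2 * ρ - σ) * k + ρ * d) := by rw [← e]; ring
      _ ≤ _ := by
          refine mul_le_mul_of_nonneg_left (Real.rpow_le_rpow_of_exponent_ge hh hh1 ?_)
            (by positivity)
          -- The argument gives the exponent `1 - 2μ - 3σ - 2ν` per order, which is no smaller than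
          -- the one required.
          have : (1 - 5 * μ - 6 * σ - 2 * ν) * (k : ℝ) ≤ (1 - 2 * ρ - σ) * k :=
            mul_le_mul_of_nonneg_right (by rw [hρ]; linarith) (Nat.cast_nonneg k)
          linarith
  rw [oscIntegral_eq_rescaled φ u hh.ne' ha0.ne' hr0]
  have hiff : (hessianZero (rescaledPhase a r φ)).map Complex.im =
      (a * r ^ 2) • (hessianZero φ).map Complex.im := by
    rw [hessianZero_rescaledPhase hφ]
    ext i j
    simp only [Matrix.map_apply, Matrix.smul_apply, smul_eq_mul, Complex.im_ofReal_mul]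
  -- Since `Im φ''(0) = Re (φ''(0) / i)`, this decides whether the matrix lies in the domain of the
  -- branch; scaling by `a r² > 0` does not affect the alternative.
  by_cases hR : ((hessianZero φ).map Complex.im).PosSemidef
  · rw [spExpansion_eq_rescaled hφ H.amplitude_smooth hdet hR hh ha0 hr0, ← mul_sub, ← mul_sub]
    exact hfinal _ K₁ (by linarith) (H₁ _ _ _ _ _ hlam hunit sv hv
      (by rw [hiff]; exact hR.smul (by positivity)))
  · obtain ⟨h0, h1⟩ := H₂ _ _ _ _ _ hlam (hunit.of_le (by omega)) sv (hv.of_le (by omega))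
      fun hcon => hR (by
        have := hcon.smul (inv_nonneg.mpr (by positivity : 0 ≤ a * r ^ 2))
        rwa [hiff, smul_smul, inv_mul_cancel₀ (by positivity), one_smul] at this)
    have h2 : spExpansion h φ u k = 0 := by
      have : ∀ j, spOp φ j u 0 = 0 := fun j => by
        have h3 := h0 j
        rw [spOp_rescaledPhase hφ H.amplitude_smooth hdet ha0.ne' hr0.ne'] at h3
        exact (mul_eq_zero.mp h3).resolve_left
          (pow_ne_zero _ (inv_ne_zero (by exact_mod_cast ha0.ne')))
      simp [spExpansion, this]
    rw [h2, sub_zero]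
    exact hfinal _ K₂ (by linarith) h1
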